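/- Let $n\ge 1$, and let $\phi\in C_c^\infty(\mathbb R^n)$ be a non-negative radial function, supported in $\{|x|\le 1/4\}$, with $\int\phi=1$; put $\phi_k(x)=2^{-kn}\phi(2^{-k}x)$ for $k\in\mathbb Z$. Let $K:\mathbb R^n\to\mathbb C$ be a measurable kernel and $C_K$ a constant with $$|K(x)|\le \frac{C_K}{|x|^n}\quad(x\ne 0),\qquad \int_{\varepsilon<|x|<R}K(x)\,dx=0\quad(0<\varepsilon,R<\infty).$$ No regularity of $K$ is assumed. Let $K_k=K\chi_{|\cdot|\le 2^k}$, and let $\phi_k*K_k(x)=\lim_{\varepsilon\to0^+}\phi_k*(K_k\chi_{|\cdot|>\varepsilon})(x)$ in the principal value sense. For locally integrable $f:\mathbb R^n\to\mathbb C$ put $Sf=\big(\sum_{k\in\mathbb Z}|\phi_k*K_k*f|^2\big)^{1/2}$, and let $$\mathcal M_S f(x)=\sup_{Q\ni x}\operatorname*{ess\,sup}_{\xi\in Q}|S(f\chi_{\mathbb R^n\setminus 3Q})(\xi)|$$ be its grand maximal truncated operator. All cubes $Q$ have edges parallel to the axes, and $3Q$ is the cube concentric with $Q$ of three times the side length.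 There is a constant $c$, depending only on $n$ and $\phi$, such that for every such $K$ the limits defining $\phi_k*K_k(x)$ exist for all $k\in\mathbb Z$, $x\in\mathbb R^n$, and the following hold. 1. Size condition: $|\phi_k*K_k(x)|\le c\,C_K\,2^{-kn}$ for all $k\in\mathbb Z$ and $x\ne0$. Lipschitz condition: for $0<2|y|\le|x|$ and $0<\gamma\le1$ (in particular $\gamma=1$), $$\sum_{k\in\mathbb Z}|\phi_k*K_k(x-y)-\phi_k*K_k(x)|\le c\,C_K\frac{|y|^\gamma}{|x|^{n+\gamma}}.$$ 2. $\|Sf\|_{L^2}\le c\,C_K\|f\|_{L^2}$ for $f\in L^2$; and $\|Sf\|_{L^{1,\infty}}\le c\,C_K\|f\|_{L^1}$, $\|\mathcal M_S f\|_{L^{1,\infty}}\le c\,C_K\|f\|_{L^1}$ for $f\in L^1$, where $\|g\|_{L^{1,\infty}}=\sup_{t>0}t\,|\{|g|>t\}|$. 3. For every $1<p<\infty$ there is a constant $c'$, depending only on $p$, $n$ and $\phi$, such that for every such $K$, every $w\in A_p$ and every $f\in L^p(w)$ $$\|Sf\|_{L^p(w)}\le c'\,C_K\,\{w\}_{A_p}\,\|f\|_{L^p(w)}.$$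 Here $w\in A_p$ means that $w\ge0$ is locally integrable and, with $p'=p/(p-1)$ and the supremum over all cubes, $$[w]_{A_p}=\sup_Q\Big(\frac1{|Q|}\int_Q w\Big)\Big(\frac1{|Q|}\int_Q w^{1-p'}\Big)^{p-1}<\infty,$$ and $$\{w\}_{A_p}=[w]_{A_p}^{1/p}\max\big\{[w]_{A_\infty}^{1/p'},[w^{1-p'}]_{A_\infty}^{1/p}\big\},\qquad [w]_{A_\infty}=\sup_Q\frac1{w(Q)}\int_Q M(w\chi_Q)\,dx,$$ where $w(Q)=\int_Q w$ and $Mg(x)=\sup_{Q\ni x}\frac1{|Q|}\int_Q|g|$ is the Hardy--Littlewood maximal function over cubes. -/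

import Mathlib

open MeasureTheory Filter Topology Set
open scoped ENNReal NNReal ContDiff Convolution

noncomputable section

namespace RoughSquare

/-- The Euclidean space `ℝⁿ`. -/
abbrev Rn (n : ℕ) : Type := EuclideanSpace ℝ (Fin n)

/-- A profile `φ`: a non-negative radial smooth function, supported in `{|x| ≤ 1/4}`,
with integral one. -/
structure IsProfile {n : ℕ} (φ : Rn n → ℝ) : Prop where
  smooth : ContDiff ℝ ∞ φ
  nonneg : ∀ x, 0 ≤ φ x
  radial : ∀ x y, ‖x‖ = ‖y‖ → φ x = φ y
  supp : ∀ x, φ x ≠ 0 → ‖x‖ ≤ 1 / 4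
  integral_eq_one : ∫ x, φ x = 1

/-- The dilates `φ_k(x) = 2^{-kn} φ(2^{-k} x)`. -/
def dilate {n : ℕ} (φ : Rn n → ℝ) (k : ℤ) (x : Rn n) : ℝ :=
  (2 : ℝ) ^ (-(k * (n : ℤ))) * φ ((2 : ℝ) ^ (-k) • x)

/-- A (measurable) kernel `K` on `ℝⁿ` with the size bound `|K(x)| ≤ C / |x|ⁿ` off the origin and
mean value zero over all annuli. No regularity is asked for. -/
structure IsRoughKernel {n : ℕ} (K : Rn n → ℂ) (C : ℝ) : Prop where
  meas : AEStronglyMeasurable K volume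
  size : ∀ x, x ≠ 0 → ‖K x‖ ≤ C / ‖x‖ ^ n
  cancel : ∀ ε R : ℝ, 0 < ε → 0 < R → ∫ x in {x : Rn n | ε < ‖x‖ ∧ ‖x‖ < R}, K x = 0

/-- The truncated kernel `K_k = K χ_{|·| ≤ 2^k}`. -/
def truncKernel {n : ℕ} (K : Rn n → ℂ) (k : ℤ) : Rn n → ℂ :=
  {x : Rn n | ‖x‖ ≤ (2 : ℝ) ^ k}.indicator K

/-- The convolution `(φ_k * (K_k χ_{|·| > ε}))(x)`, whose kernel has no singularity. -/
def epsConv {n : ℕ} (φ : Rn n → ℝ) (K : Rn n → ℂ) (k : ℤ) (ε : ℝ) (x : Rn n) : ℂ :=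
  (dilate φ k ⋆[ContinuousLinearMap.lsmul ℝ ℝ, volume]
    ({z : Rn n | ε < ‖z‖}.indicator (truncKernel K k))) x

/-- The function `φ_k * K_k`. As `K_k` need not be integrable at the origin, it acts as a principal
value: `φ_k * K_k (x) = lim_{ε → 0+} (φ_k * (K_k χ_{|·| > ε}))(x)`. -/
def smoothKernel {n : ℕ} (φ : Rn n → ℝ) (K : Rn n → ℂ) (k : ℤ) (x : Rn n) : ℂ :=
  limUnder (𝓝[>] (0 : ℝ)) (fun ε => epsConv φ K k ε x)

/-- The square function `(∑_{k ∈ ℤ} |φ_k * K_k * f|²)^{1/2}`, with values in `[0, ∞]`. -/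
def squareFn {n : ℕ} (φ : Rn n → ℝ) (K : Rn n → ℂ) (f : Rn n → ℂ) (x : Rn n) : ℝ≥0∞ :=
  (∑' k : ℤ,
    ‖(smoothKernel φ K k ⋆[ContinuousLinearMap.mul ℂ ℂ, volume] f) x‖ₑ ^ 2) ^ (1 / 2 : ℝ)

/-- The closed cube with edges parallel to the axes, centre `c` and side length `2 r`. -/
def cube {n : ℕ} (c : Rn n) (r : ℝ) : Set (Rn n) := {x | ∀ i, |x i - c i| ≤ r}

/-- The grand maximal truncated operator
`M_U f(x) = sup_{Q ∋ x} ess sup_{ξ ∈ Q} |U(f χ_{ℝⁿ \ 3Q})(ξ)|`. -/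
def grandMaximal {n : ℕ} (U : (Rn n → ℂ) → Rn n → ℝ≥0∞) (f : Rn n → ℂ) (x : Rn n) : ℝ≥0∞ :=
  ⨆ (c : Rn n) (r : ℝ) (_ : 0 < r) (_ : x ∈ cube c r),
    essSup (U ((cube c (3 * r))ᶜ.indicator f)) (volume.restrict (cube c r))

/-- The quasi-norm of `L^{1,∞}(ℝⁿ)`: `sup_{t > 0} t |{x : g(x) > t}|`. -/
def weakL1 {n : ℕ} (g : Rn n → ℝ≥0∞) : ℝ≥0∞ :=
  ⨆ t : ℝ≥0, (t : ℝ≥0∞) * volume {x | (t : ℝ≥0∞) < g x}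

/-- The Hardy--Littlewood maximal function over cubes. -/
def hlMaximal {n : ℕ} (g : Rn n → ℝ≥0∞) (x : Rn n) : ℝ≥0∞ :=
  ⨆ (c : Rn n) (r : ℝ) (_ : 0 < r) (_ : x ∈ cube c r),
    (∫⁻ y in cube c r, g y) / volume (cube c r)

/-- The conjugate weight `w^{1-p'}`, where `p' = p/(p-1)`; it is `∞` where `w` vanishes. -/
def dualWeight {n : ℕ} (p : ℝ) (w : Rn n → ℝ≥0∞) (x : Rn n) : ℝ≥0∞ :=
  w x ^ (1 - p.conjExponent)

/-- `[w]_{A_p} = sup_Q (|Q|⁻¹ ∫_Q w) (|Q|⁻¹ ∫_Q w^{1-p'})^{p-1}`. -/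
def apConst {n : ℕ} (p : ℝ) (w : Rn n → ℝ≥0∞) : ℝ≥0∞ :=
  ⨆ (c : Rn n) (r : ℝ) (_ : 0 < r),
    ((∫⁻ x in cube c r, w x) / volume (cube c r)) *
      ((∫⁻ x in cube c r, dualWeight p w x) / volume (cube c r)) ^ (p - 1)

/-- `[w]_{A_∞} = sup_Q w(Q)⁻¹ ∫_Q M(w χ_Q)`. -/
def aInftyConst {n : ℕ} (w : Rn n → ℝ≥0∞) : ℝ≥0∞ :=
  ⨆ (c : Rn n) (r : ℝ) (_ : 0 < r),
    (∫⁻ x in cube c r, hlMaximal ((cube c r).indicator w) x) / ∫⁻ x in cube c r, w x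

/-- `{w}_{A_p} = [w]_{A_p}^{1/p} max([w]_{A_∞}^{1/p'}, [w^{1-p'}]_{A_∞}^{1/p})`. -/
def braceConst {n : ℕ} (p : ℝ) (w : Rn n → ℝ≥0∞) : ℝ≥0∞ :=
  apConst p w ^ (1 / p) *
    max (aInftyConst w ^ (1 / p.conjExponent)) (aInftyConst (dualWeight p w) ^ (1 / p))

/-- A real-valued weight, seen as a function with values in `[0, ∞]`. -/
def toWeight {n : ℕ} (w : Rn n → ℝ) (x : Rn n) : ℝ≥0∞ := ENNReal.ofReal (w x)

/-- `w ∈ A_p`: a non-negative locally integrable function with `[w]_{A_p} < ∞`. -/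
structure IsApWeight {n : ℕ} (p : ℝ) (w : Rn n → ℝ) : Prop where
  nonneg : ∀ x, 0 ≤ w x
  locInt : LocallyIntegrable w volume
  finite : apConst p (toWeight w) < ⊤

/-- The measure `w(x) dx`. -/
def weightMeasure {n : ℕ} (w : Rn n → ℝ) : Measure (Rn n) := volume.withDensity (toWeight w)

end RoughSquare

end

open RoughSquare

open RoughSquare

/-! Although `K` is rough, the kernels ψ_k = φ_k * K_k are not. Because `K` has mean zero over
annuli, the principal value equals the integral over |z| ≤ 2^k of (φ_k(x-z) - φ_k(x)) K(z). The
difference vanishes to first order at z = 0, which makes |z|^{-n} integrable (`pvKernel`,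
`tendsto_epsConv`). So ψ_k lives on |x| ≤ 2·2^k, has size 2^{-kn} and Lipschitz constant
2^{-k(n+1)}, and has integral zero (`exists_isKernelFamily`). Only these four facts, recorded in
`IsKernelFamily`, are used afterwards: S is a smooth Littlewood–Paley square function, and by
homogeneity its constant may be taken to be one.

The Lipschitz bounds sum geometrically over the scales that reach x (`tsum_sub_le`). Mean zero and
Lipschitz regularity bound the Fourier transform of ψ_k by a multiple of min(2^k|ξ|, (2^k|ξ|)^{-1}),
which is square summable in k uniformly in ξ; Plancherel gives the L² bound. The weak type bound is
the Calderón–Zygmund argument, with the summed regularity as Hörmander condition. For the grand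
maximal operator, S(f χ_{(3Q)^c}) oscillates on Q by at most a multiple of Mf, so one large value
makes Sf or S(f χ_{3Q}) large at every point of Q; a measure count excludes this unless Mf or M of a
level set of Sf is large (`grandMaximal_subset`).

The weighted bound goes through sparse domination. The set where S or its grand maximal operator
exceeds a large multiple of the average of |f| over 3Q is a small part of Q. A Calderón–Zygmund
decomposition of its indicator gives children of total measure at most |Q|/2 (`exists_children`),
and iteration dominates S by a sum of averages over dilates 3Q (`sparse_domination`). The dilates
split into 3^n colours, each laminar (`tcube_nested`).

For a laminar family, stopping sets for both functions and the Carleson embedding reduce the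
bilinear form to testing on indicators (`bilinear_bound`). In `testing_bound` the sets are sorted by
the size of the local A_p product and of the σ-average; inside a class w inherits the Carleson
property of Lebesgue measure, so testing costs only [w]_{A_p}^{1/p}. The A_∞ constants enter as
Carleson constants of the two weights over a sparse family (`IsWeight.sum_tcube_le`), with the
exponents 1/p and 1/p'. Exhausting the space by cubes finishes the proof. -/

namespace RoughSquare

/-! ### Separated sums, stopping families and the Carleson embedding -/

/-- The sum of the geometric series of ratio `2^{-s}`. -/
noncomputable def geomConst (s : ℝ) : ℝ≥0∞ := ∑' k : ℕ, ((2 : ℝ≥0∞) ^ (-s)) ^ k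

lemma two_rpow_neg_lt_one {s : ℝ} (hs : 0 < s) : (2 : ℝ≥0∞) ^ (-s) < 1 :=
  ENNReal.rpow_lt_one_of_one_lt_of_neg (by norm_num) (by linarith)

lemma geomConst_ne_top {s : ℝ} (hs : 0 < s) : geomConst s ≠ ⊤ := by
  rw [geomConst, ENNReal.tsum_geometric]
  simpa [tsub_eq_zero_iff_le] using two_rpow_neg_lt_one hs

lemma geomConst_eq (s : ℝ) : geomConst s = 1 + (2 : ℝ≥0∞) ^ (-s) * geomConst s := by
  conv_lhs => rw [geomConst, tsum_eq_zero_add' ENNReal.summable]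
  simp [geomConst, pow_succ', ENNReal.tsum_mul_left]

/-- Remove the largest member: separation puts the others below half of it, so they contribute at
most 2^{-s} times the same bound, and `geomConst_eq` closes the induction. Finiteness is needed
because infinite values would count as separated from each other. -/
lemma sum_rpow_le_of_separated {ι : Type*} {s : ℝ} (hs : 0 < s) (T : Finset ι) (a : ι → ℝ≥0∞)
    (hfin : ∀ i ∈ T, a i ≠ ⊤)
    (hsep : ∀ i ∈ T, ∀ j ∈ T, i ≠ j → 2 * a i ≤ a j ∨ 2 * a j ≤ a i) :
    ∀ M : ℝ≥0∞, (∀ i ∈ T, a i ≤ M) → ∑ i ∈ T, a i ^ s ≤ geomConst s * M ^ s := by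
  classical
  induction T using Finset.induction_on_max_value a with
  | empty => simp
  | insert m T hm hmax ih =>
    intro M hM
    have h1 : ∀ i ∈ T, a i ≤ a m / 2 := by
      intro i hi
      have hne : i ≠ m := fun h => hm (h ▸ hi)
      rw [ENNReal.le_div_iff_mul_le (by simp) (by simp), mul_comm]
      rcases hsep i (by simp [hi]) m (by simp) hne with h | h
      · exact h
      · have h2 := hmax i hi
        have h3 : 2 * a m ≤ a m := h.trans h2
        have hmt := hfin m (by simp)
        have : a m = 0 := by
          rw [two_mul] at h3
          by_contra h0
          exact absurd h3 (not_le.2 (ENNReal.lt_add_right hmt h0))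
        have h4 : a i = 0 := by simpa [this] using h2
        simp [h4]
    have h2 := ih (fun i hi => hfin i (by simp [hi]))
      (fun i hi j hj => hsep i (by simp [hi]) j (by simp [hj])) _ h1
    rw [Finset.sum_insert hm]
    calc a m ^ s + ∑ i ∈ T, a i ^ s ≤ a m ^ s + geomConst s * (a m / 2) ^ s := by gcongr
      _ = geomConst s * a m ^ s := by
        rw [div_eq_mul_inv, ENNReal.mul_rpow_of_nonneg _ _ hs.le, ENNReal.inv_rpow,
          ← ENNReal.rpow_neg]
        conv_rhs => rw [geomConst_eq]
        ring
      _ ≤ _ := by gcongr; exact hM m (by simp)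

/-- Any two members are nested or disjoint. -/
def Laminar {X : Type*} (S : Finset (Set X)) : Prop :=
  ∀ Q ∈ S, ∀ R ∈ S, Q ⊆ R ∨ R ⊆ Q ∨ Disjoint Q R

lemma Laminar.mono {X : Type*} {S T : Finset (Set X)} (h : Laminar S) (hT : T ⊆ S) : Laminar T :=
  fun Q hQ R hR => h Q (hT hQ) R (hT hR)

/-- Induction on `S` by removing a minimal set: the stopping family of the rest is kept, and the
minimal set is added only if no stopping superset controls its value. Being minimal, it never
becomes a strict superset of a set already chosen. -/
lemma exists_stopping_aux {X : Type*} (a : Set X → ℝ≥0∞) (S : Finset (Set X)) :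
    ∃ T ⊆ S, (∀ F ∈ T, ∀ R ∈ T, F ⊂ R → 2 * a R < a F) ∧
      ∀ Q ∈ S, ∃ R ∈ T, Q ⊆ R ∧ a Q ≤ 2 * a R := by
  classical
  induction S using Finset.strongInduction with
  | H S ih =>
    rcases S.eq_empty_or_nonempty with rfl | hne
    · exact ⟨∅, by simp⟩
    obtain ⟨x, hx⟩ := Finset.exists_minimal hne
    have hxS : x ∈ S := hx.1
    obtain ⟨T, hTS, h1, h2⟩ := ih (S.erase x) (Finset.erase_ssubset hxS)
    have hTS' : T ⊆ S := hTS.trans (Finset.erase_subset _ _)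
    by_cases hex : ∃ R ∈ T, x ⊆ R ∧ a x ≤ 2 * a R
    · refine ⟨T, hTS', h1, fun Q hQ => ?_⟩
      by_cases hQx : Q = x
      · rw [hQx]; exact hex
      · exact h2 Q (by simp [hQ, hQx])
    · push Not at hex
      refine ⟨insert x T, ?_, ?_, ?_⟩
      · intro y hy
        rcases Finset.mem_insert.1 hy with rfl | hy
        · exact hxS
        · exact hTS' hy
      · intro F hF R hR hFR
        rcases Finset.mem_insert.1 hR with rfl | hR
        · rcases Finset.mem_insert.1 hF with rfl | hF
          · exact absurd rfl hFR.ne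
          · exact absurd (hx.2 (hTS' hF) hFR.subset) (not_subset_of_ssubset hFR)
        · rcases Finset.mem_insert.1 hF with hF' | hF'
          · rw [hF'] at hFR ⊢
            exact hex R (by assumption) hFR.subset
          · exact h1 F hF' R (by assumption) hFR
      · intro Q hQ
        by_cases hQx : Q = x
        · exact ⟨x, by simp, by simp [hQx], by rw [hQx, two_mul]; exact le_self_add⟩
        · obtain ⟨R, hR, h⟩ := h2 Q (by simp [hQ, hQx])
          exact ⟨R, by simp [hR], h⟩

/-- Stopping families with the projection of every set on its smallest stopping superset. -/
lemma Laminar.exists_stopping {X : Type*} {S : Finset (Set X)} (hS : Laminar S)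
    (hne : ∀ Q ∈ S, Q.Nonempty) (a : Set X → ℝ≥0∞) :
    ∃ T ⊆ S, ∃ π : Set X → Set X, (∀ F ∈ T, ∀ R ∈ T, F ⊂ R → 2 * a R < a F) ∧
      ∀ Q ∈ S, π Q ∈ T ∧ Q ⊆ π Q ∧ a Q ≤ 2 * a (π Q) ∧ ∀ R ∈ T, Q ⊆ R → π Q ⊆ R := by
  classical
  obtain ⟨T, hTS, h1, h2⟩ := exists_stopping_aux a S
  have key : ∀ Q ∈ S, ∃ F ∈ T, Q ⊆ F ∧ a Q ≤ 2 * a F ∧ ∀ R ∈ T, Q ⊆ R → F ⊆ R := by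
    intro Q hQ
    obtain ⟨R₀, hR₀, hQR₀, haR₀⟩ := h2 Q hQ
    obtain ⟨F, hF⟩ := Finset.exists_minimal (s := T.filter (Q ⊆ ·)) ⟨R₀, by simp [hR₀, hQR₀]⟩
    have hFm := Finset.mem_filter.1 hF.1
    have hmin : ∀ R ∈ T, Q ⊆ R → F ⊆ R := by
      intro R hR hQR
      rcases hS F (hTS hFm.1) R (hTS hR) with h | h | h
      · exact h
      · exact hF.2 (by simp [hR, hQR]) h
      · exact absurd (h hFm.2 hQR) (by simpa [← Set.nonempty_iff_ne_empty] using hne Q hQ)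
    refine ⟨F, hFm.1, hFm.2, ?_, hmin⟩
    -- The stopping set that controls `a Q` need not be the smallest one. If `F` lies strictly
    -- inside it, growth makes `a F` larger still, so `F` controls `a Q` too.
    rcases (hmin R₀ hR₀ hQR₀).eq_or_ssubset with h | h
    · rwa [h]
    · refine haR₀.trans ?_
      gcongr
      exact (le_mul_of_one_le_left (by simp) (by norm_num)).trans (h1 _ hFm.1 _ hR₀ h).le
  choose! π hπ using key
  exact ⟨T, hTS, π, h1, fun Q hQ => hπ Q hQ⟩

lemma sum_indicator_eq_sum_filter {X : Type*} (T : Finset (Set X)) (c : Set X → ℝ≥0∞) (x : X)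
    [DecidablePred fun Q : Set X => x ∈ Q] :
    ∑ Q ∈ T, Q.indicator (fun _ => c Q) x = ∑ Q ∈ T with x ∈ Q, c Q := by
  classical
  rw [Finset.sum_filter]
  exact Finset.sum_congr rfl fun Q _ => by simp [Set.indicator_apply]

variable {X : Type*} [MeasurableSpace X]

lemma lintegral_mul_indicator_const {μ : Measure X} {Q : Set X} (hQ : MeasurableSet Q)
    {f : X → ℝ≥0∞} (hf : Measurable f) (c : ℝ≥0∞) :
    ∫⁻ x, f x * Q.indicator (fun _ => c) x ∂μ = c * ∫⁻ x in Q, f x ∂μ := by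
  rw [← lintegral_const_mul _ hf, ← lintegral_indicator hQ]
  congr 1; ext x
  by_cases hx : x ∈ Q <;> simp [hx, mul_comm]

lemma measurable_finset_sup {ι : Type*} (T : Finset ι) {g : ι → X → ℝ≥0∞}
    (hg : ∀ i ∈ T, Measurable (g i)) : Measurable fun x => T.sup fun i => g i x := by
  classical
  induction T using Finset.induction_on with
  | empty => simp
  | insert i T hi ih =>
    simp only [Finset.sup_insert]
    exact (hg i (by simp)).sup (ih fun j hj => hg j (by simp [hj]))

/-- Absorption: division by N^{1/q}, legitimate because N is finite. -/
lemma rpow_one_div_le_of_le_mul {p q : ℝ} (hpq : p.HolderConjugate q) {N B : ℝ≥0∞} (hN : N ≠ ⊤)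
    (h : N ≤ B * N ^ (1 / q)) : N ^ (1 / p) ≤ B := by
  have hq0 : 0 < q := hpq.symm.pos
  rcases eq_or_ne N 0 with rfl | h0
  · simp [hpq.pos]
  have h1 : N ^ (1 / q) ≠ 0 := (ENNReal.rpow_pos (pos_iff_ne_zero.2 h0) hN).ne'
  have h2 : N ^ (1 / q) ≠ ⊤ := ENNReal.rpow_ne_top_of_nonneg (by positivity) hN
  have h3 : N = N ^ (1 / p) * N ^ (1 / q) := by
    rw [← ENNReal.rpow_add _ _ h0 hN, one_div, one_div, hpq.inv_add_inv_eq_one, ENNReal.rpow_one]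
  refine (ENNReal.mul_le_mul_iff_left h1 h2).1 ?_
  rwa [← h3]

lemma setLIntegral_ne_top_of_rpow {σ : Measure X} {p q : ℝ} (hpq : p.HolderConjugate q)
    {f : X → ℝ≥0∞} (hf : Measurable f) (hfin : ∫⁻ x, f x ^ p ∂σ ≠ ⊤) {Q : Set X}
    (hQ : σ Q ≠ ⊤) : ∫⁻ x in Q, f x ∂σ ≠ ⊤ := by
  have hp0 := hpq.pos
  have hq0 := hpq.symm.pos
  have := ENNReal.lintegral_mul_le_Lp_mul_Lq (σ.restrict Q) hpq (f := f) (g := fun _ => 1)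
    hf.aemeasurable (by fun_prop)
  simp only [Pi.mul_apply, mul_one, ENNReal.one_rpow, lintegral_const, one_mul,
    Measure.restrict_apply_univ] at this
  refine ne_top_of_le_ne_top (ENNReal.mul_ne_top ?_ ?_) this
  · exact ENNReal.rpow_ne_top_of_nonneg (by positivity)
      (ne_top_of_le_ne_top hfin (setLIntegral_le_lintegral _ _))
  · exact ENNReal.rpow_ne_top_of_nonneg (by positivity) hQ

/-- Carleson embedding for a stopping family. -/
lemma carleson_embedding {σ : Measure X} {T : Finset (Set X)} (hT : Laminar T)
    (hm : ∀ Q ∈ T, MeasurableSet Q) (h0 : ∀ Q ∈ T, σ Q ≠ 0) (htop : ∀ Q ∈ T, σ Q ≠ ⊤)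
    {p q : ℝ} (hpq : p.HolderConjugate q) {f : X → ℝ≥0∞} (hf : Measurable f)
    (hfin : ∫⁻ x, f x ^ p ∂σ ≠ ⊤)
    (hgrow : ∀ F ∈ T, ∀ R ∈ T, F ⊂ R → 2 * ((∫⁻ x in R, f x ∂σ) / σ R) <
      (∫⁻ x in F, f x ∂σ) / σ F) :
    (∑ Q ∈ T, ((∫⁻ x in Q, f x ∂σ) / σ Q) ^ p * σ Q) ^ (1 / p) ≤
      geomConst (p - 1) * (∫⁻ x, f x ^ p ∂σ) ^ (1 / p) := by
  classical
  set a : Set X → ℝ≥0∞ := fun Q => (∫⁻ x in Q, f x ∂σ) / σ Q with ha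
  have hp := hpq.lt
  have hp1 : 0 < p - 1 := by linarith
  have hp0 : 0 < p := by linarith
  have hq0 : 0 < q := hpq.symm.pos
  have hpne := hp0.ne'
  have hconj : (p - 1) * q = p := hpq.sub_one_mul_conj
  have haf : ∀ Q ∈ T, a Q ≠ ⊤ := by
    intro Q hQ
    exact ENNReal.div_ne_top (setLIntegral_ne_top_of_rpow hpq hf hfin (htop Q hQ)) (h0 Q hQ)
  -- The supremum `m` of the stopping averages plays the role of a maximal function. Averages double
  -- along a chain, so the sum of a_Q^{p-1} over the sets containing x is at most a constant times
  -- m^{p-1}, while ∫ m^p ≤ N is immediate. Hölder then bounds N by a multiple of N^{1/q}, which is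
  -- absorbed.
  set m : X → ℝ≥0∞ := fun x => T.sup fun Q => Q.indicator (fun _ => a Q) x with hmdef
  have hmm : Measurable m :=
    measurable_finset_sup T fun Q hQ => measurable_const.indicator (hm Q hQ)
  set N := ∑ Q ∈ T, a Q ^ p * σ Q with hN
  have hNtop : N ≠ ⊤ := by
    refine (ENNReal.sum_lt_top.2 fun Q hQ => ?_).ne
    exact ENNReal.mul_lt_top (ENNReal.rpow_lt_top_of_nonneg hp0.le (haf Q hQ)) (htop Q hQ).lt_top
  have h1 : N = ∫⁻ x, f x * ∑ Q ∈ T, Q.indicator (fun _ => a Q ^ (p - 1)) x ∂σ := by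
    simp_rw [Finset.mul_sum]
    rw [lintegral_finsetSum' (f := fun Q x => f x * Q.indicator (fun _ => a Q ^ (p - 1)) x) _
      (fun Q hQ => (hf.mul (measurable_const.indicator (hm Q hQ))).aemeasurable)]
    refine Finset.sum_congr rfl fun Q hQ => ?_
    rw [lintegral_mul_indicator_const (hm Q hQ) hf]
    have : ∫⁻ x in Q, f x ∂σ = a Q * σ Q := by
      simp only [ha]; rw [ENNReal.div_mul_cancel (h0 Q hQ) (htop Q hQ)]
    rw [this, ← mul_assoc]
    congr 1
    nth_rw 3 [← ENNReal.rpow_one (a Q)]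
    rw [← ENNReal.rpow_add_of_nonneg _ _ hp1.le zero_le_one, sub_add_cancel]
  have h2 : ∀ x, ∑ Q ∈ T, Q.indicator (fun _ => a Q ^ (p - 1)) x ≤
      geomConst (p - 1) * m x ^ (p - 1) := by
    intro x
    rw [sum_indicator_eq_sum_filter]
    refine sum_rpow_le_of_separated hp1 _ a (fun Q hQ => haf Q (Finset.mem_filter.1 hQ).1) ?_ _ ?_
    · intro Q hQ R hR hne
      obtain ⟨hQ, hxQ⟩ := Finset.mem_filter.1 hQ
      obtain ⟨hR, hxR⟩ := Finset.mem_filter.1 hR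
      rcases hT Q hQ R hR with h | h | h
      · exact Or.inr (hgrow Q hQ R hR (h.ssubset_of_ne hne)).le
      · exact Or.inl (hgrow R hR Q hQ (h.ssubset_of_ne hne.symm)).le
      · exact absurd hxR (Set.disjoint_left.1 h hxQ)
    · intro Q hQ
      obtain ⟨hQ, hxQ⟩ := Finset.mem_filter.1 hQ
      refine le_trans ?_ (Finset.le_sup (f := fun Q : Set X => Q.indicator (fun _ => a Q) x) hQ)
      simp [hxQ]
  have h3 : ∫⁻ x, m x ^ p ∂σ ≤ N := by
    have : ∀ x, m x ^ p ≤ ∑ Q ∈ T, Q.indicator (fun _ => a Q ^ p) x := by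
      intro x
      rcases T.eq_empty_or_nonempty with rfl | hne
      · simp [hmdef, hp0]
      obtain ⟨Q, hQ, hQe⟩ := Finset.exists_mem_eq_sup T hne
        (fun Q : Set X => Q.indicator (fun _ => a Q) x)
      simp only [hmdef]
      rw [hQe]
      refine le_trans (le_of_eq ?_) (Finset.single_le_sum (fun _ _ => zero_le) hQ)
      by_cases hx : x ∈ Q <;> simp [hx, hp0]
    refine (lintegral_mono this).trans ?_
    rw [lintegral_finsetSum' _ (fun Q hQ => (measurable_const.indicator (hm Q hQ)).aemeasurable)]
    refine Finset.sum_le_sum fun Q hQ => ?_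
    rw [lintegral_indicator_const (hm Q hQ)]
  have h4 : N ≤ geomConst (p - 1) * (∫⁻ x, f x ^ p ∂σ) ^ (1 / p) * N ^ (1 / q) := by
    calc N ≤ ∫⁻ x, f x * (geomConst (p - 1) * m x ^ (p - 1)) ∂σ := by
          rw [h1]; exact lintegral_mono fun x => by gcongr; exact h2 x
      _ = geomConst (p - 1) * ∫⁻ x, (f * fun y => m y ^ (p - 1)) x ∂σ := by
          rw [← lintegral_const_mul _ (by fun_prop)]
          congr 1; ext x; simp only [Pi.mul_apply]; ring
      _ ≤ geomConst (p - 1) * ((∫⁻ x, f x ^ p ∂σ) ^ (1 / p) *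
            (∫⁻ x, (m x ^ (p - 1)) ^ q ∂σ) ^ (1 / q)) := by
          gcongr
          exact ENNReal.lintegral_mul_le_Lp_mul_Lq σ hpq hf.aemeasurable (by fun_prop)
      _ ≤ _ := by
          rw [mul_assoc]
          gcongr
          refine le_trans (le_of_eq ?_) h3
          congr 1; ext x; rw [← ENNReal.rpow_mul, hconj]
  exact rpow_one_div_le_of_le_mul hpq hNtop h4

end RoughSquare

namespace RoughSquare

/-! ### Testing condition for sparse families -/

section depth

open scoped Classical in
/-- The number of strictly larger members with the same label. -/
noncomputable def depth {X : Type*} (S : Finset (Set X)) (b : Set X → ℤ) (Q : Set X) : ℕ :=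
  (S.filter fun R => Q ⊂ R ∧ b R = b Q).card

variable {X : Type*} {S : Finset (Set X)} {b : Set X → ℤ}

lemma depth_lt_depth {Q R : Set X} (hR : R ∈ S) (hQR : Q ⊂ R) (hb : b R = b Q) :
    depth S b R < depth S b Q := by
  classical
  refine Finset.card_lt_card (Finset.ssubset_iff_subset_ne.2 ⟨?_, ?_⟩)
  · intro P hP
    simp only [Finset.mem_filter] at hP ⊢
    exact ⟨hP.1, hQR.trans hP.2.1, hP.2.2.trans hb⟩
  · intro h
    have : R ∈ S.filter fun P => R ⊂ P ∧ b P = b R := by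
      rw [h]; simp [hR, hQR, hb]
    exact (Finset.mem_filter.1 this).2.1.ne rfl

/-- The members above `Q` with its label form a chain, by laminarity and since `Q` is nonempty.
Depth is injective on this chain, takes values up to the depth of `Q`, and the chain has one more
member than that depth; by counting, every value is attained. -/
lemma exists_depth_eq (hS : Laminar S) {Q : Set X} (hQ : Q ∈ S) (hne : Q.Nonempty) {j : ℕ}
    (hj : j ≤ depth S b Q) : ∃ P ∈ S, Q ⊆ P ∧ b P = b Q ∧ depth S b P = j := by
  classical
  set c := S.filter fun R => Q ⊆ R ∧ b R = b Q with hc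
  have hcard : depth S b Q + 1 = c.card := by
    have : c = insert Q (S.filter fun R => Q ⊂ R ∧ b R = b Q) := by
      ext R
      simp only [hc, Finset.mem_filter, Finset.mem_insert]
      constructor
      · rintro ⟨h1, h2, h3⟩
        rcases h2.eq_or_ssubset with h | h
        · exact Or.inl h.symm
        · exact Or.inr ⟨h1, h, h3⟩
      · rintro (h | ⟨h1, h2, h3⟩)
        · rw [h]; exact ⟨hQ, Subset.rfl, rfl⟩
        · exact ⟨h1, h2.subset, h3⟩
    rw [this, Finset.card_insert_of_notMem, depth]
    simp
  have hmaps : Set.MapsTo (depth S b) c (Finset.range c.card) := by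
    intro R hR
    simp only [hc, Finset.coe_filter, Set.mem_ofPred_eq] at hR
    rw [← hcard]
    simp only [Finset.coe_range, Set.mem_Iio]
    rcases hR.2.1.eq_or_ssubset with h | h
    · rw [h]; exact Nat.lt_succ_self _
    · exact (depth_lt_depth hR.1 h hR.2.2).trans (Nat.lt_succ_self _)
  have hinj : Set.InjOn (depth S b) c := by
    intro R hR R' hR' h
    simp only [hc, Finset.coe_filter, Set.mem_ofPred_eq] at hR hR'
    by_contra hne'
    rcases hS R hR.1 R' hR'.1 with h1 | h1 | h1
    · exact (depth_lt_depth hR'.1 (h1.ssubset_of_ne hne') (hR'.2.2.trans hR.2.2.symm)).ne h.symm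
    · exact (depth_lt_depth hR.1 (h1.ssubset_of_ne (Ne.symm hne'))
        (hR.2.2.trans hR'.2.2.symm)).ne h
    · exact absurd (h1 hR.2.1 hR'.2.1) (by simpa [← Set.nonempty_iff_ne_empty] using hne)
  have hsurj := Finset.surjOn_of_injOn_of_card_le _ hmaps hinj (by simp)
  obtain ⟨P, hP, hPj⟩ := hsurj (show j ∈ (Finset.range c.card : Set ℕ) by
    simp only [Finset.coe_range, Set.mem_Iio]; omega)
  simp only [hc, Finset.coe_filter, Set.mem_ofPred_eq] at hP
  exact ⟨P, hP.1, hP.2.1, hP.2.2, hPj⟩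

end depth

variable {X : Type*} [MeasurableSpace X]

lemma lintegral_Lp_finset_sum_le {ι : Type*} {w : Measure X} {p : ℝ} (hp : 1 ≤ p) (s : Finset ι)
    (g : ι → X → ℝ≥0∞) (hg : ∀ i, Measurable (g i)) :
    (∫⁻ x, (∑ i ∈ s, g i x) ^ p ∂w) ^ (1 / p) ≤ ∑ i ∈ s, (∫⁻ x, g i x ^ p ∂w) ^ (1 / p) := by
  classical
  induction s using Finset.induction_on with
  | empty => simp [show 0 < p by linarith]
  | insert i s hi ih =>
    simp only [Finset.sum_insert hi]
    have hms : Measurable fun x => ∑ i ∈ s, g i x := Finset.measurable_fun_sum _ fun i _ => hg i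
    exact (ENNReal.lintegral_Lp_add_le (hg i).aemeasurable hms.aemeasurable hp).trans (by gcongr)

/-- The constant in `layer_bound`. -/
noncomputable def layerConst (p : ℝ) (Λ : ℝ≥0∞) : ℝ≥0∞ :=
  geomConst 1 * ∑' j : ℕ, ((1 - Λ⁻¹) ^ (1 / p)) ^ j

lemma layerConst_ne_top {p : ℝ} (hp : 1 < p) {Λ : ℝ≥0∞} (hΛ : Λ ≠ ⊤) : layerConst p Λ ≠ ⊤ := by
  refine ENNReal.mul_ne_top (geomConst_ne_top one_pos) ?_
  rw [ENNReal.tsum_geometric]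
  have h1 : 1 - Λ⁻¹ < 1 := ENNReal.sub_lt_self (by simp) (by simp) (by simpa using hΛ)
  have : (1 - Λ⁻¹) ^ (1 / p) < 1 := ENNReal.rpow_lt_one h1 (by positivity)
  simpa [tsub_eq_zero_iff_le] using this

open scoped Classical in
-- Let T_j be the weighted mass of the sets of depth at least j and V_j that of depth exactly j.
-- Each set counted in T_j lies in one of depth j with the same label, so the Carleson condition
-- gives T_j ≤ Λ V_j. As T_j = T_{j+1} + V_j, this is decay with ratio 1 - 1/Λ.
lemma depth_sum_le {S : Finset (Set X)} (hS : Laminar S) (hne : ∀ Q ∈ S, Q.Nonempty)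
    {b : Set X → ℤ} {w : Measure X} {Λ : ℝ≥0∞} (h1Λ : 1 ≤ Λ)
    (hC : ∀ R ∈ S, ∑ Q ∈ S with Q ⊆ R ∧ b Q = b R, w Q ≤ Λ * w R) (v : ℤ → ℝ≥0∞)
    (hfin : ∑ Q ∈ S, v (b Q) * w Q ≠ ⊤) (j : ℕ) :
    ∑ Q ∈ S with j ≤ depth S b Q, v (b Q) * w Q ≤
      (1 - Λ⁻¹) ^ j * ∑ Q ∈ S, v (b Q) * w Q := by
  induction j with
  | zero => simp
  | succ j ih =>
    set T := ∑ Q ∈ S with j ≤ depth S b Q, v (b Q) * w Q with hT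
    set T' := ∑ Q ∈ S with j + 1 ≤ depth S b Q, v (b Q) * w Q with hT'
    set V := ∑ Q ∈ S with depth S b Q = j, v (b Q) * w Q with hV
    have hTtop : T ≠ ⊤ := ne_top_of_le_ne_top hfin
      (Finset.sum_le_sum_of_subset (Finset.filter_subset _ _))
    have h1 : T = T' + V := by
      rw [hT, hT', hV, ← Finset.sum_union]
      · congr 1; ext Q; simp only [Finset.mem_filter, Finset.mem_union]
        constructor
        · rintro ⟨h1, h2⟩; rcases h2.eq_or_lt with h | h
          · exact Or.inr ⟨h1, h.symm⟩
          · exact Or.inl ⟨h1, h⟩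
        · rintro (⟨h1, h2⟩ | ⟨h1, h2⟩)
          · exact ⟨h1, by omega⟩
          · exact ⟨h1, by omega⟩
      · rw [Finset.disjoint_left]; intro Q h1 h2
        simp only [Finset.mem_filter] at h1 h2; omega
    have h2 : T ≤ Λ * V := by
      have key : ∀ Q ∈ S.filter (fun Q => j ≤ depth S b Q),
          ∃ P ∈ S.filter (fun P => depth S b P = j), Q ⊆ P ∧ b P = b Q := by
        intro Q hQ
        obtain ⟨hQ, hj⟩ := Finset.mem_filter.1 hQ
        obtain ⟨P, hP, h1, h2, h3⟩ := exists_depth_eq hS hQ (hne Q hQ) hj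
        exact ⟨P, by simp [hP, h3], h1, h2⟩
      choose! P hP using key
      rw [hT, ← Finset.sum_fiberwise_of_maps_to (fun Q hQ => (hP Q hQ).1), hV, Finset.mul_sum]
      refine Finset.sum_le_sum fun R hR => ?_
      have hRS := (Finset.mem_filter.1 hR).1
      calc _ ≤ ∑ Q ∈ S with Q ⊆ R ∧ b Q = b R, v (b Q) * w Q := by
            refine Finset.sum_le_sum_of_subset fun Q hQ => ?_
            obtain ⟨h1, h2⟩ := Finset.mem_filter.1 hQ
            obtain ⟨_, h3, h4⟩ := hP Q h1
            rw [h2] at h3 h4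
            exact Finset.mem_filter.2 ⟨(Finset.mem_filter.1 h1).1, h3, h4.symm⟩
        _ = v (b R) * ∑ Q ∈ S with Q ⊆ R ∧ b Q = b R, w Q := by
            rw [Finset.mul_sum]
            exact Finset.sum_congr rfl fun Q hQ => by rw [(Finset.mem_filter.1 hQ).2.2]
        _ ≤ v (b R) * (Λ * w R) := by gcongr; exact hC R hRS
        _ = _ := by ring
    have hΛ0 : Λ ≠ 0 := (one_pos.trans_le h1Λ).ne'
    have h3 : Λ⁻¹ * T ≤ V := by
      rw [mul_comm, ← div_eq_mul_inv]
      exact ENNReal.div_le_of_le_mul (by rwa [mul_comm])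
    have h4 : T' + Λ⁻¹ * T ≤ (1 - Λ⁻¹) * T + Λ⁻¹ * T := by
      rw [← add_mul, tsub_add_cancel_of_le (ENNReal.inv_le_one.2 h1Λ), one_mul]
      calc T' + Λ⁻¹ * T ≤ T' + V := by gcongr
        _ = T := h1.symm
    have h5 : T' ≤ (1 - Λ⁻¹) * T :=
      (ENNReal.add_le_add_iff_right (ENNReal.mul_ne_top (by simpa using hΛ0) hTtop)).1 h4
    calc T' ≤ (1 - Λ⁻¹) * T := h5
      _ ≤ (1 - Λ⁻¹) * ((1 - Λ⁻¹) ^ j * ∑ Q ∈ S, v (b Q) * w Q) := by gcongr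
      _ = _ := by ring

lemma two_zpow_separated {i j : ℤ} (h : i ≠ j) :
    2 * (2 : ℝ≥0∞) ^ i ≤ 2 ^ j ∨ 2 * (2 : ℝ≥0∞) ^ j ≤ 2 ^ i := by
  have key : ∀ i j : ℤ, i < j → 2 * (2 : ℝ≥0∞) ^ i ≤ 2 ^ j := by
    intro i j hij
    calc 2 * (2 : ℝ≥0∞) ^ i = 2 ^ (i + 1) := by
          rw [ENNReal.zpow_add (by simp) (by simp), zpow_one, mul_comm]
      _ ≤ 2 ^ j := ENNReal.zpow_le_of_le (by norm_num) hij
  rcases lt_or_gt_of_ne h with h | h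
  · exact Or.inl (key _ _ h)
  · exact Or.inr (key _ _ h)

lemma two_zpow_ne_top (i : ℤ) : (2 : ℝ≥0∞) ^ i ≠ ⊤ := (ENNReal.zpow_lt_top (by simp) (by simp) _).ne

open scoped Classical in
/-- Functions that are constant on each label class of a Carleson family. -/
lemma layer_bound {S : Finset (Set X)} (hS : Laminar S) (hne : ∀ Q ∈ S, Q.Nonempty)
    (hm : ∀ Q ∈ S, MeasurableSet Q)
    {b : Set X → ℤ} {w : Measure X} {Λ : ℝ≥0∞} (h1Λ : 1 ≤ Λ)
    (hw : ∀ Q ∈ S, w Q ≠ ⊤)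
    (hC : ∀ R ∈ S, ∑ Q ∈ S with Q ⊆ R ∧ b Q = b R, w Q ≤ Λ * w R) {p : ℝ} (hp : 1 < p) :
    (∫⁻ x, (∑ Q ∈ S, Q.indicator (fun _ => (2 : ℝ≥0∞) ^ b Q) x) ^ p ∂w) ^ (1 / p) ≤
      layerConst p Λ * (∑ Q ∈ S, ((2 : ℝ≥0∞) ^ b Q) ^ p * w Q) ^ (1 / p) := by
  have hp0 : 0 < p := by linarith
  set D := ∑ Q ∈ S, ((2 : ℝ≥0∞) ^ b Q) ^ p * w Q with hD
  have hDtop : D ≠ ⊤ := by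
    refine (ENNReal.sum_lt_top.2 fun Q hQ => ENNReal.mul_lt_top ?_ (hw Q hQ).lt_top).ne
    exact ENNReal.rpow_lt_top_of_nonneg hp0.le (two_zpow_ne_top _)
  -- Layers of constant depth. Two different sets of one layer that share a point have different
  -- labels, since equal labels would make the smaller one deeper. So the values 2^b at a point are
  -- separated, and the p-th power of their sum is comparable to the sum of their p-th powers. The
  -- layers decay geometrically and Minkowski sums them.
  set h : ℕ → X → ℝ≥0∞ := fun j x =>
    ∑ Q ∈ S with depth S b Q = j, Q.indicator (fun _ => (2 : ℝ≥0∞) ^ b Q) x with hh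
  have hmeas : ∀ (s : Finset (Set X)) (c : Set X → ℝ≥0∞), s ⊆ S →
      Measurable fun x => ∑ Q ∈ s, Q.indicator (fun _ => c Q) x := fun s c hs =>
    Finset.measurable_fun_sum _ fun Q hQ => measurable_const.indicator (hm Q (hs hQ))
  have hhm : ∀ j, Measurable (h j) := fun j => hmeas _ _ (Finset.filter_subset _ _)
  have hsum : ∀ x, ∑ Q ∈ S, Q.indicator (fun _ => (2 : ℝ≥0∞) ^ b Q) x =
      ∑ j ∈ Finset.range (S.card + 1), h j x := by
    intro x
    refine (Finset.sum_fiberwise_of_maps_to (fun Q hQ => ?_) _).symm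
    exact Finset.mem_range.2 (Nat.lt_succ_of_le (Finset.card_filter_le _ _))
  have hj : ∀ j, (∫⁻ x, h j x ^ p ∂w) ^ (1 / p) ≤
      geomConst 1 * (((1 - Λ⁻¹) ^ (1 / p)) ^ j * D ^ (1 / p)) := by
    intro j
    have hpt : ∀ x, h j x ^ p ≤ geomConst 1 ^ p *
        ∑ Q ∈ S with depth S b Q = j, Q.indicator (fun _ => ((2 : ℝ≥0∞) ^ b Q) ^ p) x := by
      intro x
      simp only [hh, sum_indicator_eq_sum_filter]
      set U := ((S.filter fun Q => depth S b Q = j).filter fun Q => x ∈ Q) with hU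
      rw [← ENNReal.rpow_one (∑ Q ∈ U, (2 : ℝ≥0∞) ^ b Q)]
      rcases U.eq_empty_or_nonempty with hU0 | hU0
      · simp [hU0, hp0]
      obtain ⟨P, hP, hPmax⟩ := Finset.exists_max_image U b hU0
      have := sum_rpow_le_of_separated one_pos U (fun Q => (2 : ℝ≥0∞) ^ b Q)
        (fun Q _ => two_zpow_ne_top _) ?_ (2 ^ b P)
        (fun Q hQ => ENNReal.zpow_le_of_le (by norm_num) (hPmax Q hQ))
      · simp only [ENNReal.rpow_one] at this ⊢
        calc _ ≤ (geomConst 1 * 2 ^ b P) ^ p := by gcongr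
          _ = geomConst 1 ^ p * (2 ^ b P) ^ p := ENNReal.mul_rpow_of_nonneg _ _ hp0.le
          _ ≤ _ := by
            gcongr
            exact Finset.single_le_sum (f := fun Q : Set X => ((2 : ℝ≥0∞) ^ b Q) ^ p)
              (fun _ _ => zero_le) hP
      · intro Q hQ R hR hQR
        refine two_zpow_separated fun hb => ?_
        simp only [hU, Finset.mem_filter] at hQ hR
        rcases hS Q hQ.1.1 R hR.1.1 with h | h | h
        · have := depth_lt_depth (b := b) hR.1.1 (h.ssubset_of_ne hQR) hb.symm
          omega
        · have := depth_lt_depth (b := b) hQ.1.1 (h.ssubset_of_ne hQR.symm) hb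
          omega
        · exact Set.disjoint_left.1 h hQ.2 hR.2
    calc (∫⁻ x, h j x ^ p ∂w) ^ (1 / p)
        ≤ (geomConst 1 ^ p * ∑ Q ∈ S with j ≤ depth S b Q,
            ((2 : ℝ≥0∞) ^ b Q) ^ p * w Q) ^ (1 / p) := by
          gcongr
          refine (lintegral_mono hpt).trans ?_
          rw [lintegral_const_mul _ (hmeas _ _ (Finset.filter_subset _ _)),
            lintegral_finsetSum' _ (fun Q hQ => (measurable_const.indicator
              (hm Q (Finset.filter_subset _ _ hQ))).aemeasurable)]
          gcongr
          refine (Finset.sum_le_sum fun Q hQ => ?_).trans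
            (Finset.sum_le_sum_of_subset fun Q hQ => ?_)
          · rw [lintegral_indicator_const (hm Q (Finset.filter_subset _ _ hQ))]
          · simp only [Finset.mem_filter] at hQ ⊢
            exact ⟨hQ.1, hQ.2.ge⟩
      _ ≤ (geomConst 1 ^ p * ((1 - Λ⁻¹) ^ j * D)) ^ (1 / p) := by
          gcongr
          exact depth_sum_le hS hne h1Λ hC (fun i => ((2 : ℝ≥0∞) ^ i) ^ p) hDtop j
      _ = _ := by
          rw [ENNReal.mul_rpow_of_nonneg _ _ (by positivity),
            ENNReal.mul_rpow_of_nonneg _ _ (by positivity), ← ENNReal.rpow_mul,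
            mul_one_div_cancel hp0.ne', ENNReal.rpow_one, ← ENNReal.rpow_natCast,
            ← ENNReal.rpow_natCast, ← ENNReal.rpow_mul, ← ENNReal.rpow_mul, mul_comm (j : ℝ)]
  simp only [hsum]
  calc _ ≤ ∑ j ∈ Finset.range (S.card + 1), (∫⁻ x, h j x ^ p ∂w) ^ (1 / p) :=
        lintegral_Lp_finset_sum_le hp.le _ _ hhm
    _ ≤ ∑ j ∈ Finset.range (S.card + 1),
          geomConst 1 * (((1 - Λ⁻¹) ^ (1 / p)) ^ j * D ^ (1 / p)) :=
        Finset.sum_le_sum fun j _ => hj j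
    _ = geomConst 1 * (∑ j ∈ Finset.range (S.card + 1), ((1 - Λ⁻¹) ^ (1 / p)) ^ j) *
          D ^ (1 / p) := by rw [Finset.mul_sum, Finset.sum_mul]; simp only [mul_assoc]
    _ ≤ _ := by
        rw [layerConst]; gcongr; exact ENNReal.sum_le_tsum _

end RoughSquare

/-! ### Two-weight estimates for sparse families. -/

namespace RoughSquare

variable {X : Type*} [MeasurableSpace X]

/-- The constant in `testing_bound`. -/
noncomputable def testConst (p : ℝ) (Λ : ℝ≥0∞) : ℝ≥0∞ :=
  2 * layerConst p (2 ^ p * Λ) * (2 ^ (1 / p) * geomConst (1 / p))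

lemma testConst_ne_top {p : ℝ} (hp : 1 < p) {Λ : ℝ≥0∞} (hΛ : Λ ≠ ⊤) : testConst p Λ ≠ ⊤ := by
  have h2 : (2 : ℝ≥0∞) ^ p ≠ ⊤ := ENNReal.rpow_ne_top_of_nonneg (by linarith) (by simp)
  have h3 : (2 : ℝ≥0∞) ^ (1 / p) ≠ ⊤ := ENNReal.rpow_ne_top_of_nonneg (by positivity) (by simp)
  exact ENNReal.mul_ne_top (ENNReal.mul_ne_top (by simp)
    (layerConst_ne_top hp (ENNReal.mul_ne_top h2 hΛ)))
    (ENNReal.mul_ne_top h3 (geomConst_ne_top (by positivity)))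

/-- Admissible families for the two-weight bilinear estimate. -/
structure SparseData (μ σ w : Measure X) (S : Finset (Set X)) (Λ : ℝ≥0∞) : Prop where
  laminar : Laminar S
  meas : ∀ Q ∈ S, MeasurableSet Q
  μ0 : ∀ Q ∈ S, μ Q ≠ 0
  μtop : ∀ Q ∈ S, μ Q ≠ ⊤
  σ0 : ∀ Q ∈ S, σ Q ≠ 0
  σtop : ∀ Q ∈ S, σ Q ≠ ⊤
  w0 : ∀ Q ∈ S, w Q ≠ 0
  wtop : ∀ Q ∈ S, w Q ≠ ⊤
  oneΛ : 1 ≤ Λ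
  Λtop : Λ ≠ ⊤
  carleson : ∀ S' ⊆ S, ∀ R ∈ S, (∀ Q ∈ S', Q ⊆ R) → ∑ Q ∈ S', μ Q ≤ Λ * μ R

namespace SparseData

variable {μ σ w : Measure X} {S : Finset (Set X)} {Λ : ℝ≥0∞}

lemma mono (h : SparseData μ σ w S Λ) {S' : Finset (Set X)} (hS : S' ⊆ S) :
    SparseData μ σ w S' Λ where
  laminar := h.laminar.mono hS
  meas Q hQ := h.meas Q (hS hQ)
  μ0 Q hQ := h.μ0 Q (hS hQ)
  μtop Q hQ := h.μtop Q (hS hQ)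
  σ0 Q hQ := h.σ0 Q (hS hQ)
  σtop Q hQ := h.σtop Q (hS hQ)
  w0 Q hQ := h.w0 Q (hS hQ)
  wtop Q hQ := h.wtop Q (hS hQ)
  oneΛ := h.oneΛ
  Λtop := h.Λtop
  carleson T hT R hR := h.carleson T (hT.trans hS) R (hS hR)

lemma symm (h : SparseData μ σ w S Λ) : SparseData μ w σ S Λ :=
  ⟨h.laminar, h.meas, h.μ0, h.μtop, h.w0, h.wtop, h.σ0, h.σtop, h.oneΛ, h.Λtop, h.carleson⟩

lemma nonempty (h : SparseData μ σ w S Λ) : ∀ Q ∈ S, Q.Nonempty := fun Q hQ =>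
  nonempty_of_measure_ne_zero (h.μ0 Q hQ)

/-- Testing on indicators, with the `A_p` constant entering to the power `1/p`. -/
lemma testing_bound (h : SparseData μ σ w S Λ) {p q : ℝ} (hpq : p.HolderConjugate q) {A : ℝ≥0∞}
    (hA : ∀ Q ∈ S, (w Q / μ Q) ^ (1 / p) * (σ Q / μ Q) ^ (1 / q) ≤ A) :
    (∫⁻ x, (∑ Q ∈ S, Q.indicator (fun _ => σ Q / μ Q) x) ^ p ∂w) ^ (1 / p) ≤
      testConst p Λ * A * (∑ Q ∈ S, σ Q) ^ (1 / p) := by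
  classical
  have hp := hpq.lt
  have hp0 : 0 < p := by linarith
  have hp1 : 0 < p - 1 := by linarith
  have hq0 : 0 < q := hpq.symm.pos
  set s : Set X → ℝ≥0∞ := fun Q => σ Q / μ Q with hs
  -- α is the p-th power of the local quantity bounded by `A`. Sets are sorted by the dyadic level
  -- `a` of α and then by the dyadic level `b` of the σ-average `s`. With both levels fixed the
  -- averages w(Q)/μ(Q) are comparable, so w inherits the Carleson condition of μ and `layer_bound`
  -- applies with label `b`.
  set α : Set X → ℝ≥0∞ := fun Q => w Q / μ Q * s Q ^ (p - 1) with hα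
  have hs0 : ∀ Q ∈ S, s Q ≠ 0 := fun Q hQ => ENNReal.div_ne_zero.2 ⟨h.σ0 Q hQ, h.μtop Q hQ⟩
  have hst : ∀ Q ∈ S, s Q ≠ ⊤ := fun Q hQ => ENNReal.div_ne_top (h.σtop Q hQ) (h.μ0 Q hQ)
  have hsp0 : ∀ Q ∈ S, s Q ^ (p - 1) ≠ 0 := fun Q hQ =>
    (ENNReal.rpow_pos (pos_iff_ne_zero.2 (hs0 Q hQ)) (hst Q hQ)).ne'
  have hspt : ∀ Q ∈ S, s Q ^ (p - 1) ≠ ⊤ := fun Q hQ =>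
    ENNReal.rpow_ne_top_of_nonneg hp1.le (hst Q hQ)
  have hα0 : ∀ Q ∈ S, α Q ≠ 0 := fun Q hQ =>
    mul_ne_zero (ENNReal.div_ne_zero.2 ⟨h.w0 Q hQ, h.μtop Q hQ⟩) (hsp0 Q hQ)
  have hαt : ∀ Q ∈ S, α Q ≠ ⊤ := fun Q hQ =>
    ENNReal.mul_ne_top (ENNReal.div_ne_top (h.wtop Q hQ) (h.μ0 Q hQ)) (hspt Q hQ)
  have hαA : ∀ Q ∈ S, α Q ≤ A ^ p := by
    intro Q hQ
    refine le_trans (le_of_eq ?_) (ENNReal.rpow_le_rpow (hA Q hQ) hp0.le)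
    rw [ENNReal.mul_rpow_of_nonneg _ _ hp0.le, ← ENNReal.rpow_mul, ← ENNReal.rpow_mul,
      one_div_mul_cancel hp0.ne', ENNReal.rpow_one]
    have : 1 / q * p = p - 1 := by
      rw [one_div_mul_eq_div, div_eq_iff hq0.ne', hpq.sub_one_mul_conj]
    rw [this]
  have hb : ∀ Q ∈ S, ∃ b : ℤ, s Q ∈ Set.Ioc ((2 : ℝ≥0∞) ^ b) (2 ^ (b + 1)) := fun Q hQ =>
    ENNReal.exists_mem_Ioc_zpow (hs0 Q hQ) (hst Q hQ) (by norm_num) (by simp)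
  have ha : ∀ Q ∈ S, ∃ a : ℤ, α Q ∈ Set.Ioc ((2 : ℝ≥0∞) ^ a) (2 ^ (a + 1)) := fun Q hQ =>
    ENNReal.exists_mem_Ioc_zpow (hα0 Q hQ) (hαt Q hQ) (by norm_num) (by simp)
  choose! b hb using hb
  choose! a ha using ha
  have htwo : ∀ i : ℤ, (2 : ℝ≥0∞) ^ (i + 1) = 2 * 2 ^ i := fun i => by
    rw [ENNReal.zpow_add (by simp) (by simp), zpow_one, mul_comm]
  set D := ∑ Q ∈ S, σ Q with hD
  set g : ℤ → X → ℝ≥0∞ := fun i x => ∑ Q ∈ S with a Q = i, Q.indicator (fun _ => s Q) x with hg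
  have hgm : ∀ i, Measurable (g i) := fun i => Finset.measurable_fun_sum _ fun Q hQ =>
    measurable_const.indicator (h.meas Q (Finset.filter_subset _ _ hQ))
  have hlevel : ∀ i, (∫⁻ x, g i x ^ p ∂w) ^ (1 / p) ≤
      2 * layerConst p (2 ^ p * Λ) * (2 ^ (1 / p) * ((2 : ℝ≥0∞) ^ i) ^ (1 / p) * D ^ (1 / p)) := by
    intro i
    set Si := S.filter fun Q => a Q = i with hSi
    have hsub : Si ⊆ S := Finset.filter_subset _ _
    have hC : ∀ R ∈ Si, ∑ Q ∈ Si with Q ⊆ R ∧ b Q = b R, w Q ≤ 2 ^ p * Λ * w R := by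
      intro R hR
      have hRS := hsub hR
      have hQw : ∀ Q ∈ Si.filter (fun Q => Q ⊆ R ∧ b Q = b R),
          w Q ≤ 2 ^ p * (w R / μ R) * μ Q := by
        intro Q hQ
        obtain ⟨hQi, hQR, hbQ⟩ := Finset.mem_filter.1 hQ
        have hQS := hsub hQi
        have haQ : a Q = a R := (Finset.mem_filter.1 hQi).2.trans (Finset.mem_filter.1 hR).2.symm
        have hsR : s R ≤ 2 * s Q := by
          calc s R ≤ 2 ^ (b R + 1) := (hb R hRS).2
            _ = 2 * 2 ^ b Q := by rw [htwo, hbQ]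
            _ ≤ 2 * s Q := by gcongr; exact (hb Q hQS).1.le
        have hαQ : α Q ≤ 2 * α R := by
          calc α Q ≤ 2 ^ (a Q + 1) := (ha Q hQS).2
            _ = 2 * 2 ^ a R := by rw [htwo, haQ]
            _ ≤ _ := by gcongr; exact (ha R hRS).1.le
        have h1 : w Q / μ Q * s Q ^ (p - 1) ≤ 2 ^ p * (w R / μ R) * s Q ^ (p - 1) := by
          calc _ ≤ 2 * (w R / μ R * s R ^ (p - 1)) := hαQ
            _ ≤ 2 * (w R / μ R * (2 * s Q) ^ (p - 1)) := by gcongr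
            _ = (2 ^ (1 : ℝ) * 2 ^ (p - 1)) * (w R / μ R) * s Q ^ (p - 1) := by
              rw [ENNReal.mul_rpow_of_nonneg _ _ hp1.le, ENNReal.rpow_one]; ring
            _ = _ := by
              rw [← ENNReal.rpow_add _ _ (by simp) (by simp), add_sub_cancel]
        have h2 := (ENNReal.mul_le_mul_iff_left (hsp0 Q hQS) (hspt Q hQS)).1 h1
        rwa [ENNReal.div_le_iff (h.μ0 Q hQS) (h.μtop Q hQS)] at h2
      calc _ ≤ ∑ Q ∈ Si with Q ⊆ R ∧ b Q = b R, 2 ^ p * (w R / μ R) * μ Q :=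
            Finset.sum_le_sum hQw
        _ = 2 ^ p * (w R / μ R) * ∑ Q ∈ Si with Q ⊆ R ∧ b Q = b R, μ Q := by
            rw [Finset.mul_sum]
        _ ≤ 2 ^ p * (w R / μ R) * (Λ * μ R) := by
            gcongr
            exact h.carleson _ ((Finset.filter_subset _ _).trans hsub) R hRS
              fun Q hQ => (Finset.mem_filter.1 hQ).2.1
        _ = 2 ^ p * Λ * (w R / μ R * μ R) := by ring
        _ = _ := by rw [ENNReal.div_mul_cancel (h.μ0 R hRS) (h.μtop R hRS)]
    have h1Λ : 1 ≤ 2 ^ p * Λ :=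
      one_le_mul (ENNReal.one_le_rpow (by norm_num) hp0) h.oneΛ
    have hlay := layer_bound (h.laminar.mono hsub) (fun Q hQ => h.nonempty Q (hsub hQ))
      (fun Q hQ => h.meas Q (hsub hQ)) h1Λ
      (fun Q hQ => h.wtop Q (hsub hQ)) hC hp
    have hg2 : ∀ x, g i x ≤ 2 * ∑ Q ∈ Si, Q.indicator (fun _ => (2 : ℝ≥0∞) ^ b Q) x := by
      intro x
      rw [Finset.mul_sum]
      refine Finset.sum_le_sum fun Q hQ => ?_
      by_cases hx : x ∈ Q
      · simp only [hx, Set.indicator_of_mem]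
        rw [← htwo]; exact (hb Q (hsub hQ)).2
      · simp [hx]
    -- The identity s^p w = α σ exchanges w-mass for σ-mass at the price of α, which is about 2^i on
    -- this level.
    have hV : ∑ Q ∈ Si, ((2 : ℝ≥0∞) ^ b Q) ^ p * w Q ≤ 2 * 2 ^ i * D := by
      rw [hD, Finset.mul_sum]
      refine le_trans (Finset.sum_le_sum fun Q hQ => ?_) (Finset.sum_le_sum_of_subset hsub)
      have hQS := hsub hQ
      calc ((2 : ℝ≥0∞) ^ b Q) ^ p * w Q ≤ s Q ^ p * w Q := by
            gcongr; exact (hb Q hQS).1.le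
        _ = s Q ^ (p - 1) * s Q ^ (1 : ℝ) * w Q := by
            rw [← ENNReal.rpow_add_of_nonneg _ _ hp1.le zero_le_one, sub_add_cancel]
        _ = α Q * σ Q := by
            simp only [hα, hs, ENNReal.rpow_one, div_eq_mul_inv]; ring
        _ ≤ _ := by
            gcongr
            rw [← htwo, ← (Finset.mem_filter.1 hQ).2]
            exact (ha Q hQS).2
    have hlm : Measurable fun x => ∑ Q ∈ Si, Q.indicator (fun _ => (2 : ℝ≥0∞) ^ b Q) x :=
      Finset.measurable_fun_sum _ fun Q hQ => measurable_const.indicator (h.meas Q (hsub hQ))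
    calc (∫⁻ x, g i x ^ p ∂w) ^ (1 / p)
        ≤ (∫⁻ x, 2 ^ p * (∑ Q ∈ Si, Q.indicator (fun _ => (2 : ℝ≥0∞) ^ b Q) x) ^ p ∂w) ^ (1 / p) := by
          gcongr with x
          rw [← ENNReal.mul_rpow_of_nonneg _ _ hp0.le]
          gcongr; exact hg2 x
      _ = 2 * (∫⁻ x, (∑ Q ∈ Si, Q.indicator (fun _ => (2 : ℝ≥0∞) ^ b Q) x) ^ p ∂w) ^ (1 / p) := by
          rw [lintegral_const_mul _ (by fun_prop), ENNReal.mul_rpow_of_nonneg _ _ (by positivity),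
            ← ENNReal.rpow_mul, mul_one_div_cancel hp0.ne', ENNReal.rpow_one]
      _ ≤ 2 * (layerConst p (2 ^ p * Λ) * (2 * 2 ^ i * D) ^ (1 / p)) := by
          gcongr; exact hlay.trans (by gcongr)
      _ = _ := by
          rw [ENNReal.mul_rpow_of_nonneg _ _ (by positivity),
            ENNReal.mul_rpow_of_nonneg _ _ (by positivity)]
          ring
  have hsum : ∀ x, ∑ Q ∈ S, Q.indicator (fun _ => σ Q / μ Q) x = ∑ i ∈ S.image a, g i x := fun x =>
    (Finset.sum_fiberwise_of_maps_to (fun Q hQ => Finset.mem_image_of_mem a hQ) _).symm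
  simp only [hsum]
  calc _ ≤ ∑ i ∈ S.image a, (∫⁻ x, g i x ^ p ∂w) ^ (1 / p) :=
        lintegral_Lp_finset_sum_le hp.le _ _ hgm
    _ ≤ ∑ i ∈ S.image a, 2 * layerConst p (2 ^ p * Λ) *
          (2 ^ (1 / p) * ((2 : ℝ≥0∞) ^ i) ^ (1 / p) * D ^ (1 / p)) :=
        Finset.sum_le_sum fun i _ => hlevel i
    _ = 2 * layerConst p (2 ^ p * Λ) * (2 ^ (1 / p) *
          (∑ i ∈ S.image a, ((2 : ℝ≥0∞) ^ i) ^ (1 / p)) * D ^ (1 / p)) := by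
        simp only [Finset.mul_sum, Finset.sum_mul]
    _ ≤ 2 * layerConst p (2 ^ p * Λ) * (2 ^ (1 / p) *
          (geomConst (1 / p) * (A ^ p) ^ (1 / p)) * D ^ (1 / p)) := by
        gcongr
        -- The occupied levels lie below A^p, so the factors 2^{i/p} sum to a constant times `A`,
        -- with no logarithmic loss.
        refine sum_rpow_le_of_separated (by positivity) _ _ (fun i _ => two_zpow_ne_top i)
          (fun i _ j _ hij => two_zpow_separated hij) _ fun i hi => ?_
        obtain ⟨Q, hQ, rfl⟩ := Finset.mem_image.1 hi
        exact (ha Q hQ).1.le.trans (hαA Q hQ)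
    _ = _ := by
        rw [← ENNReal.rpow_mul, mul_one_div_cancel hp0.ne', ENNReal.rpow_one, testConst]; ring

/-- Half of the bilinear estimate: the sum over sets whose stopping parents are nested. -/
lemma half_bilinear (h : SparseData μ σ w S Λ) {p q : ℝ} (hpq : p.HolderConjugate q) {A B : ℝ≥0∞}
    (hA : ∀ Q ∈ S, (w Q / μ Q) ^ (1 / p) * (σ Q / μ Q) ^ (1 / q) ≤ A)
    (hB : ∀ S' ⊆ S, ∀ R ∈ S, (∀ Q ∈ S', Q ⊆ R) → ∑ Q ∈ S', σ Q ≤ B * σ R)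
    {T T' : Finset (Set X)} (hT : T ⊆ S) (hT' : T' ⊆ S) (π π' : Set X → Set X)
    (hπ : ∀ Q ∈ S, π Q ∈ T ∧ Q ⊆ π Q ∧ ∀ R ∈ T, Q ⊆ R → π Q ⊆ R)
    (hπ' : ∀ Q ∈ S, π' Q ∈ T' ∧ Q ⊆ π' Q) (a c : Set X → ℝ≥0∞)
    (S₀ : Finset (Set X)) (hS₀ : S₀ ⊆ S) (hnest : ∀ Q ∈ S₀, π' Q ⊆ π Q) :
    ∑ Q ∈ S₀, a (π Q) * c (π' Q) * (σ Q / μ Q * w Q) ≤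
      testConst p Λ * A * B ^ (1 / p) *
        ((∑ F ∈ T, a F ^ p * σ F) ^ (1 / p) * (∑ G ∈ T', c G ^ q * w G) ^ (1 / q)) := by
  classical
  have hp0 : 0 < p := hpq.pos
  have hq0 : 0 < q := hpq.symm.pos
  set SF : Set X → Finset (Set X) := fun F => S₀.filter fun Q => π Q = F with hSF
  set GF : Set X → Finset (Set X) := fun F => T'.filter fun G => π G = F with hGF
  have hSFS : ∀ F, SF F ⊆ S := fun F => (Finset.filter_subset _ _).trans hS₀
  -- If π' Q ⊆ π Q = F, then the smallest stopping set of `T` above π' Q is again F. The families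
  -- `GF F` are the fibres of π on `T'`, hence disjoint, so their ℓ^q sums add up without overlap at
  -- the end.
  have hmem : ∀ F, ∀ Q ∈ SF F, π' Q ∈ GF F := by
    intro F Q hQ
    obtain ⟨hQ0, hQF⟩ := Finset.mem_filter.1 hQ
    have hQS := hS₀ hQ0
    obtain ⟨h1, h2, h3⟩ := hπ Q hQS
    obtain ⟨h4, h5⟩ := hπ' Q hQS
    obtain ⟨h6, h7, h8⟩ := hπ _ (hT' h4)
    refine Finset.mem_filter.2 ⟨h4, ?_⟩
    rw [← hQF]
    exact (h8 _ h1 (hnest Q hQ0)).antisymm (h3 _ h6 (h5.trans h7))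
  have hF : ∀ F ∈ T, ∑ Q ∈ SF F, c (π' Q) * (σ Q / μ Q * w Q) ≤
      testConst p Λ * A * (B * σ F) ^ (1 / p) * (∑ G ∈ GF F, c G ^ q * w G) ^ (1 / q) := by
    intro F hFT
    set m : X → ℝ≥0∞ := fun x => (GF F).sup fun G => G.indicator (fun _ => c G) x with hm
    have hGS : GF F ⊆ S := (Finset.filter_subset _ _).trans hT'
    have hmm : Measurable m := measurable_finset_sup _ fun G hG =>
      measurable_const.indicator (h.meas G (hGS hG))
    set u : X → ℝ≥0∞ := fun x => ∑ Q ∈ SF F, Q.indicator (fun _ => σ Q / μ Q) x with hu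
    have hum : Measurable u := Finset.measurable_fun_sum _ fun Q hQ =>
      measurable_const.indicator (h.meas Q (hSFS F hQ))
    have h1 : ∑ Q ∈ SF F, c (π' Q) * (σ Q / μ Q * w Q) ≤ ∫⁻ x, (u * m) x ∂w := by
      have : ∑ Q ∈ SF F, c (π' Q) * (σ Q / μ Q * w Q) =
          ∫⁻ x, ∑ Q ∈ SF F, Q.indicator (fun _ => c (π' Q) * (σ Q / μ Q)) x ∂w := by
        rw [lintegral_finsetSum' _ (fun Q hQ =>
          (measurable_const.indicator (h.meas Q (hSFS F hQ))).aemeasurable)]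
        refine Finset.sum_congr rfl fun Q hQ => ?_
        rw [lintegral_indicator_const (h.meas Q (hSFS F hQ)), mul_assoc]
      rw [this]
      refine lintegral_mono fun x => ?_
      simp only [Pi.mul_apply, hu, Finset.sum_mul]
      refine Finset.sum_le_sum fun Q hQ => ?_
      by_cases hx : x ∈ Q
      · simp only [hx, Set.indicator_of_mem]
        rw [mul_comm]
        gcongr
        refine le_trans ?_ (Finset.le_sup (f := fun G : Set X => G.indicator (fun _ => c G) x)
          (hmem F Q hQ))
        have : x ∈ π' Q := (hπ' Q (hSFS F hQ)).2 hx
        simp [this]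
      · simp [hx]
    have h2 : ∫⁻ x, m x ^ q ∂w ≤ ∑ G ∈ GF F, c G ^ q * w G := by
      have : ∀ x, m x ^ q ≤ ∑ G ∈ GF F, G.indicator (fun _ => c G ^ q) x := by
        intro x
        rcases (GF F).eq_empty_or_nonempty with h0 | hne
        · simp [hm, h0, hq0]
        obtain ⟨G, hG, hGe⟩ := Finset.exists_mem_eq_sup (GF F) hne
          (fun G : Set X => G.indicator (fun _ => c G) x)
        simp only [hm]
        rw [hGe]
        refine le_trans (le_of_eq ?_) (Finset.single_le_sum (fun _ _ => zero_le) hG)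
        by_cases hx : x ∈ G <;> simp [hx, hq0]
      refine (lintegral_mono this).trans ?_
      rw [lintegral_finsetSum' _ (fun G hG =>
        (measurable_const.indicator (h.meas G (hGS hG))).aemeasurable)]
      exact Finset.sum_le_sum fun G hG => by rw [lintegral_indicator_const (h.meas G (hGS hG))]
    calc _ ≤ ∫⁻ x, (u * m) x ∂w := h1
      _ ≤ (∫⁻ x, u x ^ p ∂w) ^ (1 / p) * (∫⁻ x, m x ^ q ∂w) ^ (1 / q) :=
          ENNReal.lintegral_mul_le_Lp_mul_Lq w hpq hum.aemeasurable hmm.aemeasurable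
      _ ≤ _ := by
          gcongr
          refine ((h.mono (hSFS F)).testing_bound hpq fun Q hQ => hA Q (hSFS F hQ)).trans ?_
          gcongr
          refine hB _ (hSFS F) F (hT hFT) fun Q hQ => ?_
          rw [← (Finset.mem_filter.1 hQ).2]
          exact (hπ Q (hSFS F hQ)).2.1
  calc ∑ Q ∈ S₀, a (π Q) * c (π' Q) * (σ Q / μ Q * w Q)
      = ∑ F ∈ T, ∑ Q ∈ SF F, a (π Q) * c (π' Q) * (σ Q / μ Q * w Q) :=
        (Finset.sum_fiberwise_of_maps_to (fun Q hQ => (hπ Q (hS₀ hQ)).1) _).symm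
    _ = ∑ F ∈ T, a F * ∑ Q ∈ SF F, c (π' Q) * (σ Q / μ Q * w Q) := by
        refine Finset.sum_congr rfl fun F _ => ?_
        rw [Finset.mul_sum]
        exact Finset.sum_congr rfl fun Q hQ => by rw [(Finset.mem_filter.1 hQ).2, mul_assoc]
    _ ≤ ∑ F ∈ T, a F * (testConst p Λ * A * (B * σ F) ^ (1 / p) *
          (∑ G ∈ GF F, c G ^ q * w G) ^ (1 / q)) :=
        Finset.sum_le_sum fun F hFT => by gcongr; exact hF F hFT
    _ = testConst p Λ * A * B ^ (1 / p) * ∑ F ∈ T, (a F * σ F ^ (1 / p)) *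
          (∑ G ∈ GF F, c G ^ q * w G) ^ (1 / q) := by
        rw [Finset.mul_sum]
        refine Finset.sum_congr rfl fun F _ => ?_
        rw [ENNReal.mul_rpow_of_nonneg _ _ (by positivity)]; ring
    _ ≤ testConst p Λ * A * B ^ (1 / p) * ((∑ F ∈ T, (a F * σ F ^ (1 / p)) ^ p) ^ (1 / p) *
          (∑ F ∈ T, ((∑ G ∈ GF F, c G ^ q * w G) ^ (1 / q)) ^ q) ^ (1 / q)) := by
        gcongr; exact ENNReal.inner_le_Lp_mul_Lq _ _ _ hpq
    _ = testConst p Λ * A * B ^ (1 / p) * ((∑ F ∈ T, a F ^ p * σ F) ^ (1 / p) *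
          (∑ F ∈ T, ∑ G ∈ GF F, c G ^ q * w G) ^ (1 / q)) := by
        simp only [ENNReal.mul_rpow_of_nonneg _ _ hp0.le, ← ENNReal.rpow_mul,
          one_div_mul_cancel hp0.ne', one_div_mul_cancel hq0.ne', ENNReal.rpow_one]
    _ = _ := by
        rw [Finset.sum_fiberwise_of_maps_to (fun G hG => (hπ G (hT' hG)).1)]

/-- The two-weight bilinear estimate for Carleson families, with mixed constants. -/
theorem bilinear_bound (h : SparseData μ σ w S Λ) {p q : ℝ} (hpq : p.HolderConjugate q)
    {A B B' : ℝ≥0∞}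
    (hA : ∀ Q ∈ S, (w Q / μ Q) ^ (1 / p) * (σ Q / μ Q) ^ (1 / q) ≤ A)
    (hB : ∀ S' ⊆ S, ∀ R ∈ S, (∀ Q ∈ S', Q ⊆ R) → ∑ Q ∈ S', σ Q ≤ B * σ R)
    (hB' : ∀ S' ⊆ S, ∀ R ∈ S, (∀ Q ∈ S', Q ⊆ R) → ∑ Q ∈ S', w Q ≤ B' * w R)
    {f g : X → ℝ≥0∞} (hf : Measurable f) (hg : Measurable g)
    (hff : ∫⁻ x, f x ^ p ∂σ ≠ ⊤) (hgf : ∫⁻ x, g x ^ q ∂w ≠ ⊤) :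
    ∑ Q ∈ S, (∫⁻ x in Q, f x ∂σ) * (∫⁻ x in Q, g x ∂w) / μ Q ≤
      4 * (testConst p Λ + testConst q Λ) * (geomConst (p - 1) * geomConst (q - 1)) * A *
        max (B ^ (1 / p)) (B' ^ (1 / q)) *
        ((∫⁻ x, f x ^ p ∂σ) ^ (1 / p) * (∫⁻ x, g x ^ q ∂w) ^ (1 / q)) := by
  classical
  set a : Set X → ℝ≥0∞ := fun Q => (∫⁻ x in Q, f x ∂σ) / σ Q with ha
  set c : Set X → ℝ≥0∞ := fun Q => (∫⁻ x in Q, g x ∂w) / w Q with hc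
  obtain ⟨T, hT, π, hTs, hπ⟩ := h.laminar.exists_stopping h.nonempty a
  obtain ⟨T', hT', π', hTs', hπ'⟩ := h.laminar.exists_stopping h.nonempty c
  have hX := carleson_embedding (h.mono hT).laminar (h.mono hT).meas (h.mono hT).σ0
    (h.mono hT).σtop hpq hf hff hTs
  have hY := carleson_embedding (h.mono hT').laminar (h.mono hT').meas (h.mono hT').w0
    (h.mono hT').wtop hpq.symm hg hgf hTs'
  set Nf := (∫⁻ x, f x ^ p ∂σ) ^ (1 / p)
  set Ng := (∫⁻ x, g x ^ q ∂w) ^ (1 / q)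
  set M := max (B ^ (1 / p)) (B' ^ (1 / q))
  have hterm : ∀ Q ∈ S, (∫⁻ x in Q, f x ∂σ) * (∫⁻ x in Q, g x ∂w) / μ Q ≤
      4 * (a (π Q) * c (π' Q) * (σ Q / μ Q * w Q)) := by
    intro Q hQ
    have h1 : ∫⁻ x in Q, f x ∂σ = a Q * σ Q :=
      (ENNReal.div_mul_cancel (h.σ0 Q hQ) (h.σtop Q hQ)).symm
    have h2 : ∫⁻ x in Q, g x ∂w = c Q * w Q :=
      (ENNReal.div_mul_cancel (h.w0 Q hQ) (h.wtop Q hQ)).symm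
    rw [h1, h2]
    calc a Q * σ Q * (c Q * w Q) / μ Q = a Q * c Q * (σ Q / μ Q * w Q) := by
          simp only [div_eq_mul_inv]; ring
      _ ≤ (2 * a (π Q)) * (2 * c (π' Q)) * (σ Q / μ Q * w Q) := by
          gcongr
          · exact (hπ Q hQ).2.2.1
          · exact (hπ' Q hQ).2.2.1
      _ = _ := by ring
  -- Both stopping parents contain `Q`, hence are nested. The second half is the first with (σ, f,
  -- p) and (w, g, q) exchanged.
  set S₁ := S.filter fun Q => π' Q ⊆ π Q with hS₁
  set S₂ := S.filter fun Q => ¬ π' Q ⊆ π Q with hS₂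
  have hhalf₁ := h.half_bilinear hpq hA hB hT hT' π π'
    (fun Q hQ => ⟨(hπ Q hQ).1, (hπ Q hQ).2.1, (hπ Q hQ).2.2.2⟩)
    (fun Q hQ => ⟨(hπ' Q hQ).1, (hπ' Q hQ).2.1⟩) a c S₁ (Finset.filter_subset _ _)
    (fun Q hQ => (Finset.mem_filter.1 hQ).2)
  have hhalf₂ := h.symm.half_bilinear hpq.symm (A := A)
    (fun Q hQ => by rw [mul_comm]; exact hA Q hQ) hB' hT' hT π' π
    (fun Q hQ => ⟨(hπ' Q hQ).1, (hπ' Q hQ).2.1, (hπ' Q hQ).2.2.2⟩)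
    (fun Q hQ => ⟨(hπ Q hQ).1, (hπ Q hQ).2.1⟩) c a S₂ (Finset.filter_subset _ _) (by
      intro Q hQ
      obtain ⟨hQ, hn⟩ := Finset.mem_filter.1 hQ
      rcases h.laminar _ (hT' (hπ' Q hQ).1) _ (hT (hπ Q hQ).1) with h1 | h1 | h1
      · exact absurd h1 hn
      · exact h1
      · exact absurd (h1 (hπ' Q hQ).2.1 (hπ Q hQ).2.1)
          (by simpa [← Set.nonempty_iff_ne_empty] using h.nonempty Q hQ))
  calc _ ≤ ∑ Q ∈ S, 4 * (a (π Q) * c (π' Q) * (σ Q / μ Q * w Q)) := Finset.sum_le_sum hterm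
    _ = 4 * (∑ Q ∈ S₁, a (π Q) * c (π' Q) * (σ Q / μ Q * w Q) +
          ∑ Q ∈ S₂, c (π' Q) * a (π Q) * (w Q / μ Q * σ Q)) := by
        rw [← Finset.mul_sum, ← Finset.sum_filter_add_sum_filter_not S fun Q => π' Q ⊆ π Q]
        congr 2
        refine Finset.sum_congr rfl fun Q _ => ?_
        simp only [div_eq_mul_inv]; ring
    _ ≤ 4 * (testConst p Λ * A * M * ((geomConst (p - 1) * Nf) * (geomConst (q - 1) * Ng)) +
          testConst q Λ * A * M * ((geomConst (q - 1) * Ng) * (geomConst (p - 1) * Nf))) := by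
        gcongr
        · exact hhalf₁.trans (by gcongr; exact le_max_left _ _)
        · exact hhalf₂.trans (by gcongr; exact le_max_right _ _)
    _ = _ := by ring

/-- The constant in the weighted bound for sparse operators. -/
noncomputable def sparseConst (p q : ℝ) (Λ : ℝ≥0∞) : ℝ≥0∞ :=
  4 * (testConst p Λ + testConst q Λ) * (geomConst (p - 1) * geomConst (q - 1))

lemma sparseConst_ne_top {p q : ℝ} (hpq : p.HolderConjugate q) {Λ : ℝ≥0∞} (hΛ : Λ ≠ ⊤) :
    sparseConst p q Λ ≠ ⊤ := by
  have hp := hpq.lt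
  have hq := hpq.symm.lt
  refine ENNReal.mul_ne_top (ENNReal.mul_ne_top (by simp) ?_) (ENNReal.mul_ne_top ?_ ?_)
  · exact ENNReal.add_ne_top.2 ⟨testConst_ne_top hp hΛ, testConst_ne_top hq hΛ⟩
  · exact geomConst_ne_top (by linarith)
  · exact geomConst_ne_top (by linarith)

/-- The `L^p(σ) → L^p(w)` bound for sparse operators, with mixed constants. -/
theorem strong_bound (h : SparseData μ σ w S Λ) {p q : ℝ} (hpq : p.HolderConjugate q)
    {A B B' : ℝ≥0∞}
    (hA : ∀ Q ∈ S, (w Q / μ Q) ^ (1 / p) * (σ Q / μ Q) ^ (1 / q) ≤ A)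
    (hB : ∀ S' ⊆ S, ∀ R ∈ S, (∀ Q ∈ S', Q ⊆ R) → ∑ Q ∈ S', σ Q ≤ B * σ R)
    (hB' : ∀ S' ⊆ S, ∀ R ∈ S, (∀ Q ∈ S', Q ⊆ R) → ∑ Q ∈ S', w Q ≤ B' * w R)
    {f : X → ℝ≥0∞} (hf : Measurable f) (hff : ∫⁻ x, f x ^ p ∂σ ≠ ⊤) :
    (∫⁻ x, (∑ Q ∈ S, Q.indicator (fun _ => (∫⁻ y in Q, f y ∂σ) / μ Q) x) ^ p ∂w) ^ (1 / p) ≤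
      sparseConst p q Λ * A * max (B ^ (1 / p)) (B' ^ (1 / q)) *
        (∫⁻ x, f x ^ p ∂σ) ^ (1 / p) := by
  classical
  have hp0 : 0 < p := hpq.pos
  have hp1 : 0 < p - 1 := by linarith [hpq.lt]
  set c : Set X → ℝ≥0∞ := fun Q => (∫⁻ y in Q, f y ∂σ) / μ Q with hc
  set H : X → ℝ≥0∞ := fun x => ∑ Q ∈ S, Q.indicator (fun _ => c Q) x with hH
  have hHm : Measurable H := Finset.measurable_fun_sum _ fun Q hQ =>
    measurable_const.indicator (h.meas Q hQ)
  have hcf : ∀ Q ∈ S, c Q ≠ ⊤ := fun Q hQ =>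
    ENNReal.div_ne_top (setLIntegral_ne_top_of_rpow hpq hf hff (h.σtop Q hQ)) (h.μ0 Q hQ)
  -- A priori finiteness for the absorption below: `H` is at most a finite constant and vanishes off
  -- a finite union of sets of finite w-measure.
  have hsupp : ∀ x, H x ^ p ≤
      (⋃ Q ∈ S, Q).indicator (fun _ => (∑ Q ∈ S, c Q) ^ p) x := by
    intro x
    by_cases hx : x ∈ ⋃ Q ∈ S, Q
    · simp only [hx, Set.indicator_of_mem]
      gcongr with Q
      exact Finset.sum_le_sum fun Q _ => Set.indicator_le_self' (fun _ _ => zero_le) x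
    · have : H x = 0 := by
        refine Finset.sum_eq_zero fun Q hQ => ?_
        have : x ∉ Q := fun h' => hx (Set.mem_biUnion hQ h')
        simp [this]
      simp [this, hp0]
  have hN : ∫⁻ x, H x ^ p ∂w ≠ ⊤ := by
    refine ne_top_of_le_ne_top ?_ (lintegral_mono hsupp)
    rw [lintegral_indicator_const (Finset.measurableSet_biUnion S fun Q hQ => h.meas Q hQ)]
    refine ENNReal.mul_ne_top (ENNReal.rpow_ne_top_of_nonneg hp0.le
      (ENNReal.sum_ne_top.2 fun Q hQ => hcf Q hQ)) ?_
    exact ((measure_biUnion_finset_le _ _).trans_lt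
      (ENNReal.sum_lt_top.2 fun Q hQ => (h.wtop Q hQ).lt_top)).ne
  refine rpow_one_div_le_of_le_mul hpq hN ?_
  -- Duality with g = H^{p-1}: its q-th power is H^p, so the bilinear estimate bounds ∫ H^p dw by
  -- its own power 1/q.
  have hgq : ∀ x, (H x ^ (p - 1)) ^ q = H x ^ p := fun x => by
    rw [← ENNReal.rpow_mul, hpq.sub_one_mul_conj]
  have hbil := h.bilinear_bound hpq hA hB hB' hf (g := fun x => H x ^ (p - 1)) (by fun_prop) hff
    (by simpa only [hgq] using hN)
  simp only [hgq] at hbil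
  calc ∫⁻ x, H x ^ p ∂w = ∫⁻ x, H x ^ (p - 1) * H x ∂w := by
        congr 1; ext x
        nth_rw 3 [← ENNReal.rpow_one (H x)]
        rw [← ENNReal.rpow_add_of_nonneg _ _ hp1.le zero_le_one, sub_add_cancel]
    _ = ∑ Q ∈ S, (∫⁻ x in Q, f x ∂σ) * (∫⁻ x in Q, H x ^ (p - 1) ∂w) / μ Q := by
        have hHe : ∀ x, H x ^ (p - 1) * H x =
            ∑ Q ∈ S, H x ^ (p - 1) * Q.indicator (fun _ => c Q) x := fun x => by
          rw [← Finset.mul_sum]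
        simp only [hHe]
        rw [lintegral_finsetSum'
          (f := fun (Q : Set X) x => H x ^ (p - 1) * Q.indicator (fun _ => c Q) x) _
          (fun Q hQ => ((hHm.pow_const _).mul
          (measurable_const.indicator (h.meas Q hQ))).aemeasurable)]
        refine Finset.sum_congr rfl fun Q hQ => ?_
        rw [lintegral_mul_indicator_const (h.meas Q hQ) (by fun_prop)]
        simp only [hc, div_eq_mul_inv]; ring
    _ ≤ _ := hbil
    _ = _ := by rw [sparseConst]; ring

end SparseData

end RoughSquare

namespace RoughSquare

/-! ### Radial integrals and estimates for the smooth kernels -/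

/-- The surface measure of the unit sphere of `ℝⁿ`. -/
noncomputable def sphereConst (n : ℕ) : ℝ :=
  (n : ℝ) * (volume : Measure (Rn n)).real (Metric.ball 0 1)

lemma nontrivial_Rn {n : ℕ} (hn : 1 ≤ n) : Nontrivial (Rn n) := by
  have : Nonempty (Fin n) := ⟨⟨0, hn⟩⟩
  infer_instance

lemma sphereConst_pos {n : ℕ} (hn : 1 ≤ n) : 0 < sphereConst n := by
  have : 0 < (volume : Measure (Rn n)).real (Metric.ball 0 1) :=
    ENNReal.toReal_pos (Metric.measure_ball_pos _ _ one_pos).ne' measure_ball_lt_top.ne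
  have hn' : (0 : ℝ) < n := by exact_mod_cast hn
  exact mul_pos hn' this

/-- In polar coordinates r^{n-1} cancels r/r^n, leaving the length of (0, R]. This is what |z|^{-n}
produces against a factor vanishing linearly at the origin. -/
lemma radial_near {n : ℕ} (hn : 1 ≤ n) {R : ℝ} (hR : 0 < R) :
    Integrable (fun z : Rn n => (Iic R).indicator (fun r : ℝ => r / r ^ n) ‖z‖) ∧
      ∫ z : Rn n, (Iic R).indicator (fun r : ℝ => r / r ^ n) ‖z‖ = sphereConst n * R := by
  have := nontrivial_Rn hn
  have hfun : ∀ y ∈ Ioi (0 : ℝ), y ^ (Module.finrank ℝ (Rn n) - 1) •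
      (Iic R).indicator (fun r : ℝ => r / r ^ n) y = (Iic R).indicator (fun _ => (1 : ℝ)) y := by
    intro y hy
    have hy0 : y ≠ 0 := (show 0 < y from hy).ne'
    by_cases h : y ∈ Iic R
    · simp only [h, Set.indicator_of_mem, finrank_euclideanSpace, Fintype.card_fin, smul_eq_mul]
      rw [← mul_div_assoc, ← pow_succ, Nat.sub_add_cancel hn, div_self (pow_ne_zero _ hy0)]
    · simp [h]
  have hvol : volume (Iic R ∩ Ioi (0 : ℝ)) = ENNReal.ofReal R := by
    rw [Set.inter_comm, Ioi_inter_Iic, Real.volume_Ioc, sub_zero]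
  constructor
  · rw [integrable_fun_norm_addHaar volume, integrableOn_congr_fun hfun measurableSet_Ioi]
    refine (integrable_indicator_iff measurableSet_Iic).2 ?_
    rw [IntegrableOn, Measure.restrict_restrict measurableSet_Iic]
    exact integrableOn_const (by rw [hvol]; simp)
  · rw [integral_fun_norm_addHaar volume, setIntegral_congr_fun measurableSet_Ioi hfun,
      integral_indicator measurableSet_Iic, Measure.restrict_restrict measurableSet_Iic]
    simp [Measure.real, hvol, hR.le, sphereConst, mul_assoc]

/-- Polar coordinates leave R ∫_R^∞ r^{-2} dr = 1. That the value does not depend on R makes the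
off-diagonal estimate scale invariant. -/
lemma radial_far {n : ℕ} (hn : 1 ≤ n) {R : ℝ} (hR : 0 < R) :
    Integrable (fun z : Rn n => (Ioi R).indicator (fun r : ℝ => R / r ^ (n + 1)) ‖z‖) ∧
      ∫ z : Rn n, (Ioi R).indicator (fun r : ℝ => R / r ^ (n + 1)) ‖z‖ = sphereConst n := by
  have := nontrivial_Rn hn
  have hfun : ∀ y ∈ Ioi (0 : ℝ), y ^ (Module.finrank ℝ (Rn n) - 1) •
      (Ioi R).indicator (fun r : ℝ => R / r ^ (n + 1)) y =
        (Ioi R).indicator (fun y => R * y ^ (-2 : ℝ)) y := by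
    intro y hy
    have hy' : 0 < y := hy
    have hy0 : y ≠ 0 := hy'.ne'
    by_cases h : y ∈ Ioi R
    · simp only [h, Set.indicator_of_mem, finrank_euclideanSpace, Fintype.card_fin, smul_eq_mul]
      rw [Real.rpow_neg hy'.le]
      obtain ⟨m, rfl⟩ : ∃ m, n = m + 1 := ⟨n - 1, by omega⟩
      simp only [Nat.add_sub_cancel, Real.rpow_two]
      field_simp
      ring
    · simp [h]
  have hres : (Ioi R) ∩ Ioi (0 : ℝ) = Ioi R := by
    rw [Ioi_inter_Ioi, sup_eq_left.2 hR.le]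
  constructor
  · rw [integrable_fun_norm_addHaar volume, integrableOn_congr_fun hfun measurableSet_Ioi]
    refine (integrable_indicator_iff measurableSet_Ioi).2 ?_
    rw [IntegrableOn, Measure.restrict_restrict measurableSet_Ioi, hres]
    exact (integrableOn_Ioi_rpow_of_lt (by norm_num) hR).const_mul _
  · rw [integral_fun_norm_addHaar volume, setIntegral_congr_fun measurableSet_Ioi hfun,
      integral_indicator measurableSet_Ioi, Measure.restrict_restrict measurableSet_Ioi, hres,
      integral_const_mul, integral_Ioi_rpow_of_lt (by norm_num) hR]
    have : R * (-R ^ (-2 + 1 : ℝ) / (-2 + 1)) = 1 := by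
      norm_num
      rw [Real.rpow_neg_one]
      exact mul_inv_cancel₀ hR.ne'
    rw [this]
    simp [sphereConst]

/-- Smooth kernels `ψ_k` adapted to the scale `2^k`, with mean value zero. -/
structure IsKernelFamily {n : ℕ} (ψ : ℤ → Rn n → ℂ) (A : ℝ) : Prop where
  supp : ∀ k x, ψ k x ≠ 0 → ‖x‖ ≤ 2 * (2 : ℝ) ^ k
  bound : ∀ k x, ‖ψ k x‖ ≤ A * ((2 : ℝ) ^ (-k)) ^ n
  lip : ∀ k x y, ‖ψ k x - ψ k y‖ ≤ A * ((2 : ℝ) ^ (-k)) ^ (n + 1) * ‖x - y‖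
  mean : ∀ k, ∫ x, ψ k x = 0

section profile

variable {n : ℕ} {φ : Rn n → ℝ}

lemma IsProfile.hasCompactSupport (hφ : IsProfile φ) : HasCompactSupport φ :=
  HasCompactSupport.intro (isCompact_closedBall 0 (1 / 4)) fun x hx => by
    by_contra h
    exact hx (by simpa using hφ.supp x h)

/-- The first difference will control the size of the smoothed kernels, the mixed second difference
their Lipschitz constant. The latter bound is the mean value inequality for b ↦ φ(b - z) - φ(b),
whose derivative is O(|z|) because the derivative of φ is Lipschitz. -/
lemma IsProfile.exists_bounds (hφ : IsProfile φ) : ∃ L : ℝ, 0 < L ∧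
    (∀ x y, |φ x - φ y| ≤ L * ‖x - y‖) ∧
    ∀ a y z, |φ (a - y - z) - φ (a - y) - (φ (a - z) - φ a)| ≤ L * ‖y‖ * ‖z‖ := by
  obtain ⟨C₁, h₁⟩ := hφ.smooth.lipschitzWith_of_hasCompactSupport hφ.hasCompactSupport (by simp)
  have hd : ContDiff ℝ 1 (fderiv ℝ φ) := 
    ((contDiff_infty_iff_fderiv.1 hφ.smooth).2).of_le (by simp)
  obtain ⟨C₂, h₂⟩ := hd.lipschitzWith_of_hasCompactSupport (hφ.hasCompactSupport.fderiv ℝ) (by simp)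
  have hdiff : Differentiable ℝ φ := hφ.smooth.differentiable (by simp)
  refine ⟨max 1 (max C₁ C₂), lt_max_of_lt_left one_pos, fun x y => ?_, fun a y z => ?_⟩
  · have := h₁.norm_sub_le x y
    rw [Real.norm_eq_abs] at this
    refine this.trans ?_
    gcongr
    exact (le_max_left _ _).trans (le_max_right _ _)
  · have hder : ∀ b, HasFDerivAt (fun b => φ (b - z) - φ b) (fderiv ℝ φ (b - z) - fderiv ℝ φ b) b := by
      intro b
      have h3 : HasFDerivAt (fun b => φ (b - z)) (fderiv ℝ φ (b - z)) b := by
        have := (hdiff (b - z)).hasFDerivAt.comp b ((hasFDerivAt_id b).sub_const z)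
        rwa [ContinuousLinearMap.comp_id] at this
      exact h3.sub (hdiff b).hasFDerivAt
    have := Convex.norm_image_sub_le_of_norm_fderiv_le (𝕜 := ℝ) (f := fun b => φ (b - z) - φ b)
      (C := C₂ * ‖z‖) (s := univ) (x := a) (y := a - y) (fun b _ => (hder b).differentiableAt)
      (fun b _ => by
        rw [(hder b).fderiv]
        simpa using h₂.norm_sub_le (b - z) b) convex_univ (mem_univ _) (mem_univ _)
    rw [Real.norm_eq_abs] at this
    have h4 : ‖a - y - a‖ = ‖y‖ := by rw [sub_sub_cancel_left, norm_neg]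
    rw [h4] at this
    calc _ ≤ (C₂ : ℝ) * ‖z‖ * ‖y‖ := this
      _ = C₂ * ‖y‖ * ‖z‖ := by ring
      _ ≤ _ := by gcongr; exact (le_max_right _ _).trans (le_max_right _ _)

lemma dilate_eq (φ : Rn n → ℝ) (k : ℤ) (x : Rn n) :
    dilate φ k x = ((2 : ℝ) ^ (-k)) ^ n * φ ((2 : ℝ) ^ (-k) • x) := by
  rw [dilate, ← zpow_natCast, ← zpow_mul, neg_mul]

lemma dilate_lip {L : ℝ} (hL : ∀ x y, |φ x - φ y| ≤ L * ‖x - y‖) (k : ℤ) (x y : Rn n) :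
    |dilate φ k x - dilate φ k y| ≤ L * ((2 : ℝ) ^ (-k)) ^ (n + 1) * ‖x - y‖ := by
  have hs : (0 : ℝ) < 2 ^ (-k) := by positivity
  rw [dilate_eq, dilate_eq, ← mul_sub, abs_mul, abs_of_pos (by positivity)]
  refine (mul_le_mul_of_nonneg_left (hL _ _) (by positivity)).trans (le_of_eq ?_)
  rw [← smul_sub, norm_smul, Real.norm_of_nonneg hs.le]; ring

lemma dilate_second {L : ℝ}
    (hL : ∀ a y z, |φ (a - y - z) - φ (a - y) - (φ (a - z) - φ a)| ≤ L * ‖y‖ * ‖z‖)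
    (k : ℤ) (a y z : Rn n) :
    |dilate φ k (a - y - z) - dilate φ k (a - y) - (dilate φ k (a - z) - dilate φ k a)| ≤
      L * ((2 : ℝ) ^ (-k)) ^ (n + 2) * ‖y‖ * ‖z‖ := by
  have hs : (0 : ℝ) < 2 ^ (-k) := by positivity
  simp only [dilate_eq, smul_sub]
  rw [← mul_sub, ← mul_sub, ← mul_sub, abs_mul, abs_of_pos (by positivity)]
  refine (mul_le_mul_of_nonneg_left (hL _ _ _) (by positivity)).trans (le_of_eq ?_)
  rw [norm_smul, norm_smul, Real.norm_of_nonneg hs.le]; ring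

lemma dilate_eq_zero (hφ : IsProfile φ) {k : ℤ} {x : Rn n} (h : (1 / 4) * (2 : ℝ) ^ k < ‖x‖) :
    dilate φ k x = 0 := by
  rw [dilate_eq]
  by_contra h0
  have := hφ.supp _ (right_ne_zero_of_mul h0)
  rw [norm_smul, Real.norm_of_nonneg (by positivity), zpow_neg,
    inv_mul_le_iff₀ (by positivity)] at this
  linarith

lemma continuous_dilate (hφ : IsProfile φ) (k : ℤ) : Continuous (dilate φ k) := by
  have := hφ.smooth.continuous
  have h : dilate φ k = fun x => ((2 : ℝ) ^ (-k)) ^ n * φ ((2 : ℝ) ^ (-k) • x) :=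
    funext (dilate_eq φ k)
  rw [h]; fun_prop

end profile

end RoughSquare

/-! ### The smoothed kernels φ_k * K_k as principal values. -/

namespace RoughSquare

section rough

variable {n : ℕ} {φ : Rn n → ℝ} {K : Rn n → ℂ} {C : ℝ}

lemma IsRoughKernel.nonneg (hn : 1 ≤ n) (hK : IsRoughKernel K C) : 0 ≤ C := by
  have := nontrivial_Rn hn
  obtain ⟨x, hx⟩ := exists_ne (0 : Rn n)
  have h := (norm_nonneg _).trans (hK.size x hx)
  have hx' : 0 < ‖x‖ ^ n := by positivity
  by_contra hC
  exact absurd h (not_le.2 (div_neg_of_neg_of_pos (not_le.1 hC) hx'))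

lemma IsRoughKernel.norm_smul_le (hK : IsRoughKernel K C) {D : Rn n → ℝ} {M : ℝ}
    (hD : ∀ z, |D z| ≤ M * ‖z‖) (z : Rn n) :
    ‖D z • K z‖ ≤ M * C * (‖z‖ / ‖z‖ ^ n) := by
  rcases eq_or_ne z 0 with rfl | hz
  · have : D 0 = 0 := by simpa using hD 0
    simp [this]
  · rw [norm_smul, Real.norm_eq_abs]
    calc |D z| * ‖K z‖ ≤ M * ‖z‖ * (C / ‖z‖ ^ n) := by
          gcongr
          · exact (abs_nonneg _).trans (hD z)
          · exact hD z
          · exact hK.size z hz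
      _ = _ := by ring

/-- The linear vanishing of `D` at the origin removes one power of the singularity and leaves
|z|^{1-n}, so only the size bound on `K` is needed. It is applied to first and mixed second
differences of φ_k. -/
lemma IsRoughKernel.weighted_integral (hn : 1 ≤ n) (hK : IsRoughKernel K C) {D : Rn n → ℝ}
    (hDc : Continuous D) {M : ℝ} (hD : ∀ z, |D z| ≤ M * ‖z‖) {R : ℝ} (hR : 0 < R) :
    IntegrableOn (fun z => D z • K z) (Metric.closedBall 0 R) ∧
      ‖∫ z in Metric.closedBall 0 R, D z • K z‖ ≤ M * C * (sphereConst n * R) := by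
  obtain ⟨h1, h2⟩ := radial_near hn hR
  have hmeas : AEStronglyMeasurable (fun z => D z • K z) volume :=
    hDc.aestronglyMeasurable.smul hK.meas
  have hb : ∀ z, ‖(Metric.closedBall 0 R).indicator (fun z => D z • K z) z‖ ≤
      M * C * (Iic R).indicator (fun r : ℝ => r / r ^ n) ‖z‖ := by
    intro z
    by_cases hz : ‖z‖ ≤ R
    · have h3 : z ∈ Metric.closedBall (0 : Rn n) R := by simpa using hz
      rw [Set.indicator_of_mem h3, Set.indicator_of_mem (show ‖z‖ ∈ Iic R from hz)]
      exact hK.norm_smul_le hD z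
    · have h3 : z ∉ Metric.closedBall (0 : Rn n) R := by simpa using hz
      rw [Set.indicator_of_notMem h3, Set.indicator_of_notMem (show ‖z‖ ∉ Iic R from hz)]
      simp
  have hint : Integrable ((Metric.closedBall 0 R).indicator (fun z => D z • K z)) :=
    (h1.const_mul (M * C)).mono' (hmeas.indicator Metric.isClosed_closedBall.measurableSet)
      (Eventually.of_forall hb)
  refine ⟨(integrable_indicator_iff Metric.isClosed_closedBall.measurableSet).1 hint, ?_⟩
  rw [← integral_indicator Metric.isClosed_closedBall.measurableSet, ← h2, ← integral_const_mul]
  exact (norm_integral_le_integral_norm _).trans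
    (integral_mono hint.norm (h1.const_mul (M * C)) hb)

lemma IsRoughKernel.integrableOn_annulus (hn : 1 ≤ n) (hK : IsRoughKernel K C) {ε R : ℝ}
    (hε : 0 < ε) : IntegrableOn K {z : Rn n | ε < ‖z‖ ∧ ‖z‖ ≤ R} := by
  have hC := hK.nonneg hn
  refine Measure.integrableOn_of_bounded (M := C / ε ^ n) ?_ hK.meas ?_
  · refine ((measure_mono fun z hz => ?_).trans_lt
      (measure_closedBall_lt_top (x := (0 : Rn n)) (r := R))).ne
    simpa using hz.2
  · refine (ae_restrict_iff' ?_).2 (Eventually.of_forall fun z hz => ?_)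
    · exact (measurableSet_lt measurable_const measurable_norm).inter
        (measurableSet_le measurable_norm measurable_const)
    · have hz0 : z ≠ 0 := by rintro rfl; simp at hz; linarith [hz.1]
      refine (hK.size z hz0).trans ?_
      gcongr
      exact hz.1.le

/-- The hypothesis has a strict outer inequality while the truncation ‖z‖ ≤ 2^k does not; the sphere
between them is null. -/
lemma IsRoughKernel.integral_annulus (hn : 1 ≤ n) (hK : IsRoughKernel K C) {ε R : ℝ}
    (hε : 0 < ε) (hR : 0 < R) : ∫ z in {z : Rn n | ε < ‖z‖ ∧ ‖z‖ ≤ R}, K z = 0 := by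
  have := nontrivial_Rn hn
  rw [← hK.cancel ε R hε hR]
  refine setIntegral_congr_set ?_
  have h0 : volume (Metric.sphere (0 : Rn n) R) = 0 :=
    Measure.addHaar_sphere_of_ne_zero volume 0 hR.ne'
  have h1 : ∀ᵐ z : Rn n, z ∉ Metric.sphere (0 : Rn n) R := measure_eq_zero_iff_ae_notMem.1 h0
  filter_upwards [h1] with z hz
  have hz' : ‖z‖ ≠ R := by simpa using hz
  refine propext ⟨fun h => ⟨h.1, lt_of_le_of_ne h.2 hz'⟩, fun h => ⟨h.1, h.2.le⟩⟩

/-- The principal value written with the cancellation of `K` built in. -/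
noncomputable def pvKernel (φ : Rn n → ℝ) (K : Rn n → ℂ) (k : ℤ) (x : Rn n) : ℂ :=
  ∫ z in Metric.closedBall 0 ((2 : ℝ) ^ k), (dilate φ k (x - z) - dilate φ k x) • K z

/-- Subtracting the constant φ_k(x) is free, because `K` has integral zero over ε < |z| ≤ 2^k. The
new integrand has a majorant independent of ε, so dominated convergence applies as ε tends to 0. -/
lemma epsConv_eq (hn : 1 ≤ n) (hφ : IsProfile φ) (hK : IsRoughKernel K C) (k : ℤ) {ε : ℝ}
    (hε : 0 < ε) (x : Rn n) :
    epsConv φ K k ε x = ∫ z in Metric.closedBall 0 ((2 : ℝ) ^ k),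
      {z : Rn n | ε < ‖z‖}.indicator
        (fun z => (dilate φ k (x - z) - dilate φ k x) • K z) z := by
  set U : Set (Rn n) := {z | ε < ‖z‖ ∧ ‖z‖ ≤ (2 : ℝ) ^ k} with hU
  have hUm : MeasurableSet U := (measurableSet_lt measurable_const measurable_norm).inter
        (measurableSet_le measurable_norm measurable_const)
  have hεm : MeasurableSet {z : Rn n | ε < ‖z‖} := measurableSet_lt measurable_const measurable_norm
  have hc := continuous_dilate hφ k
  have hKU : IntegrableOn K U := hK.integrableOn_annulus hn hε
  have hbd : ∃ M, ∀ z, ‖dilate φ k z‖ ≤ M := by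
    have : HasCompactSupport (dilate φ k) :=
      HasCompactSupport.intro (isCompact_closedBall 0 ((1 / 4) * (2 : ℝ) ^ k)) fun z hz =>
        dilate_eq_zero hφ (by simpa using hz)
    obtain ⟨M, hM⟩ := this.exists_bound_of_continuous hc
    exact ⟨M, hM⟩
  obtain ⟨M, hM⟩ := hbd
  have hKU1 : IntegrableOn (fun z => dilate φ k (x - z) • K z) U :=
    hKU.bdd_smul M (φ := fun z => dilate φ k (x - z))
      (Continuous.aestronglyMeasurable (by fun_prop)) (Eventually.of_forall fun z => hM _)
  have e1 : epsConv φ K k ε x = ∫ z in U, dilate φ k (x - z) • K z := by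
    rw [epsConv, convolution_lsmul_swap, ← integral_indicator hUm]
    congr 1; ext z
    rw [truncKernel, Set.indicator_indicator]
    have : {z : Rn n | ε < ‖z‖} ∩ {z | ‖z‖ ≤ (2 : ℝ) ^ k} = U := rfl
    rw [this]
    by_cases hz : z ∈ U <;> simp [hz]
  have e2 : ∫ z in U, dilate φ k (x - z) • K z =
      ∫ z in U, (dilate φ k (x - z) - dilate φ k x) • K z := by
    simp only [sub_smul]
    have h2 : IntegrableOn (fun z => dilate φ k x • K z) U :=
      Integrable.smul (dilate φ k x) hKU
    rw [integral_sub hKU1 h2, integral_smul, hK.integral_annulus hn hε (by positivity),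
      smul_zero, sub_zero]
  rw [e1, e2, setIntegral_indicator hεm]
  congr 2
  ext z
  simp only [hU, Set.mem_inter_iff, Metric.mem_closedBall, dist_zero_right]
  exact and_comm

lemma tendsto_epsConv (hn : 1 ≤ n) (hφ : IsProfile φ) (hK : IsRoughKernel K C) (k : ℤ)
    (x : Rn n) : Tendsto (fun ε => epsConv φ K k ε x) (𝓝[>] (0 : ℝ)) (𝓝 (pvKernel φ K k x)) := by
  have := nontrivial_Rn hn
  obtain ⟨L, hL0, hL, -⟩ := hφ.exists_bounds
  have hc := continuous_dilate hφ k
  have hD : ∀ z, |dilate φ k (x - z) - dilate φ k x| ≤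
      L * ((2 : ℝ) ^ (-k)) ^ (n + 1) * ‖z‖ := fun z => by
    have := dilate_lip hL k (x - z) x
    rwa [sub_sub_cancel_left, norm_neg] at this
  have hDc : Continuous fun z => dilate φ k (x - z) - dilate φ k x := by fun_prop
  obtain ⟨hint, -⟩ := hK.weighted_integral hn hDc hD (R := (2 : ℝ) ^ k) (by positivity)
  have hev : ∀ᶠ ε in 𝓝[>] (0 : ℝ), (∫ z in Metric.closedBall 0 ((2 : ℝ) ^ k),
      {z : Rn n | ε < ‖z‖}.indicator
        (fun z => (dilate φ k (x - z) - dilate φ k x) • K z) z) = epsConv φ K k ε x := by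
    filter_upwards [self_mem_nhdsWithin] with ε hε
    exact (epsConv_eq hn hφ hK k hε x).symm
  refine Tendsto.congr' hev ?_
  refine tendsto_integral_filter_of_dominated_convergence
    (fun z => ‖(dilate φ k (x - z) - dilate φ k x) • K z‖) ?_ ?_ hint.norm ?_
  · exact Eventually.of_forall fun ε => hint.aestronglyMeasurable.indicator
      (measurableSet_lt measurable_const measurable_norm)
  · exact Eventually.of_forall fun ε => Eventually.of_forall fun z => norm_indicator_le_norm_self _ _
  · have h0 : ∀ᵐ z : Rn n ∂volume.restrict (Metric.closedBall 0 ((2 : ℝ) ^ k)), z ≠ 0 :=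
      ae_restrict_of_ae (by simp [ae_iff])
    filter_upwards [h0] with z hz
    refine tendsto_const_nhds.congr' ?_
    have : ∀ᶠ ε in 𝓝[>] (0 : ℝ), ε < ‖z‖ :=
      mem_nhdsWithin_of_mem_nhds (Iio_mem_nhds (norm_pos_iff.2 hz))
    filter_upwards [this] with ε hε
    rw [Set.indicator_of_mem (show z ∈ {z : Rn n | ε < ‖z‖} from hε)]

lemma smoothKernel_eq (hn : 1 ≤ n) (hφ : IsProfile φ) (hK : IsRoughKernel K C) (k : ℤ)
    (x : Rn n) : smoothKernel φ K k x = pvKernel φ K k x :=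
  (tendsto_epsConv hn hφ hK k x).limUnder_eq

/-- Fubini: for fixed z the integral in x of φ_k(x - z) - φ_k(x) is zero by translation invariance.
Joint integrability comes from the first-order bound in z and the vanishing for |x| > 2·2^k. -/
lemma pvKernel_mean (hn : 1 ≤ n) (hφ : IsProfile φ) (hK : IsRoughKernel K C) (k : ℤ) :
    ∫ x, pvKernel φ K k x = 0 := by
  obtain ⟨L, hL0, hL, -⟩ := hφ.exists_bounds
  have hc := continuous_dilate hφ k
  set R : ℝ := (2 : ℝ) ^ k with hR
  have hR0 : 0 < R := by positivity
  set M := L * ((2 : ℝ) ^ (-k)) ^ (n + 1) with hM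
  have hC := hK.nonneg hn
  have hD : ∀ x z, |dilate φ k (x - z) - dilate φ k x| ≤ M * ‖z‖ := fun x z => by
    have := dilate_lip hL k (x - z) x
    rwa [sub_sub_cancel_left, norm_neg] at this
  have hint : Integrable (Function.uncurry fun x z =>
      (dilate φ k (x - z) - dilate φ k x) • K z)
      (volume.prod (volume.restrict (Metric.closedBall (0 : Rn n) R))) := by
    have h1 : Integrable ((Metric.closedBall (0 : Rn n) (2 * R)).indicator fun _ => (1 : ℝ)) :=
      (integrable_indicator_iff Metric.isClosed_closedBall.measurableSet).2
        (integrableOn_const measure_closedBall_lt_top.ne)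
    have h2 := ((radial_near hn hR0).1.const_mul (M * C)).integrableOn
      (s := Metric.closedBall (0 : Rn n) R)
    refine (h1.mul_prod h2).mono' ?_ ?_
    · refine AEStronglyMeasurable.smul
        (f := fun q : Rn n × Rn n => dilate φ k (q.1 - q.2) - dilate φ k q.1)
        (Continuous.aestronglyMeasurable (by fun_prop)) ?_
      exact hK.meas.restrict.comp_snd
    · have hae : ∀ᵐ q : Rn n × Rn n ∂(volume.prod (volume.restrict (Metric.closedBall (0 : Rn n) R))),
          q.2 ∈ Metric.closedBall (0 : Rn n) R := by
        have := ae_restrict_mem (μ := (volume : Measure (Rn n)))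
          (Metric.isClosed_closedBall (x := (0 : Rn n)) (ε := R)).measurableSet
        exact Measure.quasiMeasurePreserving_snd.ae this
      filter_upwards [hae] with q hq
      obtain ⟨x, z⟩ := q
      simp only [Metric.mem_closedBall, dist_zero_right] at hq
      simp only [Function.uncurry_apply_pair]
      rw [Set.indicator_of_mem (show ‖z‖ ∈ Iic R from hq)]
      by_cases hx : ‖x‖ ≤ 2 * R
      · rw [Set.indicator_of_mem (by simpa using hx), one_mul]
        exact hK.norm_smul_le (hD x) z
      · push Not at hx
        have hz1 : dilate φ k x = 0 := dilate_eq_zero hφ (by linarith)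
        have hz2 : dilate φ k (x - z) = 0 := dilate_eq_zero hφ (by
          have := norm_sub_norm_le x z
          linarith)
        rw [hz1, hz2, Set.indicator_of_notMem (by simpa using hx)]
        simp
  unfold pvKernel
  rw [integral_integral_swap hint]
  refine integral_eq_zero_of_ae (Eventually.of_forall fun z => ?_)
  have hci : Integrable (dilate φ k) := hc.integrable_of_hasCompactSupport
    (HasCompactSupport.intro (isCompact_closedBall 0 ((1 / 4) * (2 : ℝ) ^ k)) fun z hz =>
        dilate_eq_zero hφ (by simpa using hz))
  simp only [Pi.zero_apply]
  rw [integral_smul_const, integral_sub (hci.comp_sub_right z) hci, integral_sub_right_eq_self,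
    sub_self, zero_smul]

/-- The kernels `φ_k * K_k` form a family of smooth kernels. -/
theorem exists_isKernelFamily (hn : 1 ≤ n) (hφ : IsProfile φ) :
    ∃ c : ℝ, 0 < c ∧ ∀ (K : Rn n → ℂ) (C : ℝ), IsRoughKernel K C →
      IsKernelFamily (smoothKernel φ K) (c * C) := by
  obtain ⟨L, hL0, hL, hL2⟩ := hφ.exists_bounds
  refine ⟨L * sphereConst n, mul_pos hL0 (sphereConst_pos hn), fun K C hK => ?_⟩
  have hC := hK.nonneg hn
  have hcn := (sphereConst_pos hn).le
  have hD : ∀ (k : ℤ) (x z : Rn n), |dilate φ k (x - z) - dilate φ k x| ≤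
      L * ((2 : ℝ) ^ (-k)) ^ (n + 1) * ‖z‖ := fun k x z => by
    have := dilate_lip hL k (x - z) x
    rwa [sub_sub_cancel_left, norm_neg] at this
  have hDc : ∀ (k : ℤ) (x : Rn n), Continuous fun z => dilate φ k (x - z) - dilate φ k x := by
    intro k x
    have := continuous_dilate hφ k
    fun_prop
  refine ⟨fun k x hx => ?_, fun k x => ?_, fun k x y => ?_, fun k => ?_⟩
  · rw [smoothKernel_eq hn hφ hK] at hx
    by_contra hlt
    push Not at hlt
    have hk : (0 : ℝ) < 2 ^ k := by positivity
    refine hx (setIntegral_eq_zero_of_forall_eq_zero fun z hz => ?_)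
    simp only [Metric.mem_closedBall, dist_zero_right] at hz
    have h1 : dilate φ k x = 0 := dilate_eq_zero hφ (by linarith)
    have h2 : dilate φ k (x - z) = 0 := dilate_eq_zero hφ (by
      have := norm_sub_norm_le x z
      linarith)
    simp [h1, h2]
  · rw [smoothKernel_eq hn hφ hK]
    refine ((hK.weighted_integral hn (hDc k x) (hD k x)
      (R := (2 : ℝ) ^ k) (by positivity)).2).trans (le_of_eq ?_)
    rw [pow_succ, zpow_neg]
    field_simp
  · rw [smoothKernel_eq hn hφ hK, smoothKernel_eq hn hφ hK, pvKernel, pvKernel,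
      ← integral_sub (hK.weighted_integral hn (hDc k x) (hD k x) (by positivity)).1
        (hK.weighted_integral hn (hDc k y) (hD k y) (by positivity)).1]
    simp only [← sub_smul]
    -- The mixed second difference gains both ‖x - y‖, which is the Lipschitz estimate, and ‖z‖,
    -- which pays for the singularity of `K`.
    have hDD : ∀ z, |dilate φ k (x - z) - dilate φ k x - (dilate φ k (y - z) - dilate φ k y)| ≤
        L * ((2 : ℝ) ^ (-k)) ^ (n + 2) * ‖x - y‖ * ‖z‖ := by
      intro z
      have := dilate_second hL2 k y (y - x) z
      rw [sub_sub_cancel, norm_sub_rev] at this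
      exact this
    refine (hK.weighted_integral hn ((hDc k x).sub (hDc k y)) hDD
      (R := (2 : ℝ) ^ k) (by positivity)).2.trans (le_of_eq ?_)
    rw [show n + 2 = n + 1 + 1 from rfl, pow_succ _ (n + 1), zpow_neg]
    field_simp
  · simp only [smoothKernel_eq hn hφ hK]
    exact pvKernel_mean hn hφ hK k

end rough

end RoughSquare

namespace RoughSquare

/-! ### Convolution square functions -/

variable {n : ℕ}

/-- The square function of a family of kernels. -/
noncomputable def sqFn (ψ : ℤ → Rn n → ℂ) (f : Rn n → ℂ) (x : Rn n) : ℝ≥0∞ :=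
  (∑' k : ℤ, ‖(ψ k ⋆[ContinuousLinearMap.mul ℂ ℂ, volume] f) x‖ₑ ^ 2) ^ (1 / 2 : ℝ)

lemma sqFn_sq (ψ : ℤ → Rn n → ℂ) (f : Rn n → ℂ) (x : Rn n) :
    sqFn ψ f x ^ 2 = ∑' k : ℤ, ‖(ψ k ⋆[ContinuousLinearMap.mul ℂ ℂ, volume] f) x‖ₑ ^ 2 := by
  rw [sqFn, ← ENNReal.rpow_natCast, ← ENNReal.rpow_mul]; norm_num

/-- Minkowski's inequality in ℓ², read as L² of the counting measure. -/
lemma sqrt_tsum_sq_add_le (a b : ℤ → ℝ≥0∞) :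
    (∑' k, (a k + b k) ^ 2) ^ (1 / 2 : ℝ) ≤
      (∑' k, a k ^ 2) ^ (1 / 2 : ℝ) + (∑' k, b k ^ 2) ^ (1 / 2 : ℝ) := by
  have := ENNReal.lintegral_Lp_add_le (μ := Measure.count) (p := 2) (f := a) (g := b)
    (measurable_from_top).aemeasurable (measurable_from_top).aemeasurable (by norm_num)
  simpa [lintegral_count] using this

lemma sqrt_tsum_sq_le_tsum (a : ℤ → ℝ≥0∞) :
    (∑' k, a k ^ 2) ^ (1 / 2 : ℝ) ≤ ∑' k, a k := by
  have h : ∑' k, a k ^ 2 ≤ (∑' k, a k) ^ (2 : ℝ) := by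
    rw [ENNReal.rpow_two, sq, ← ENNReal.tsum_mul_left]
    refine ENNReal.tsum_le_tsum fun k => ?_
    rw [sq]
    gcongr
    exact ENNReal.le_tsum k
  calc _ ≤ ((∑' k, a k) ^ (2 : ℝ)) ^ (1 / 2 : ℝ) := by gcongr
    _ = _ := by rw [← ENNReal.rpow_mul]; norm_num

/-- A sum over powers of two is dominated by its largest term, here at most M^s. The injection `e`
allows summation over the scales 2^k as well as 2^{-k}. -/
lemma tsum_scale_le {s : ℝ} (hs : 0 < s) (M : ℝ≥0∞) (e : ℤ → ℤ) (he : Function.Injective e)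
    (c : ℤ → ℝ≥0∞) (hc : ∀ k, c k ≠ 0 → (2 : ℝ≥0∞) ^ e k ≤ M)
    (hc' : ∀ k, c k ≤ ((2 : ℝ≥0∞) ^ e k) ^ s) : ∑' k, c k ≤ geomConst s * M ^ s := by
  classical
  rw [ENNReal.tsum_eq_iSup_sum]
  refine iSup_le fun T => ?_
  rw [← Finset.sum_filter_ne_zero]
  refine (Finset.sum_le_sum fun k _ => hc' k).trans
    (sum_rpow_le_of_separated hs _ (fun k => (2 : ℝ≥0∞) ^ e k) (fun k _ => two_zpow_ne_top _)
      (fun i _ j _ hij => two_zpow_separated (he.ne hij)) _ fun k hk => ?_)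
  exact hc k (Finset.mem_filter.1 hk).2

lemma ofReal_two_zpow (k : ℤ) : ENNReal.ofReal ((2 : ℝ) ^ k) = (2 : ℝ≥0∞) ^ k := by
  rw [← Real.rpow_intCast, ← ENNReal.ofReal_rpow_of_pos two_pos, ENNReal.rpow_intCast]; norm_num

lemma tsum_fatou (F : ℕ → ℤ → ℝ≥0∞) (G : ℤ → ℝ≥0∞)
    (h : ∀ k, Tendsto (fun j => F j k) atTop (𝓝 (G k))) :
    ∑' k, G k ≤ liminf (fun j => ∑' k, F j k) atTop := by
  have := lintegral_liminf_le (μ := (Measure.count : Measure ℤ)) (f := F) (u := atTop)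
    fun _ => measurable_from_top
  simp only [lintegral_count] at this
  refine le_trans (le_of_eq ?_) this
  exact tsum_congr fun k => (h k).liminf_eq.symm

namespace IsKernelFamily

variable {ψ : ℤ → Rn n → ℂ} {A : ℝ}

lemma continuous (h : IsKernelFamily ψ A) (k : ℤ) : Continuous (ψ k) := by
  refine (LipschitzWith.of_dist_le_mul (K := (A * ((2 : ℝ) ^ (-k)) ^ (n + 1)).toNNReal)
    fun x y => ?_).continuous
  rw [dist_eq_norm, dist_eq_norm]
  exact (h.lip k x y).trans (by gcongr; exact Real.le_coe_toNNReal _)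

lemma hasCompactSupport (h : IsKernelFamily ψ A) (k : ℤ) : HasCompactSupport (ψ k) :=
  HasCompactSupport.intro (isCompact_closedBall 0 (2 * (2 : ℝ) ^ k)) fun x hx => by
    by_contra h0
    exact hx (by simpa using h.supp k x h0)

lemma nonneg (h : IsKernelFamily ψ A) : 0 ≤ A := by
  have := (norm_nonneg _).trans (h.bound 0 0)
  simpa using this

lemma smul (h : IsKernelFamily ψ A) (c : ℝ) (hc : 0 ≤ c) :
    IsKernelFamily (fun k x => (c : ℂ) * ψ k x) (c * A) where
  supp k x hx := h.supp k x (right_ne_zero_of_mul hx)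
  bound k x := by
    rw [norm_mul, Complex.norm_real, Real.norm_of_nonneg hc, mul_assoc]
    exact mul_le_mul_of_nonneg_left (h.bound k x) hc
  lip k x y := by
    rw [← mul_sub, norm_mul, Complex.norm_real, Real.norm_of_nonneg hc, mul_assoc, mul_assoc]
    refine mul_le_mul_of_nonneg_left ?_ hc
    rw [← mul_assoc]; exact h.lip k x y
  mean k := by rw [integral_const_mul, h.mean k, mul_zero]

lemma convolutionExistsAt (h : IsKernelFamily ψ A) {f : Rn n → ℂ} (hf : LocallyIntegrable f)
    (k : ℤ) (x : Rn n) :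
    ConvolutionExistsAt (ψ k) f x (ContinuousLinearMap.mul ℂ ℂ) volume :=
  (h.hasCompactSupport k).convolutionExists_left _ (h.continuous k) hf x

lemma integrable_mul (h : IsKernelFamily ψ A) {f : Rn n → ℂ} (hf : LocallyIntegrable f)
    (k : ℤ) (x : Rn n) : Integrable fun y => ψ k (x - y) * f y := by
  have := (h.convolutionExistsAt hf k x).integrable_swap
  simpa using this

lemma measurable_sqFn (h : IsKernelFamily ψ A) {f : Rn n → ℂ} (hf : LocallyIntegrable f) :
    Measurable (sqFn ψ f) := by
  refine Measurable.pow_const (Measurable.tsum fun k => Measurable.pow_const ?_ 2) _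
  exact ((h.hasCompactSupport k).continuous_convolution_left _ (h.continuous k)
    hf).measurable.enorm

lemma sqFn_add_le (h : IsKernelFamily ψ A) {f g : Rn n → ℂ} (hf : LocallyIntegrable f)
    (hg : LocallyIntegrable g) (x : Rn n) : sqFn ψ (f + g) x ≤ sqFn ψ f x + sqFn ψ g x := by
  refine le_trans ?_ (sqrt_tsum_sq_add_le _ _)
  rw [sqFn]
  gcongr with k
  rw [(h.convolutionExistsAt hf k x).distrib_add (h.convolutionExistsAt hg k x)]
  exact enorm_add_le _ _

/-- The square function varies slowly with the point. -/
lemma sqFn_le_add (h : IsKernelFamily ψ A) {f : Rn n → ℂ} (hf : LocallyIntegrable f)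
    (x x' : Rn n) : sqFn ψ f x ≤ sqFn ψ f x' +
      ∫⁻ y, (∑' k, ‖ψ k (x - y) - ψ k (x' - y)‖ₑ) * ‖f y‖ₑ := by
  have h1 : ∀ k, ‖(ψ k ⋆[ContinuousLinearMap.mul ℂ ℂ, volume] f) x‖ₑ ≤
      ‖(ψ k ⋆[ContinuousLinearMap.mul ℂ ℂ, volume] f) x'‖ₑ +
        ∫⁻ y, ‖ψ k (x - y) - ψ k (x' - y)‖ₑ * ‖f y‖ₑ := by
    intro k
    have e : (ψ k ⋆[ContinuousLinearMap.mul ℂ ℂ, volume] f) x =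
        (ψ k ⋆[ContinuousLinearMap.mul ℂ ℂ, volume] f) x' +
          ∫ y, (ψ k (x - y) - ψ k (x' - y)) * f y := by
      simp only [sub_mul]
      rw [integral_sub (h.integrable_mul hf k x) (h.integrable_mul hf k x'), convolution_mul_swap,
        convolution_mul_swap]
      ring
    rw [e]
    refine (enorm_add_le _ _).trans ?_
    gcongr
    refine (enorm_integral_le_lintegral_enorm _).trans (le_of_eq ?_)
    simp only [enorm_mul]
  calc sqFn ψ f x ≤ (∑' k, (‖(ψ k ⋆[ContinuousLinearMap.mul ℂ ℂ, volume] f) x'‖ₑ +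
        ∫⁻ y, ‖ψ k (x - y) - ψ k (x' - y)‖ₑ * ‖f y‖ₑ) ^ 2) ^ (1 / 2 : ℝ) := by
        rw [sqFn]; gcongr with k; exact h1 k
    _ ≤ _ := (sqrt_tsum_sq_add_le _ _).trans (by
        rw [sqFn]
        gcongr
        refine (sqrt_tsum_sq_le_tsum _).trans (le_of_eq ?_)
        rw [← lintegral_tsum]
        · simp only [ENNReal.tsum_mul_right]
        · intro k
          refine AEMeasurable.mul ?_ hf.aestronglyMeasurable.enorm
          have := h.continuous k
          exact (Continuous.measurable (by fun_prop)).enorm.aemeasurable)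

lemma sqFn_congr {f g : Rn n → ℂ} (hfg : f =ᵐ[volume] g) : sqFn ψ f = sqFn ψ g := by
  ext x
  rw [sqFn, sqFn]
  congr 2
  ext k
  congr 2
  rw [convolution_mul_swap, convolution_mul_swap]
  refine integral_congr_ae ?_
  filter_upwards [hfg] with y hy
  rw [hy]

/-- The kernel regularity, summed over all scales. -/
lemma tsum_sub_le (h : IsKernelFamily ψ 1) {x x' : Rn n} {m : ℝ} (hm : 0 < m) (hx : m ≤ ‖x‖)
    (hx' : m ≤ ‖x'‖) : ∑' k, ‖ψ k x - ψ k x'‖ₑ ≤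
      geomConst (n + 1) * 2 ^ (n + 1) * ENNReal.ofReal (‖x - x'‖ / m ^ (n + 1)) := by
  -- A nonzero difference puts one of the points into the support |·| ≤ 2·2^k. Small scales
  -- therefore do not contribute, and 2^{-k(n+1)} sums geometrically over the others.
  have h1 : ∀ k, ψ k x - ψ k x' ≠ 0 → (2 : ℝ) ^ (-k) ≤ 2 / m := by
    intro k hk
    have : ψ k x ≠ 0 ∨ ψ k x' ≠ 0 := by
      by_contra hcon
      push Not at hcon
      exact hk (by rw [hcon.1, hcon.2, sub_zero])
    have h2 : m ≤ 2 * 2 ^ k := by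
      rcases this with h3 | h3
      · exact hx.trans (h.supp k x h3)
      · exact hx'.trans (h.supp k x' h3)
    rw [zpow_neg, inv_le_iff_one_le_mul₀ (by positivity), div_mul_eq_mul_div, le_div_iff₀ hm]
    linarith
  have h2 : ∀ k, ‖ψ k x - ψ k x'‖ₑ ≤ (if ψ k x - ψ k x' = 0 then 0 else
      ((2 : ℝ≥0∞) ^ (-k)) ^ ((n : ℝ) + 1)) * ENNReal.ofReal ‖x - x'‖ := by
    intro k
    split_ifs with h0
    · simp [h0]
    · rw [← ofReal_norm, ← ofReal_two_zpow, ← Nat.cast_succ, ENNReal.rpow_natCast,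
        ← ENNReal.ofReal_pow (by positivity), ← ENNReal.ofReal_mul (by positivity)]
      refine ENNReal.ofReal_le_ofReal ?_
      have := h.lip k x x'
      rwa [one_mul] at this
  calc _ ≤ ∑' k, (if ψ k x - ψ k x' = 0 then 0 else
        ((2 : ℝ≥0∞) ^ (-k)) ^ ((n : ℝ) + 1)) * ENNReal.ofReal ‖x - x'‖ :=
        ENNReal.tsum_le_tsum h2
    _ ≤ geomConst (n + 1) * ENNReal.ofReal (2 / m) ^ ((n : ℝ) + 1) * ENNReal.ofReal ‖x - x'‖ := by
        rw [ENNReal.tsum_mul_right]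
        gcongr
        refine tsum_scale_le (by positivity) _ (fun k => -k) neg_injective _ ?_ ?_
        · intro k hk
          rw [← ofReal_two_zpow]
          refine ENNReal.ofReal_le_ofReal (h1 k fun h0 => hk (by simp [h0]))
        · intro k
          split_ifs <;> simp
    _ = _ := by
        rw [mul_assoc, mul_assoc]
        congr 1
        rw [← Nat.cast_succ, ENNReal.rpow_natCast, ← ENNReal.ofReal_pow (by positivity),
          ← ENNReal.ofReal_mul (by positivity),
          show (2 : ℝ≥0∞) ^ (n + 1) = ENNReal.ofReal ((2 : ℝ) ^ (n + 1)) by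
            rw [ENNReal.ofReal_pow (by norm_num)]; norm_num,
          ← ENNReal.ofReal_mul (by positivity), div_pow]
        congr 1
        simp only [Nat.succ_eq_add_one]
        ring

end IsKernelFamily

end RoughSquare

namespace RoughSquare

/-! ### The `L²` bound -/

open scoped FourierTransform

variable {n : ℕ}

/-- The constant in the decay estimates of the Fourier transforms. -/
noncomputable def decayConst (n : ℕ) : ℝ :=
  4 * Real.pi * 2 ^ n * (volume : Measure (Rn n)).real (Metric.ball 0 1)

lemma decayConst_nonneg (n : ℕ) : 0 ≤ decayConst n := by
  have := Real.pi_pos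
  unfold decayConst; positivity

namespace IsKernelFamily

variable {ψ : ℤ → Rn n → ℂ} {A : ℝ}

lemma integrable (h : IsKernelFamily ψ A) (k : ℤ) : Integrable (ψ k) :=
  (h.continuous k).integrable_of_hasCompactSupport (h.hasCompactSupport k)

lemma volume_real_closedBall (c : Rn n) {r : ℝ} (hr : 0 ≤ r) :
    (volume : Measure (Rn n)).real (Metric.closedBall c r) =
      r ^ n * (volume : Measure (Rn n)).real (Metric.ball 0 1) := by
  rw [Measure.real, Measure.addHaar_closedBall volume c hr, ENNReal.toReal_mul,
    ENNReal.toReal_ofReal (by positivity)]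
  simp [Measure.real]

/-- Mean value zero allows subtracting 1 from the exponential, and the difference is at most
2π|v||ξ| on the support |v| ≤ 2·2^k. -/
lemma fourier_le_small (h : IsKernelFamily ψ 1) (k : ℤ) (ξ : Rn n) :
    ‖𝓕 (ψ k) ξ‖ ≤ decayConst n * ((2 : ℝ) ^ k * ‖ξ‖) := by
  set R : ℝ := 2 * 2 ^ k with hR
  have hR0 : 0 < R := by positivity
  have e1 : 𝓕 (ψ k) ξ = ∫ v in Metric.closedBall (0 : Rn n) R,
      ((Real.fourierChar (-inner ℝ v ξ) : ℂ) - 1) * ψ k v := by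
    rw [setIntegral_eq_integral_of_forall_compl_eq_zero]
    · have e2 : ∫ v, ((Real.fourierChar (-inner ℝ v ξ) : ℂ) - 1) * ψ k v =
          (∫ v, Real.fourierChar (-inner ℝ v ξ) • ψ k v) - ∫ v, ψ k v := by
        rw [← integral_sub ((Real.fourierIntegral_convergent_iff ξ).2 (h.integrable k))
          (h.integrable k)]
        congr 1; ext v
        rw [sub_mul, one_mul, Circle.smul_def, smul_eq_mul]
      rw [e2, h.mean k, sub_zero, Real.fourier_eq]
    · intro v hv
      have : ψ k v = 0 := by
        by_contra h0
        exact hv (by simpa using h.supp k v h0)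
      simp [this]
  have hpt : ∀ v ∈ Metric.closedBall (0 : Rn n) R,
      ‖((Real.fourierChar (-inner ℝ v ξ) : ℂ) - 1) * ψ k v‖ ≤
        (2 * Real.pi * (R * ‖ξ‖)) * ((2 : ℝ) ^ (-k)) ^ n := by
    intro v hv
    have hv' : ‖v‖ ≤ R := by simpa using hv
    rw [norm_mul]
    have h1 : ‖(Real.fourierChar (-inner ℝ v ξ) : ℂ) - 1‖ ≤ 2 * Real.pi * (R * ‖ξ‖) := by
      rw [Real.fourierChar_apply, mul_comm]
      refine Real.norm_exp_I_mul_ofReal_sub_one_le.trans ?_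
      rw [norm_mul, Real.norm_of_nonneg Real.two_pi_pos.le, norm_neg]
      have := Real.two_pi_pos
      gcongr
      exact (norm_inner_le_norm v ξ).trans (by gcongr)
    have h2 := h.bound k v
    rw [one_mul] at h2
    have := Real.two_pi_pos
    gcongr
  rw [e1]
  refine (norm_setIntegral_le_of_norm_le_const measure_closedBall_lt_top hpt).trans
    (le_of_eq ?_)
  rw [volume_real_closedBall _ hR0.le, decayConst, hR, mul_pow, zpow_neg, inv_pow]
  field_simp
  ring

/-- Translation by y with ⟨y, ξ⟩ = 1/2 changes the sign of the exponential, so the transform is half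
the one of ψ_k - ψ_k(· + y). The Lipschitz bound then gains ‖y‖ = 1/(2‖ξ‖); the second ball in `U`
carries the translate. -/
lemma fourier_le_large (h : IsKernelFamily ψ 1) (k : ℤ) {ξ : Rn n} (hξ : ξ ≠ 0) :
    ‖𝓕 (ψ k) ξ‖ ≤ decayConst n * ((2 : ℝ) ^ k * ‖ξ‖)⁻¹ := by
  set R : ℝ := 2 * 2 ^ k with hR
  have hR0 : 0 < R := by positivity
  have hξ0 : 0 < ‖ξ‖ := norm_pos_iff.2 hξ
  set y : Rn n := (1 / (2 * ‖ξ‖ ^ 2)) • ξ with hy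
  have hyn : ‖y‖ = 1 / (2 * ‖ξ‖) := by
    rw [hy, norm_smul, Real.norm_of_nonneg (by positivity)]
    field_simp
  rw [Real.fourier_eq, fourierIntegral_eq_half_sub_half_period_translate hξ (h.integrable k)]
  simp only
  rw [norm_smul]
  set U : Set (Rn n) := Metric.closedBall 0 R ∪ Metric.closedBall (-y) R with hU
  have hUt : volume U < ⊤ :=
    (measure_union_le _ _).trans_lt (ENNReal.add_lt_top.2
      ⟨measure_closedBall_lt_top, measure_closedBall_lt_top⟩)
  have e1 : ∫ v, Real.fourierChar (-inner ℝ v ξ) • (ψ k v - ψ k (v + y)) =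
      ∫ v in U, Real.fourierChar (-inner ℝ v ξ) • (ψ k v - ψ k (v + y)) := by
    refine (setIntegral_eq_integral_of_forall_compl_eq_zero fun v hv => ?_).symm
    have h1 : ψ k v = 0 := by
      by_contra h0
      exact hv (Or.inl (by simpa using h.supp k v h0))
    have h2 : ψ k (v + y) = 0 := by
      by_contra h0
      refine hv (Or.inr ?_)
      rw [Metric.mem_closedBall, dist_eq_norm, sub_neg_eq_add]
      exact h.supp k _ h0
    simp [h1, h2]
  have hpt : ∀ v ∈ U, ‖Real.fourierChar (-inner ℝ v ξ) • (ψ k v - ψ k (v + y))‖ ≤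
      ((2 : ℝ) ^ (-k)) ^ (n + 1) * (1 / (2 * ‖ξ‖)) := by
    intro v _
    rw [Circle.norm_smul]
    have := h.lip k v (v + y)
    rwa [one_mul, sub_add_cancel_left, norm_neg, hyn] at this
  rw [e1]
  have h3 := norm_setIntegral_le_of_norm_le_const hUt hpt
  have h4 : (volume : Measure (Rn n)).real U ≤
      2 * (R ^ n * (volume : Measure (Rn n)).real (Metric.ball 0 1)) := by
    refine (measureReal_union_le _ _).trans (le_of_eq ?_)
    rw [volume_real_closedBall _ hR0.le, volume_real_closedBall _ hR0.le]; ring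
  have hpi : 1 / 2 ≤ 4 * Real.pi := by linarith [Real.two_le_pi]
  calc _ ≤ ‖(1 / 2 : ℂ)‖ * (((2 : ℝ) ^ (-k)) ^ (n + 1) * (1 / (2 * ‖ξ‖)) *
        (2 * (R ^ n * (volume : Measure (Rn n)).real (Metric.ball 0 1)))) := by
        gcongr
        exact h3.trans (by gcongr)
    _ = (1 / 2) * (2 ^ n * (volume : Measure (Rn n)).real (Metric.ball 0 1) *
          ((2 : ℝ) ^ k * ‖ξ‖)⁻¹) := by
        rw [show ‖(1 / 2 : ℂ)‖ = 1 / 2 by simp, hR, mul_pow, zpow_neg, inv_pow, pow_succ]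
        field_simp
    _ ≤ (4 * Real.pi) * (2 ^ n * (volume : Measure (Rn n)).real (Metric.ball 0 1) *
          ((2 : ℝ) ^ k * ‖ξ‖)⁻¹) := by gcongr
    _ = _ := by rw [decayConst]; ring

/-- The constant in the `L²` bound. -/
noncomputable def l2Const (n : ℕ) : ℝ≥0∞ := ENNReal.ofReal (decayConst n) ^ 2 * (2 * geomConst 2)

lemma l2Const_ne_top (n : ℕ) : l2Const n ≠ ⊤ :=
  ENNReal.mul_ne_top (by simp) (ENNReal.mul_ne_top (by simp) (geomConst_ne_top two_pos))

lemma tsum_fourier_le (h : IsKernelFamily ψ 1) (ξ : Rn n) :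
    ∑' k, ‖𝓕 (ψ k) ξ‖ₑ ^ 2 ≤ l2Const n := by
  rcases eq_or_ne ξ 0 with rfl | hξ
  · have : ∀ k, 𝓕 (ψ k) 0 = 0 := fun k => by
      have := h.fourier_le_small k 0
      simpa using this
    simp [this]
  have hξ0 : 0 < ‖ξ‖ := norm_pos_iff.2 hξ
  set a : ℝ≥0∞ := ENNReal.ofReal ‖ξ‖ with ha
  have ha0 : a ≠ 0 := by simpa [ha] using hξ
  have hat : a ≠ ⊤ := ENNReal.ofReal_ne_top
  set c := ENNReal.ofReal (decayConst n) with hc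
  have hs : ∀ k, ‖𝓕 (ψ k) ξ‖ₑ ≤ c * (2 ^ k * a) := by
    intro k
    rw [← ofReal_norm, ← ofReal_two_zpow, ha, hc, ← ENNReal.ofReal_mul (by positivity),
      ← ENNReal.ofReal_mul (decayConst_nonneg n)]
    exact ENNReal.ofReal_le_ofReal (h.fourier_le_small k ξ)
  have hl : ∀ k, ‖𝓕 (ψ k) ξ‖ₑ ≤ c * (2 ^ (-k) * a⁻¹) := by
    intro k
    rw [← ofReal_norm, ← ofReal_two_zpow, ha, hc, ← ENNReal.ofReal_inv_of_pos hξ0,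
      ← ENNReal.ofReal_mul (by positivity), ← ENNReal.ofReal_mul (decayConst_nonneg n)]
    refine ENNReal.ofReal_le_ofReal ((h.fourier_le_large k hξ).trans (le_of_eq ?_))
    rw [mul_inv, zpow_neg]
  -- The scales are split at 2^k ‖ξ‖ = 1: the bound from mean zero is used below, the one from
  -- regularity above.
  have hterm : ∀ k, ‖𝓕 (ψ k) ξ‖ₑ ^ 2 ≤
      c ^ 2 * (a ^ 2 * (if (2 : ℝ≥0∞) ^ k ≤ a⁻¹ then ((2 : ℝ≥0∞) ^ k) ^ (2 : ℝ) else 0)) +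
      c ^ 2 * (a⁻¹ ^ 2 * (if (2 : ℝ≥0∞) ^ (-k) ≤ a then ((2 : ℝ≥0∞) ^ (-k)) ^ (2 : ℝ) else 0)) := by
    intro k
    by_cases hk : (2 : ℝ≥0∞) ^ k ≤ a⁻¹
    · refine le_trans ?_ le_self_add
      rw [if_pos hk, ENNReal.rpow_two]
      calc _ ≤ (c * (2 ^ k * a)) ^ 2 := by gcongr; exact hs k
        _ = _ := by ring
    · refine le_trans ?_ le_add_self
      have hk' : (2 : ℝ≥0∞) ^ (-k) ≤ a := by
        rw [ENNReal.zpow_neg, ENNReal.inv_le_iff_inv_le]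
        exact (not_le.1 hk).le
      rw [if_pos hk', ENNReal.rpow_two]
      calc _ ≤ (c * (2 ^ (-k) * a⁻¹)) ^ 2 := by gcongr; exact hl k
        _ = _ := by ring
  refine (ENNReal.tsum_le_tsum hterm).trans ?_
  rw [ENNReal.tsum_add, ENNReal.tsum_mul_left, ENNReal.tsum_mul_left, ENNReal.tsum_mul_left,
    ENNReal.tsum_mul_left]
  have t1 : ∑' k : ℤ, (if (2 : ℝ≥0∞) ^ k ≤ a⁻¹ then ((2 : ℝ≥0∞) ^ k) ^ (2 : ℝ) else 0) ≤
      geomConst 2 * a⁻¹ ^ (2 : ℝ) := by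
    refine tsum_scale_le two_pos _ id Function.injective_id _ (fun k hk => ?_) (fun k => ?_)
    · by_contra h0
      exact hk (if_neg h0)
    · split_ifs <;> simp
  have t2 : ∑' k : ℤ, (if (2 : ℝ≥0∞) ^ (-k) ≤ a then ((2 : ℝ≥0∞) ^ (-k)) ^ (2 : ℝ) else 0) ≤
      geomConst 2 * a ^ (2 : ℝ) := by
    refine tsum_scale_le two_pos _ (fun k => -k) neg_injective _ (fun k hk => ?_) (fun k => ?_)
    · by_contra h0
      exact hk (if_neg h0)
    · split_ifs <;> simp
  have haa : a ^ 2 * a⁻¹ ^ 2 = 1 := by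
    rw [← mul_pow, ENNReal.mul_inv_cancel ha0 hat, one_pow]
  calc _ ≤ c ^ 2 * (a ^ 2 * (geomConst 2 * a⁻¹ ^ (2 : ℝ))) +
        c ^ 2 * (a⁻¹ ^ 2 * (geomConst 2 * a ^ (2 : ℝ))) := by gcongr
    _ = c ^ 2 * (a ^ 2 * a⁻¹ ^ 2 * (2 * geomConst 2)) := by
        rw [ENNReal.rpow_two, ENNReal.rpow_two]; ring
    _ = _ := by rw [haa, one_mul, l2Const]

lemma lintegral_sq_eq (f : SchwartzMap (Rn n) ℂ) :
    ∫⁻ ξ, ‖𝓕 (f : Rn n → ℂ) ξ‖ₑ ^ 2 = ∫⁻ x, ‖f x‖ₑ ^ 2 := by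
  have key : ∀ g : SchwartzMap (Rn n) ℂ, ∫⁻ x, ‖g x‖ₑ ^ 2 = ENNReal.ofReal (∫ x, ‖g x‖ ^ 2) := by
    intro g
    rw [ofReal_integral_eq_lintegral_ofReal]
    · congr 1; ext x
      rw [ENNReal.ofReal_pow (norm_nonneg _), ofReal_norm]
    · have := (SchwartzMap.memLp g 2 volume).integrable_norm_rpow (by simp) (by simp)
      simpa using this
    · exact Eventually.of_forall fun x => by positivity
  rw [key, ← SchwartzMap.integral_norm_sq_fourier, ← key]
  simp only [SchwartzMap.fourier_coe]

lemma sqFn_L2_smooth (h : IsKernelFamily ψ 1) {f : Rn n → ℂ} (hfc : HasCompactSupport f)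
    (hfs : ContDiff ℝ ∞ f) : ∫⁻ x, sqFn ψ f x ^ 2 ≤ l2Const n * ∫⁻ x, ‖f x‖ₑ ^ 2 := by
  set F := hfc.toSchwartzMap hfs with hF
  have hFf : (F : Rn n → ℂ) = f := rfl
  have hfi : Integrable f := hfs.continuous.integrable_of_hasCompactSupport hfc
  have hk : ∀ k, ∫⁻ x, ‖(ψ k ⋆[ContinuousLinearMap.mul ℂ ℂ, volume] f) x‖ₑ ^ 2 =
      ∫⁻ ξ, ‖𝓕 (ψ k) ξ‖ₑ ^ 2 * ‖𝓕 f ξ‖ₑ ^ 2 := by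
    intro k
    have hc : HasCompactSupport (ψ k ⋆[ContinuousLinearMap.mul ℂ ℂ, volume] f) :=
      (h.hasCompactSupport k).convolution _ hfc
    have hs : ContDiff ℝ ∞ (ψ k ⋆[ContinuousLinearMap.mul ℂ ℂ, volume] f) := by
      have := hfc.contDiff_convolution_right (𝕜 := ℝ) (μ := volume)
        ((ContinuousLinearMap.mul ℝ ℂ)) (h.integrable k).locallyIntegrable
        (n := ⊤) hfs
      exact this
    have := lintegral_sq_eq (hc.toSchwartzMap hs)
    calc _ = ∫⁻ ξ, ‖𝓕 (ψ k ⋆[ContinuousLinearMap.mul ℂ ℂ, volume] f) ξ‖ₑ ^ 2 := this.symm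
      _ = _ := by
        congr 1; ext ξ
        rw [Real.fourier_mul_convolution_eq (h.integrable k) hfi, enorm_mul, mul_pow]
  have hcont : ∀ g : Rn n → ℂ, Integrable g → Continuous (𝓕 g) := fun g hg => by
    exact VectorFourier.fourierIntegral_continuous Real.continuous_fourierChar
      (by exact continuous_inner) hg
  simp only [sqFn_sq]
  rw [lintegral_tsum]
  · simp only [hk]
    rw [← lintegral_tsum]
    · calc _ ≤ ∫⁻ ξ, l2Const n * ‖𝓕 f ξ‖ₑ ^ 2 := by
            refine lintegral_mono fun ξ => ?_
            rw [ENNReal.tsum_mul_right]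
            gcongr
            exact h.tsum_fourier_le ξ
        _ = l2Const n * ∫⁻ ξ, ‖𝓕 f ξ‖ₑ ^ 2 :=
            lintegral_const_mul _ ((hcont f hfi).measurable.enorm.pow_const 2)
        _ = _ := by rw [← hFf, lintegral_sq_eq]
    · intro k
      exact (((hcont _ (h.integrable k)).measurable.enorm.pow_const 2).mul
        ((hcont f hfi).measurable.enorm.pow_const 2)).aemeasurable
  · intro k
    exact (((h.hasCompactSupport k).continuous_convolution_left _ (h.continuous k)
      hfi.locallyIntegrable).measurable.enorm.pow_const 2).aemeasurable

/-- The square function is bounded on `L²`. -/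
theorem sqFn_L2 (h : IsKernelFamily ψ 1) {f : Rn n → ℂ} (hf : MemLp f 2) :
    ∫⁻ x, sqFn ψ f x ^ 2 ≤ l2Const n * ∫⁻ x, ‖f x‖ₑ ^ 2 := by
  have hnorm : ∀ g : Rn n → ℂ, eLpNorm g 2 volume ^ 2 = ∫⁻ x, ‖g x‖ₑ ^ 2 := by
    intro g
    rw [eLpNorm_eq_lintegral_rpow_enorm_toReal (by simp) (by simp), ← ENNReal.rpow_natCast,
      ← ENNReal.rpow_mul]
    norm_num
  -- Approximation in L² by test functions. For fixed k and x the convolution is continuous on L² by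
  -- Cauchy–Schwarz, and Fatou, in k and then in x, carries the bound to the limit.
  have happ : ∀ j : ℕ, ∃ g : Rn n → ℂ, HasCompactSupport g ∧ ContDiff ℝ ∞ g ∧
      eLpNorm (f - g) 2 volume ≤ ENNReal.ofReal (1 / ((j : ℝ) + 1)) := fun j =>
    MemLp.exist_eLpNorm_sub_le (by simp) (by norm_num) hf (by positivity)
  choose g hgc hgs hg using happ
  have hlim : Tendsto (fun j : ℕ => ENNReal.ofReal (1 / ((j : ℝ) + 1))) atTop (𝓝 0) := by
    rw [← ENNReal.ofReal_zero]
    exact ENNReal.tendsto_ofReal tendsto_one_div_add_atTop_nhds_zero_nat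
  have hlim' : Tendsto (fun j => eLpNorm (f - g j) 2 volume) atTop (𝓝 0) :=
    tendsto_of_tendsto_of_tendsto_of_le_of_le tendsto_const_nhds hlim (fun _ => zero_le) hg
  have hgm : ∀ j, MemLp (g j) 2 volume := fun j => (hgs j).continuous.memLp_of_hasCompactSupport (hgc j)
  have hfl : LocallyIntegrable f := hf.locallyIntegrable (by norm_num)
  have hgl : ∀ j, LocallyIntegrable (g j) := fun j => (hgm j).locallyIntegrable (by norm_num)
  have hptw : ∀ x k, Tendsto (fun j => (ψ k ⋆[ContinuousLinearMap.mul ℂ ℂ, volume] g j) x) atTop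
      (𝓝 ((ψ k ⋆[ContinuousLinearMap.mul ℂ ℂ, volume] f) x)) := by
    intro x k
    rw [tendsto_iff_edist_tendsto_0]
    have hψ : ∫⁻ y, ‖ψ k (x - y)‖ₑ ^ (2 : ℝ) ≠ ⊤ := by
      have h1 : MemLp (fun y => ψ k (x - y)) 2 volume := by
        have h2 : MemLp (ψ k) 2 volume :=
          (h.continuous k).memLp_of_hasCompactSupport (h.hasCompactSupport k)
        exact h2.comp_measurePreserving (Measure.measurePreserving_sub_left volume x)
      have h3 := hnorm (fun y => ψ k (x - y))
      simp only [ENNReal.rpow_two]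
      rw [← h3]
      exact ENNReal.pow_ne_top h1.eLpNorm_ne_top
    have hb : ∀ j, edist ((ψ k ⋆[ContinuousLinearMap.mul ℂ ℂ, volume] g j) x)
        ((ψ k ⋆[ContinuousLinearMap.mul ℂ ℂ, volume] f) x) ≤
        (∫⁻ y, ‖ψ k (x - y)‖ₑ ^ (2 : ℝ)) ^ (1 / 2 : ℝ) * eLpNorm (f - g j) 2 volume := by
      intro j
      rw [edist_comm, edist_eq_enorm_sub, convolution_mul_swap, convolution_mul_swap,
        ← integral_sub (h.integrable_mul hfl k x) (h.integrable_mul (hgl j) k x)]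
      simp only [← mul_sub]
      refine (enorm_integral_le_lintegral_enorm _).trans ?_
      simp only [enorm_mul]
      have := ENNReal.lintegral_mul_le_Lp_mul_Lq volume Real.HolderConjugate.two_two
        (f := fun y => ‖ψ k (x - y)‖ₑ) (g := fun y => ‖f y - g j y‖ₑ)
        (by
          have := h.continuous k
          exact (Continuous.measurable (by fun_prop)).enorm.aemeasurable)
        (hf.1.sub (hgm j).1).enorm
      refine this.trans (le_of_eq ?_)
      rw [eLpNorm_eq_lintegral_rpow_enorm_toReal (by simp) (by simp)]
      simp
    refine tendsto_of_tendsto_of_tendsto_of_le_of_le tendsto_const_nhds ?_ (fun _ => zero_le) hb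
    have := ENNReal.Tendsto.const_mul hlim' (Or.inr (ENNReal.rpow_ne_top_of_nonneg
      (by norm_num : (0 : ℝ) ≤ 1 / 2) hψ))
    simpa using this
  have hgn : ∀ j, eLpNorm (g j) 2 volume ≤
      eLpNorm f 2 volume + ENNReal.ofReal (1 / ((j : ℝ) + 1)) := by
    intro j
    have e : g j = f - (f - g j) := by simp
    calc eLpNorm (g j) 2 volume = eLpNorm (f - (f - g j)) 2 volume := by rw [← e]
      _ ≤ eLpNorm f 2 volume + eLpNorm (f - g j) 2 volume :=
        eLpNorm_sub_le hf.1 (hf.1.sub (hgm j).1) (by norm_num)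
      _ ≤ _ := by gcongr; exact hg j
  calc ∫⁻ x, sqFn ψ f x ^ 2 ≤ ∫⁻ x, liminf (fun j => sqFn ψ (g j) x ^ 2) atTop := by
        refine lintegral_mono fun x => ?_
        simp only [sqFn_sq]
        refine tsum_fatou _ _ fun k => ?_
        exact ((ENNReal.continuous_pow 2).tendsto _).comp
          ((continuous_enorm.tendsto _).comp (hptw x k))
    _ ≤ liminf (fun j => ∫⁻ x, sqFn ψ (g j) x ^ 2) atTop :=
        lintegral_liminf_le fun j => (h.measurable_sqFn (hgl j)).pow_const 2
    _ ≤ liminf (fun j : ℕ => l2Const n *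
          (eLpNorm f 2 volume + ENNReal.ofReal (1 / ((j : ℝ) + 1))) ^ 2) atTop := by
        refine liminf_le_liminf (Eventually.of_forall fun j => ?_)
        refine (h.sqFn_L2_smooth (hgc j) (hgs j)).trans ?_
        rw [← hnorm]
        gcongr
        exact hgn j
    _ = l2Const n * ∫⁻ x, ‖f x‖ₑ ^ 2 := by
        rw [← hnorm]
        refine Tendsto.liminf_eq ?_
        refine ENNReal.Tendsto.const_mul ?_ (Or.inr (l2Const_ne_top n))
        have : Tendsto (fun j : ℕ => eLpNorm f 2 volume + ENNReal.ofReal (1 / ((j : ℝ) + 1)))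
            atTop (𝓝 (eLpNorm f 2 volume)) := by
          simpa using tendsto_const_nhds.add hlim
        exact ((ENNReal.continuous_pow 2).tendsto _).comp this

end IsKernelFamily

end RoughSquare

namespace RoughSquare

/-! ### Cubes, Lebesgue differentiation and the maximal function -/

variable {n : ℕ}

/-- Forgetting the Euclidean norm preserves the measure and turns cubes into closed balls of the sup
norm, so covering and differentiation theorems for balls apply to cubes. -/
lemma cube_eq_preimage (c : Rn n) {r : ℝ} (hr : 0 ≤ r) :
    cube c r = WithLp.ofLp ⁻¹' Metric.closedBall (WithLp.ofLp c) r := by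
  ext x
  simp only [cube, Set.mem_preimage, Metric.mem_closedBall, dist_pi_le_iff hr, Real.dist_eq]
  rfl

lemma measurableSet_cube (c : Rn n) (r : ℝ) : MeasurableSet (cube c r) := by
  have : cube c r = ⋂ i, {x : Rn n | |x i - c i| ≤ r} := by ext x; simp [cube]
  rw [this]
  exact MeasurableSet.iInter fun i => measurableSet_le (by fun_prop) measurable_const

lemma volume_cube (c : Rn n) {r : ℝ} (hr : 0 ≤ r) :
    volume (cube c r) = ENNReal.ofReal ((2 * r) ^ n) := by
  rw [cube_eq_preimage c hr, (PiLp.volume_preserving_ofLp (Fin n)).measure_preimage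
    Metric.isClosed_closedBall.measurableSet.nullMeasurableSet, Real.volume_pi_closedBall _ hr,
    Fintype.card_fin]

lemma volume_cube_ne_zero (c : Rn n) {r : ℝ} (hr : 0 < r) : volume (cube c r) ≠ 0 := by
  rw [volume_cube c hr.le]
  exact (ENNReal.ofReal_pos.2 (by positivity)).ne'

lemma volume_cube_ne_top (c : Rn n) {r : ℝ} (hr : 0 ≤ r) : volume (cube c r) ≠ ⊤ := by
  rw [volume_cube c hr]; exact ENNReal.ofReal_ne_top

lemma volume_cube_mul (c c' : Rn n) {r : ℝ} (hr : 0 ≤ r) {t : ℝ} (ht : 0 ≤ t) :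
    volume (cube c (t * r)) = ENNReal.ofReal t ^ n * volume (cube c' r) := by
  rw [volume_cube c (by positivity), volume_cube c' hr, ← ENNReal.ofReal_pow ht,
    ← ENNReal.ofReal_mul (by positivity)]
  congr 1; ring

/-- The half-open box with lower corner `a` and side length `s`. -/
def hbox (a : Fin n → ℝ) (s : ℝ) : Set (Rn n) := {x | ∀ i, a i ≤ x i ∧ x i < a i + s}

lemma measurableSet_hbox (a : Fin n → ℝ) (s : ℝ) : MeasurableSet (hbox a s) := by
  have : hbox a s = ⋂ i, {x : Rn n | a i ≤ x i} ∩ {x : Rn n | x i < a i + s} := by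
    ext x; simp [hbox]
  rw [this]
  exact MeasurableSet.iInter fun i => (measurableSet_le measurable_const (by fun_prop)).inter
    (measurableSet_lt (by fun_prop) measurable_const)

lemma volume_hbox (a : Fin n → ℝ) {s : ℝ} (hs : 0 ≤ s) :
    volume (hbox a s) = ENNReal.ofReal (s ^ n) := by
  have : hbox a s = WithLp.ofLp ⁻¹' (Set.univ.pi fun i => Set.Ico (a i) (a i + s)) := by
    ext x; simp [hbox]
  rw [this, (PiLp.volume_preserving_ofLp (Fin n)).measure_preimage
    (MeasurableSet.univ_pi fun i => measurableSet_Ico).nullMeasurableSet, Real.volume_pi_Ico]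
  simp [ENNReal.ofReal_pow hs]

/-- The centre of a box. -/
noncomputable def boxCenter (a : Fin n → ℝ) (s : ℝ) : Rn n := WithLp.toLp 2 fun i => a i + s / 2

lemma hbox_subset_cube (a : Fin n → ℝ) (s : ℝ) : hbox a s ⊆ cube (boxCenter a s) (s / 2) := by
  intro x hx i
  have := hx i
  simp only [boxCenter]
  rw [abs_le]; constructor <;> linarith [this.1, this.2]

lemma hbox_ae_eq_cube (a : Fin n → ℝ) {s : ℝ} (hs : 0 ≤ s) :
    hbox a s =ᵐ[volume] cube (boxCenter a s) (s / 2) := by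
  refine ae_eq_of_subset_of_measure_ge (hbox_subset_cube a s) (le_of_eq ?_)
    (measurableSet_hbox a s).nullMeasurableSet (volume_cube_ne_top _ (by positivity))
  rw [volume_cube _ (by positivity), volume_hbox a hs]
  congr 2; ring

/-- The Lebesgue differentiation theorem along cubes. -/
lemma ae_tendsto_cube {h : Rn n → ℝ≥0∞} (hm : Measurable h) (hh : ∫⁻ x, h x ≠ ⊤) :
    ∀ᵐ x : Rn n, ∀ (c : ℕ → Rn n) (r : ℕ → ℝ), Tendsto r atTop (𝓝[>] 0) →
      (∀ j, x ∈ cube (c j) (r j)) →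
        Tendsto (fun j => (∫⁻ y in cube (c j) (r j), h y) / volume (cube (c j) (r j))) atTop
          (𝓝 (h x)) := by
  set h' : (Fin n → ℝ) → ℝ≥0∞ := fun y => h (WithLp.toLp 2 y) with hh'
  have hm' : Measurable h' := hm.comp (PiLp.volume_preserving_toLp (Fin n)).measurable
  have hmp := PiLp.volume_preserving_ofLp (Fin n)
  have hemb : MeasurableEmbedding (WithLp.ofLp : Rn n → Fin n → ℝ) :=
    (MeasurableEquiv.toLp 2 (Fin n → ℝ)).symm.measurableEmbedding
  have hint : ∫⁻ y, h' y ≠ ⊤ := by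
    rwa [(PiLp.volume_preserving_toLp (Fin n)).lintegral_comp hm]
  have key := VitaliFamily.ae_tendsto_lintegral_div
    (IsUnifLocDoublingMeasure.vitaliFamily (volume : Measure (Fin n → ℝ)) 1) hm'.aemeasurable hint
  filter_upwards [hmp.quasiMeasurePreserving.ae key] with x hx c r hr hxc
  have hrpos : ∀ᶠ j in atTop, 0 < r j :=
    (tendsto_nhdsWithin_iff.1 hr).2
  -- With K = 1 the point only has to lie in the balls, not at their centres.
  have h1 := IsUnifLocDoublingMeasure.tendsto_closedBall_filterAt
    (volume : Measure (Fin n → ℝ)) (K := 1) (x := WithLp.ofLp x) (fun j => WithLp.ofLp (c j)) r hr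
    (by
      filter_upwards [hrpos] with j hj
      have := hxc j
      rw [cube_eq_preimage _ hj.le] at this
      simpa using this)
  refine (hx.comp h1).congr' ?_
  filter_upwards [hrpos] with j hj
  simp only [Function.comp]
  rw [cube_eq_preimage _ hj.le, hmp.measure_preimage
    Metric.isClosed_closedBall.measurableSet.nullMeasurableSet,
    ← hmp.setLIntegral_comp_preimage_emb hemb]

/-- The weak type `(1,1)` bound for the maximal function. -/
theorem hlMaximal_weak (hn : 1 ≤ n) (g : Rn n → ℝ≥0∞) (t : ℝ≥0∞) :
    t * volume {x | t < hlMaximal g x} ≤ 5 ^ n * ∫⁻ x, g x := by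
  rcases eq_or_ne t 0 with rfl | ht0
  · simp
  rcases eq_or_ne t ⊤ with rfl | htt
  · simp
  rcases eq_or_ne (∫⁻ x, g x) ⊤ with hg | hg
  · simp [hg]
  set T : Set (Rn n × ℝ) := {a | 0 < a.2 ∧ t * volume (cube a.1 a.2) < ∫⁻ y in cube a.1 a.2, g y}
    with hT
  -- The covering lemma needs bounded radii. They follow from t (2r)^n ≤ ∫ g, because r ≤ (2r)^n
  -- once r > 1 and n ≥ 1.
  have hbd : ∀ a ∈ T, a.2 ≤ (∫⁻ x, g x).toReal / t.toReal + 1 := by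
    rintro ⟨c, r⟩ ⟨hr, ha⟩
    simp only at hr ha ⊢
    have h1 : t * volume (cube c r) ≤ ∫⁻ x, g x := ha.le.trans (setLIntegral_le_lintegral _ _)
    have h2 := ENNReal.toReal_mono hg h1
    rw [ENNReal.toReal_mul, volume_cube c hr.le, ENNReal.toReal_ofReal (by positivity)] at h2
    have ht : 0 < t.toReal := ENNReal.toReal_pos ht0 htt
    have h3 : (2 * r) ^ n ≤ (∫⁻ x, g x).toReal / t.toReal := by
      rw [le_div_iff₀ ht]; linarith
    rcases le_or_gt r 1 with h | h
    · have : 0 ≤ (∫⁻ x, g x).toReal / t.toReal := by positivity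
      linarith
    · have : r ≤ (2 * r) ^ n := by
        calc r ≤ 2 * r := by linarith
          _ = (2 * r) ^ 1 := (pow_one _).symm
          _ ≤ (2 * r) ^ n := pow_le_pow_right₀ (by linarith) hn
      linarith
  obtain ⟨u, huT, hdisj, hcov⟩ := Vitali.exists_disjoint_subfamily_covering_enlargement_closedBall
    T (fun a => WithLp.ofLp a.1) (fun a => a.2) _ hbd 5 (by norm_num)
  have hucount : u.Countable := by
    refine hdisj.countable_of_nonempty_interior fun a ha => ?_
    refine ⟨WithLp.ofLp a.1, ?_⟩
    rw [mem_interior_iff_mem_nhds]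
    exact Metric.closedBall_mem_nhds _ (huT ha).1
  have hsub : {x | t < hlMaximal g x} ⊆ ⋃ a ∈ u, cube a.1 (5 * a.2) := by
    intro x hx
    simp only [Set.mem_ofPred_eq, hlMaximal, lt_iSup_iff] at hx
    obtain ⟨c, r, hr, hxc, hlt⟩ := hx
    have hcT : (c, r) ∈ T := by
      refine ⟨hr, ?_⟩
      rwa [ENNReal.lt_div_iff_mul_lt (Or.inl (volume_cube_ne_zero c hr))
        (Or.inl (volume_cube_ne_top c hr.le))] at hlt
    obtain ⟨b, hb, hsubb⟩ := hcov _ hcT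
    refine Set.mem_biUnion hb ?_
    have h5 : (0 : ℝ) ≤ 5 * b.2 := by linarith [(huT hb).1]
    rw [cube_eq_preimage _ h5]
    rw [cube_eq_preimage _ hr.le] at hxc
    exact hsubb hxc
  have hcd : u.PairwiseDisjoint fun a => cube a.1 a.2 := by
    intro a ha b hb hab
    have := hdisj ha hb hab
    simp only [Function.onFun] at this ⊢
    rw [cube_eq_preimage _ (huT ha).1.le, cube_eq_preimage _ (huT hb).1.le]
    exact this.preimage _
  have := hucount.to_subtype
  calc t * volume {x | t < hlMaximal g x}
      ≤ t * ∑' a : u, volume (cube a.1.1 (5 * a.1.2)) := by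
        gcongr
        refine (measure_mono hsub).trans ?_
        exact measure_biUnion_le _ hucount _
    _ = 5 ^ n * ∑' a : u, t * volume (cube a.1.1 a.1.2) := by
        rw [← ENNReal.tsum_mul_left, ← ENNReal.tsum_mul_left]
        refine tsum_congr fun a => ?_
        rw [volume_cube_mul _ a.1.1 (huT a.2).1.le (by norm_num)]
        norm_num
        ring
    _ ≤ 5 ^ n * ∑' a : u, ∫⁻ y in cube a.1.1 a.1.2, g y := by
        gcongr with a
        exact (huT a.2).2.le
    _ = 5 ^ n * ∫⁻ y in ⋃ a ∈ u, cube a.1 a.2, g y := by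
        rw [lintegral_biUnion hucount (fun a _ => measurableSet_cube _ _) hcd]
    _ ≤ _ := mul_le_mul' le_rfl (setLIntegral_le_lintegral _ _)

end RoughSquare

namespace RoughSquare

/-! ### Dyadic grids and the Calderón–Zygmund decomposition -/

variable {n : ℕ}

/-- The side length of the grid cubes of generation `j`. -/
noncomputable def gside (ℓ : ℝ) (j : ℕ) : ℝ := ℓ / 2 ^ j

lemma gside_pos {ℓ : ℝ} (hℓ : 0 < ℓ) (j : ℕ) : 0 < gside ℓ j := by unfold gside; positivity

/-- The position of a point in the grid of generation `j`. -/
noncomputable def gidx (o : Fin n → ℝ) (ℓ : ℝ) (j : ℕ) (x : Rn n) : Fin n → ℤ :=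
  fun i => ⌊(x i - o i) / gside ℓ j⌋

/-- The cubes of the dyadic grid with origin `o` and initial side length `ℓ`. -/
def gcube (o : Fin n → ℝ) (ℓ : ℝ) (q : ℕ × (Fin n → ℤ)) : Set (Rn n) :=
  hbox (fun i => o i + gside ℓ q.1 * q.2 i) (gside ℓ q.1)

/-- The threefold dilates of the grid cubes. -/
def tcube (o : Fin n → ℝ) (ℓ : ℝ) (q : ℕ × (Fin n → ℤ)) : Set (Rn n) :=
  hbox (fun i => o i + gside ℓ q.1 * (q.2 i - 1)) (3 * gside ℓ q.1)

section grid

variable {o : Fin n → ℝ} {ℓ : ℝ}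

lemma mem_gcube_iff (hℓ : 0 < ℓ) {q : ℕ × (Fin n → ℤ)} {x : Rn n} :
    x ∈ gcube o ℓ q ↔ gidx o ℓ q.1 x = q.2 := by
  have hs := gside_pos hℓ q.1
  simp only [gcube, hbox, Set.mem_ofPred_eq, funext_iff, gidx, Int.floor_eq_iff, le_div_iff₀ hs,
    div_lt_iff₀ hs]
  refine forall_congr' fun i => ?_
  constructor <;> rintro ⟨h1, h2⟩ <;> constructor <;> linarith

lemma mem_tcube_iff (hℓ : 0 < ℓ) {q : ℕ × (Fin n → ℤ)} {x : Rn n} :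
    x ∈ tcube o ℓ q ↔ ∀ i, q.2 i - 1 ≤ gidx o ℓ q.1 x i ∧ gidx o ℓ q.1 x i ≤ q.2 i + 1 := by
  have hs := gside_pos hℓ q.1
  simp only [tcube, hbox, Set.mem_ofPred_eq, gidx]
  refine forall_congr' fun i => ?_
  rw [Int.le_floor, le_div_iff₀ hs, ← Int.lt_add_one_iff, Int.floor_lt, div_lt_iff₀ hs]
  push_cast
  constructor <;> rintro ⟨h1, h2⟩ <;> constructor <;> linarith

lemma mem_gcube_self (hℓ : 0 < ℓ) (j : ℕ) (x : Rn n) : x ∈ gcube o ℓ (j, gidx o ℓ j x) :=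
  (mem_gcube_iff hℓ).2 rfl

lemma gcube_subset_tcube (hℓ : 0 < ℓ) (q : ℕ × (Fin n → ℤ)) : gcube o ℓ q ⊆ tcube o ℓ q := by
  intro x hx
  rw [mem_gcube_iff hℓ] at hx
  rw [mem_tcube_iff hℓ]
  intro i
  rw [hx]; constructor <;> linarith

/-- The floor commutes with division by 2^d, so nesting of grid cubes becomes integer division of
positions. -/
lemma gidx_eq_div (hℓ : 0 < ℓ) (j d : ℕ) (x : Rn n) (i : Fin n) :
    gidx o ℓ j x i = gidx o ℓ (j + d) x i / 2 ^ d := by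
  have h := Int.floor_div_natCast ((x i - o i) / gside ℓ (j + d)) (2 ^ d)
  push_cast at h
  rw [gidx, gidx, ← h]
  congr 1
  simp only [gside, pow_add]
  field_simp

lemma gcube_nested (hℓ : 0 < ℓ) {q q' : ℕ × (Fin n → ℤ)} (hj : q.1 ≤ q'.1) {x : Rn n} (hx : x ∈ gcube o ℓ q)
    (hx' : x ∈ gcube o ℓ q') : gcube o ℓ q' ⊆ gcube o ℓ q := by
  intro y hy
  rw [mem_gcube_iff hℓ] at hx hx' hy ⊢
  obtain ⟨d, hd⟩ := Nat.exists_eq_add_of_le hj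
  rw [← hx]
  ext i
  rw [gidx_eq_div hℓ q.1 d y, gidx_eq_div hℓ q.1 d x, ← hd, hx', hy]

lemma gcube_eq_of_mem (hℓ : 0 < ℓ) {q q' : ℕ × (Fin n → ℤ)} (hj : q.1 = q'.1) {x : Rn n}
    (hx : x ∈ gcube o ℓ q) (hx' : x ∈ gcube o ℓ q') : q = q' := by
  rw [mem_gcube_iff hℓ] at hx hx'
  exact Prod.ext hj (by rw [← hx, ← hx', hj])

lemma volume_gcube (hℓ : 0 < ℓ) (q : ℕ × (Fin n → ℤ)) :
    volume (gcube o ℓ q) = ENNReal.ofReal (gside ℓ q.1) ^ n := by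
  rw [gcube, volume_hbox _ (gside_pos hℓ _).le, ENNReal.ofReal_pow (gside_pos hℓ _).le]

lemma volume_gcube_ne_zero (hℓ : 0 < ℓ) (q : ℕ × (Fin n → ℤ)) : volume (gcube o ℓ q) ≠ 0 := by
  rw [volume_gcube hℓ]
  exact pow_ne_zero _ (by simpa using gside_pos hℓ q.1)

lemma volume_gcube_ne_top (hℓ : 0 < ℓ) (q : ℕ × (Fin n → ℤ)) : volume (gcube o ℓ q) ≠ ⊤ := by
  rw [volume_gcube hℓ]; exact ENNReal.pow_ne_top ENNReal.ofReal_ne_top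

lemma volume_tcube (hℓ : 0 < ℓ) (q : ℕ × (Fin n → ℤ)) :
    volume (tcube o ℓ q) = 3 ^ n * volume (gcube o ℓ q) := by
  have := gside_pos hℓ q.1
  rw [volume_gcube hℓ, tcube, volume_hbox _ (by positivity), mul_pow,
    ENNReal.ofReal_mul (by positivity), ENNReal.ofReal_pow (by norm_num),
    ENNReal.ofReal_pow (by positivity)]
  norm_num

/-- The colour of a cube: threefold dilates of cubes of the same colour are nested or disjoint. -/
def gcolor (q : ℕ × (Fin n → ℤ)) : Fin n → ZMod 3 := fun i => (-1) ^ q.1 * ((q.2 i - 1 : ℤ) : ZMod 3)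

/-- In each coordinate a threefold dilate is the interval [u, u + 3) in units of its generation,
where u is the position minus one. In units of d generations later, the coarse one is [2^d u, 2^d u
+ 3·2^d), and equal colours mean u' ≡ 2^d u mod 3 because 2 ≡ -1. So the coarse interval is a union
of blocks of length three starting in the residue class of u', and the fine interval, being one such
block, lies inside as soon as they meet. -/
lemma tcube_nested (hℓ : 0 < ℓ) {q q' : ℕ × (Fin n → ℤ)} (hj : q.1 ≤ q'.1) (hc : gcolor q = gcolor q')
    {x : Rn n} (hx : x ∈ tcube o ℓ q) (hx' : x ∈ tcube o ℓ q') :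
    tcube o ℓ q' ⊆ tcube o ℓ q := by
  intro y hy
  rw [mem_tcube_iff hℓ] at hx hx' hy ⊢
  obtain ⟨d, hd⟩ := Nat.exists_eq_add_of_le hj
  intro i
  have h1 := hx i
  have h2 := hx' i
  have h3 := hy i
  rw [gidx_eq_div hℓ q.1 d x, ← hd] at h1
  rw [gidx_eq_div hℓ q.1 d y, ← hd]
  set a := gidx o ℓ q'.1 x i
  set b := gidx o ℓ q'.1 y i
  set u := q.2 i - 1 with hu
  set u' := q'.2 i - 1 with hu'
  have hD : (0 : ℤ) < 2 ^ d := by positivity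
  have hmod : ∃ t : ℤ, u' = 2 ^ d * u + 3 * t := by
    have h4 := congrFun hc i
    simp only [gcolor, hd, pow_add, ← hu, ← hu'] at h4
    have hunit : ((-1 : ZMod 3) ^ q.1) * ((-1) ^ q.1) = 1 := by
      rw [← mul_pow]; norm_num
    have h5 : (u : ZMod 3) = (-1) ^ d * (u' : ZMod 3) := by
      have := congrArg (fun z => (-1 : ZMod 3) ^ q.1 * z) h4
      simp only [← mul_assoc, hunit, one_mul] at this
      exact this
    have h2d : ((2 : ZMod 3)) = -1 := by decide
    have h6 : ((u' - 2 ^ d * u : ℤ) : ZMod 3) = 0 := by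
      push_cast
      rw [h5, h2d, ← mul_assoc, ← mul_pow]
      norm_num
    obtain ⟨t, ht⟩ := (ZMod.intCast_zmod_eq_zero_iff_dvd _ 3).1 h6
    exact ⟨t, by push_cast at ht; linarith⟩
  obtain ⟨t, ht⟩ := hmod
  have e1 : q.2 i = u + 1 := by rw [hu]; ring
  have e2 : q'.2 i = u' + 1 := by rw [hu']; ring
  rw [e1] at h1 ⊢
  rw [e2] at h2 h3
  have g1 : 2 ^ d * u ≤ a := by
    have := (Int.le_ediv_iff_mul_le hD).1 h1.1
    linarith [mul_comm u ((2 : ℤ) ^ d)]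
  have g2 : a < 2 ^ d * u + 3 * 2 ^ d := by
    have := (Int.ediv_lt_iff_lt_mul hD).1 (Int.lt_add_one_iff.2 h1.2)
    linarith [mul_comm u ((2 : ℤ) ^ d)]
  set P := (2 : ℤ) ^ d * u
  set D := (2 : ℤ) ^ d
  constructor
  · rw [Int.le_ediv_iff_mul_le hD]
    have : u * D = P := by simp only [P]; ring
    rw [this]; omega
  · rw [← Int.lt_add_one_iff, Int.ediv_lt_iff_lt_mul hD]
    have : (u + 1 + 1 + 1) * D = P + 3 * D := by simp only [P]; ring
    rw [this]; omega

/-- The volume determines the generation and the lower corner determines the position. Sums over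
indices can then be read as sums over sets. -/
lemma tcube_injective (hℓ : 0 < ℓ) (hn : 1 ≤ n) : Function.Injective (tcube (n := n) o ℓ) := by
  intro q q' h
  have hs := gside_pos hℓ q.1
  have hs' := gside_pos hℓ q'.1
  have hv := congrArg volume h
  rw [tcube, tcube, volume_hbox _ (by positivity), volume_hbox _ (by positivity),
    ENNReal.ofReal_eq_ofReal_iff (by positivity) (by positivity),
    pow_left_inj₀ (by positivity) (by positivity) (by omega)] at hv
  have hj : q.1 = q'.1 := by
    have h1 : ℓ / 2 ^ q.1 = ℓ / 2 ^ q'.1 := by unfold gside at hv; linarith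
    rw [div_eq_div_iff (by positivity) (by positivity)] at h1
    have h2 := mul_left_cancel₀ hℓ.ne' h1
    exact (Nat.pow_right_injective le_rfl (by exact_mod_cast h2)).symm
  refine Prod.ext hj (funext fun i => ?_)
  have key : ∀ q q' : ℕ × (Fin n → ℤ), q.1 = q'.1 → tcube o ℓ q ⊆ tcube o ℓ q' →
      q'.2 i ≤ q.2 i := by
    intro q q' hj hsub
    have hs := gside_pos hℓ q.1
    have hmem : (WithLp.toLp 2 fun i => o i + gside ℓ q.1 * (q.2 i - 1) : Rn n) ∈ tcube o ℓ q := by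
      intro i
      simp only []
      constructor <;> linarith
    have := (hsub hmem i).1
    simp only [← hj] at this
    have h3 := le_of_mul_le_mul_left (by linarith :
      gside ℓ q.1 * ((q'.2 i : ℝ) - 1) ≤ gside ℓ q.1 * (q.2 i - 1)) hs
    exact_mod_cast (by linarith : (q'.2 i : ℝ) ≤ q.2 i)
  exact (key q' q hj.symm h.symm.subset).antisymm (key q q' hj h.subset)

end grid

/-- The Calderón–Zygmund decomposition, starting from the cubes of generation `j₀`. -/
theorem calderon_zygmund {o : Fin n → ℝ} {ℓ : ℝ} (hℓ : 0 < ℓ) {h : Rn n → ℝ≥0∞}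
    (hm : Measurable h) (hh : ∫⁻ x, h x ≠ ⊤) (t : ℝ≥0∞) (j₀ : ℕ)
    (h₀ : ∀ m, ∫⁻ x in gcube o ℓ (j₀, m), h x ≤ t * volume (gcube o ℓ (j₀, m))) :
    ∃ P : Set (ℕ × (Fin n → ℤ)), (∀ q ∈ P, j₀ < q.1) ∧
      P.PairwiseDisjoint (gcube o ℓ) ∧
      (∀ q ∈ P, t * volume (gcube o ℓ q) < ∫⁻ x in gcube o ℓ q, h x) ∧
      (∀ q ∈ P, ∫⁻ x in gcube o ℓ q, h x ≤ 2 ^ n * t * volume (gcube o ℓ q)) ∧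
      ∀ᵐ x, x ∉ ⋃ q ∈ P, gcube o ℓ q → h x ≤ t := by
  set bad : ℕ × (Fin n → ℤ) → Prop := fun q =>
    t * volume (gcube o ℓ q) < ∫⁻ x in gcube o ℓ q, h x with hbad
  -- The maximal bad cubes. Since generation `j₀` has no bad cube, each selected cube has a parent
  -- in the grid that is not bad, whence the factor 2^n in the upper bound.
  set P : Set (ℕ × (Fin n → ℤ)) := {q | j₀ < q.1 ∧ bad q ∧
    ∀ q' : ℕ × (Fin n → ℤ), j₀ ≤ q'.1 → q'.1 < q.1 → gcube o ℓ q ⊆ gcube o ℓ q' → ¬ bad q'} with hP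
  refine ⟨P, fun q hq => hq.1, ?_, fun q hq => hq.2.1, ?_, ?_⟩
  · intro q hq q' hq' hne
    rw [Function.onFun, Set.disjoint_left]
    intro x hx hx'
    rcases lt_trichotomy q.1 q'.1 with hlt | heq | hlt
    · exact hq'.2.2 q hq.1.le hlt (gcube_nested hℓ hlt.le hx hx') hq.2.1
    · exact hne (gcube_eq_of_mem hℓ heq hx hx')
    · exact hq.2.2 q' hq'.1.le hlt (gcube_nested hℓ hlt.le hx' hx) hq'.2.1
  · rintro ⟨j, m⟩ hq
    obtain ⟨k, rfl⟩ : ∃ k, j = k + 1 := ⟨j - 1, by have := hq.1; simp only at this; omega⟩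
    obtain ⟨x, hx⟩ := nonempty_of_measure_ne_zero (volume_gcube_ne_zero hℓ (o := o) (k + 1, m))
    have hx' := mem_gcube_self hℓ k x (o := o)
    have hsub := gcube_nested hℓ (Nat.le_succ k) hx' hx
    have hnb := hq.2.2 _ (Nat.lt_succ_iff.1 hq.1) (Nat.lt_succ_self k) hsub
    simp only [hbad, not_lt] at hnb
    refine (lintegral_mono_set hsub).trans (hnb.trans (le_of_eq ?_))
    rw [volume_gcube hℓ, volume_gcube hℓ]
    have : gside ℓ k = 2 * gside ℓ (k + 1) := by
      simp only [gside, pow_succ]; field_simp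
    rw [this, ENNReal.ofReal_mul (by norm_num), mul_pow]
    norm_num
    ring
  · filter_upwards [ae_tendsto_cube hm hh] with x hx hxP
    -- Off the selected cubes no grid cube around x is bad, because the coarsest bad one would have
    -- been selected. Lebesgue differentiation along these cubes then bounds h at x.
    have hnb : ∀ j, j₀ ≤ j → ¬ bad (j, gidx o ℓ j x) := by
      intro j
      induction j using Nat.strong_induction_on with
      | _ j ih =>
        intro hj hb
        rcases hj.eq_or_lt with rfl | hj
        · exact absurd hb (not_lt.2 (h₀ _))
        refine hxP (Set.mem_biUnion (x := (j, gidx o ℓ j x)) ⟨hj, hb, ?_⟩ (mem_gcube_self hℓ j x))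
        intro q' hq1 hq2 hsub
        have := hsub (mem_gcube_self hℓ j x)
        rw [mem_gcube_iff hℓ] at this
        have h3 := ih q'.1 hq2 hq1
        rwa [this] at h3
    set a : ℕ → Fin n → ℝ := fun j i => o i + gside ℓ j * gidx o ℓ j x i with ha
    have hlim : Tendsto (fun j => gside ℓ j / 2) atTop (𝓝[>] 0) := by
      refine tendsto_nhdsWithin_iff.2 ⟨?_, Eventually.of_forall fun j => ?_⟩
      · have h1 : Tendsto (fun j : ℕ => ((1 : ℝ) / 2) ^ j) atTop (𝓝 0) :=
          tendsto_pow_atTop_nhds_zero_of_lt_one (by norm_num) (by norm_num)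
        have h2 := h1.const_mul (ℓ / 2)
        rw [mul_zero] at h2
        refine h2.congr fun j => ?_
        simp only [gside, one_div, inv_pow]
        field_simp
      · have := gside_pos hℓ j
        exact show 0 < gside ℓ j / 2 by positivity
    have hconv := hx (fun j => boxCenter (a j) (gside ℓ j)) (fun j => gside ℓ j / 2) hlim
      (fun j => hbox_subset_cube _ _ (mem_gcube_self hℓ j x))
    refine le_of_tendsto hconv ?_
    filter_upwards [eventually_ge_atTop j₀] with j hj
    have h1 := hnb j hj
    simp only [hbad, not_lt] at h1
    have hae : gcube o ℓ (j, gidx o ℓ j x) =ᵐ[volume] cube (boxCenter (a j) (gside ℓ j))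
        (gside ℓ j / 2) := hbox_ae_eq_cube _ (gside_pos hℓ j).le
    rw [← setLIntegral_congr hae, ← measure_congr hae]
    exact ENNReal.div_le_of_le_mul h1

end RoughSquare

namespace RoughSquare

/-! ### The weak type (1,1) bound -/

variable {n : ℕ}

/-- The constant in the off-diagonal estimate of a kernel family. -/
noncomputable def farConst (n : ℕ) : ℝ≥0∞ :=
  geomConst (n + 1) * 2 ^ (n + 1) * (2 ^ (n + 1) * ENNReal.ofReal (sphereConst n))

lemma farConst_ne_top (n : ℕ) : farConst n ≠ ⊤ := by
  refine ENNReal.mul_ne_top (ENNReal.mul_ne_top (geomConst_ne_top (by positivity)) (by simp))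
    (ENNReal.mul_ne_top (by simp) (by simp))

namespace IsKernelFamily

variable {ψ : ℤ → Rn n → ℂ}

lemma measurable_tsum_sub (h : IsKernelFamily ψ 1) (c : Rn n) :
    Measurable fun z : Rn n × Rn n => ∑' k, ‖ψ k (z.1 - z.2) - ψ k (z.1 - c)‖ₑ := by
  refine Measurable.tsum fun k => Measurable.enorm ?_
  have := (h.continuous k).measurable
  fun_prop

/-- Hörmander's condition for the square function: the regularity summed over scales is at most a
constant times R/‖x - c‖^{n+1}, whose integral over ‖x - c‖ > R does not depend on R. -/
lemma lintegral_far_le (h : IsKernelFamily ψ 1) (hn : 1 ≤ n) {c y : Rn n} {R : ℝ} (hR : 0 < R)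
    (hy : ‖y - c‖ ≤ R / 2) :
    ∫⁻ x in {x | R < ‖x - c‖}, ∑' k, ‖ψ k (x - y) - ψ k (x - c)‖ₑ ≤ farConst n := by
  have hms : MeasurableSet {x : Rn n | R < ‖x - c‖} :=
    (isOpen_lt continuous_const (by fun_prop)).measurableSet
  set F : Rn n → ℝ := fun z => (Ioi R).indicator (fun r : ℝ => R / r ^ (n + 1)) ‖z‖ with hF
  have hF0 : ∀ z, 0 ≤ F z := fun z => Set.indicator_apply_nonneg fun hz => by
    have : 0 < ‖z‖ := hR.trans hz
    positivity
  have hpt : ∀ x ∈ {x : Rn n | R < ‖x - c‖}, ∑' k, ‖ψ k (x - y) - ψ k (x - c)‖ₑ ≤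
      geomConst (n + 1) * 2 ^ (n + 1) * (2 ^ (n + 1) * ENNReal.ofReal (F (x - c))) := by
    intro x hx
    have hx' : R < ‖x - c‖ := hx
    have hpos : 0 < ‖x - c‖ := hR.trans hx'
    have h1 : ‖x - c‖ / 2 ≤ ‖x - y‖ := by
      have := norm_sub_norm_le (x - c) (y - c)
      rw [sub_sub_sub_cancel_right] at this
      linarith
    refine (h.tsum_sub_le (half_pos hpos) h1 (by linarith)).trans ?_
    gcongr
    have e : (2 : ℝ≥0∞) ^ (n + 1) = ENNReal.ofReal (2 ^ (n + 1)) := by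
      rw [ENNReal.ofReal_pow (by norm_num)]; norm_num
    rw [e, ← ENNReal.ofReal_mul (by positivity)]
    refine ENNReal.ofReal_le_ofReal ?_
    have e2 : F (x - c) = R / ‖x - c‖ ^ (n + 1) := Set.indicator_of_mem (show ‖x - c‖ ∈ Ioi R from hx') _
    rw [e2, sub_sub_sub_cancel_left, div_pow, norm_sub_rev, div_div_eq_mul_div, mul_comm,
      mul_div_assoc]
    gcongr
    linarith
  calc _ ≤ ∫⁻ x in {x | R < ‖x - c‖},
        geomConst (n + 1) * 2 ^ (n + 1) * (2 ^ (n + 1) * ENNReal.ofReal (F (x - c))) :=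
        setLIntegral_mono' hms hpt
    _ ≤ ∫⁻ x, geomConst (n + 1) * 2 ^ (n + 1) * (2 ^ (n + 1) * ENNReal.ofReal (F (x - c))) :=
        setLIntegral_le_lintegral _ _
    _ = geomConst (n + 1) * 2 ^ (n + 1) * (2 ^ (n + 1) * ∫⁻ x, ENNReal.ofReal (F (x - c))) := by
        rw [lintegral_const_mul' _ _ (ENNReal.mul_ne_top (geomConst_ne_top (by positivity)) (by simp)),
          lintegral_const_mul' _ _ (by simp)]
    _ = farConst n := by
        rw [lintegral_sub_right_eq_self (fun x => ENNReal.ofReal (F x)) c,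
          ← ofReal_integral_eq_lintegral_ofReal (radial_far hn hR).1 (ae_of_all _ hF0),
          (radial_far hn hR).2, farConst]

/-- The square function of a sum of atoms, away from their supports. -/
lemma sqFn_atoms_le (h : IsKernelFamily ψ 1) {ι : Type*} [Countable ι] {Q : ι → Set (Rn n)}
    (hQ : ∀ i, MeasurableSet (Q i)) (hd : Pairwise (Function.onFun Disjoint Q)) {b : Rn n → ℂ}
    (hb : Integrable b) (hb0 : ∀ x, x ∉ ⋃ i, Q i → b x = 0) (hbQ : ∀ i, ∫ x in Q i, b x = 0)
    (c : ι → Rn n) (x : Rn n) : sqFn ψ b x ≤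
      ∑' i, ∫⁻ y in Q i, (∑' k, ‖ψ k (x - y) - ψ k (x - c i)‖ₑ) * ‖b y‖ₑ := by
  refine (sqrt_tsum_sq_le_tsum _).trans ?_
  have key : ∀ k, ‖(ψ k ⋆[ContinuousLinearMap.mul ℂ ℂ, volume] b) x‖ₑ ≤
      ∑' i, ∫⁻ y in Q i, ‖ψ k (x - y) - ψ k (x - c i)‖ₑ * ‖b y‖ₑ := by
    intro k
    have hi := h.integrable_mul hb.locallyIntegrable k x
    have e1 : (ψ k ⋆[ContinuousLinearMap.mul ℂ ℂ, volume] b) x =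
        ∫ y in ⋃ i, Q i, ψ k (x - y) * b y := by
      rw [convolution_mul_swap, setIntegral_eq_integral_of_forall_compl_eq_zero]
      intro y hy
      rw [hb0 y hy, mul_zero]
    rw [e1, ← (hasSum_integral_iUnion hQ hd hi.integrableOn).tsum_eq]
    refine enorm_tsum_le_tsum_enorm.trans (ENNReal.tsum_le_tsum fun i => ?_)
    have e2 : ∫ y in Q i, ψ k (x - y) * b y = ∫ y in Q i, (ψ k (x - y) - ψ k (x - c i)) * b y := by
      simp_rw [sub_mul]
      rw [integral_sub hi.integrableOn (hb.integrableOn.const_mul _), integral_const_mul, hbQ i,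
        mul_zero, sub_zero]
    rw [e2]
    refine (enorm_integral_le_lintegral_enorm _).trans (le_of_eq ?_)
    simp_rw [enorm_mul]
  refine (ENNReal.tsum_le_tsum key).trans (le_of_eq ?_)
  rw [ENNReal.tsum_comm]
  refine tsum_congr fun i => ?_
  simp_rw [← ENNReal.tsum_mul_right]
  rw [lintegral_tsum]
  intro k
  have := (h.continuous k).measurable
  exact AEMeasurable.mul (by fun_prop) hb.1.enorm.restrict

/-- Cancellation of `b` on each cell subtracts the kernel at the centre. Tonelli then moves the
x-integral inside, where `lintegral_far_le` applies to each y in the cell. -/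
lemma lintegral_sqFn_atoms_le (h : IsKernelFamily ψ 1) (hn : 1 ≤ n) {ι : Type*} [Countable ι]
    {Q : ι → Set (Rn n)}
    (hQ : ∀ i, MeasurableSet (Q i)) (hd : Pairwise (Function.onFun Disjoint Q)) {b : Rn n → ℂ}
    (hb : Integrable b) (hb0 : ∀ x, x ∉ ⋃ i, Q i → b x = 0) (hbQ : ∀ i, ∫ x in Q i, b x = 0)
    (c : ι → Rn n) (R : ι → ℝ) (hR : ∀ i, 0 < R i) (hQR : ∀ i, ∀ y ∈ Q i, ‖y - c i‖ ≤ R i / 2) :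
    ∫⁻ x in (⋃ i, Metric.closedBall (c i) (R i))ᶜ, sqFn ψ b x ≤ farConst n * ∫⁻ x, ‖b x‖ₑ := by
  set U := (⋃ i, Metric.closedBall (c i) (R i))ᶜ with hU
  have hUi : ∀ i, U ⊆ {x | R i < ‖x - c i‖} := by
    intro i x hx
    rw [hU, Set.mem_compl_iff, Set.mem_iUnion, not_exists] at hx
    have := hx i
    rw [Metric.mem_closedBall, dist_eq_norm, not_le] at this
    exact this
  have hmeas : ∀ i, AEMeasurable (Function.uncurry fun x y =>
      (∑' k, ‖ψ k (x - y) - ψ k (x - c i)‖ₑ) * ‖b y‖ₑ)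
        ((volume.restrict U).prod (volume.restrict (Q i))) := by
    intro i
    refine AEMeasurable.mul (h.measurable_tsum_sub (c i)).aemeasurable ?_
    exact hb.1.enorm.restrict.comp_snd
  calc _ ≤ ∫⁻ x in U, ∑' i, ∫⁻ y in Q i, (∑' k, ‖ψ k (x - y) - ψ k (x - c i)‖ₑ) * ‖b y‖ₑ :=
        lintegral_mono fun x => h.sqFn_atoms_le hQ hd hb hb0 hbQ c x
    _ = ∑' i, ∫⁻ y in Q i, ∫⁻ x in U, (∑' k, ‖ψ k (x - y) - ψ k (x - c i)‖ₑ) * ‖b y‖ₑ := by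
        refine (lintegral_tsum fun i => (hmeas i).lintegral_prod_right').trans ?_
        exact tsum_congr fun i => lintegral_lintegral_swap (hmeas i)
    _ ≤ ∑' i, ∫⁻ y in Q i, farConst n * ‖b y‖ₑ := by
        refine ENNReal.tsum_le_tsum fun i => setLIntegral_mono' (hQ i) fun y hy => ?_
        rw [lintegral_mul_const' _ _ (by simp)]
        gcongr
        exact (lintegral_mono_set (hUi i)).trans (h.lintegral_far_le hn (hR i) (hQR i y hy))
    _ = farConst n * ∑' i, ∫⁻ y in Q i, ‖b y‖ₑ := by
        rw [← ENNReal.tsum_mul_left]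
        exact tsum_congr fun i => lintegral_const_mul' _ _ (farConst_ne_top n)
    _ ≤ _ := by
        rw [← lintegral_iUnion hQ hd]
        gcongr
        exact Measure.restrict_le_self

end IsKernelFamily

/-- The function obtained from `f` by averaging over each of the sets `Q i`. -/
noncomputable def cellAverage {ι : Type*} (Q : ι → Set (Rn n)) (f : Rn n → ℂ) (x : Rn n) : ℂ :=
  (∑' i, (Q i).indicator (fun _ => ⨍ y in Q i, f y) x) + (⋃ i, Q i)ᶜ.indicator f x

section cellAverage

variable {ι : Type*} {Q : ι → Set (Rn n)} {f : Rn n → ℂ}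

lemma cellAverage_of_mem (hd : Pairwise (Function.onFun Disjoint Q)) {i : ι} {x : Rn n}
    (hx : x ∈ Q i) : cellAverage Q f x = ⨍ y in Q i, f y := by
  rw [cellAverage, Set.indicator_of_notMem (by simpa using ⟨i, hx⟩), add_zero, tsum_eq_single i,
    Set.indicator_of_mem hx]
  intro j hj
  exact Set.indicator_of_notMem (fun h => Set.disjoint_left.1 (hd hj) h hx) _

lemma cellAverage_of_notMem {x : Rn n} (hx : x ∉ ⋃ i, Q i) : cellAverage Q f x = f x := by
  have : ∀ i, (Q i).indicator (fun _ => ⨍ y in Q i, f y) x = 0 := fun i =>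
    Set.indicator_of_notMem (fun h => hx (Set.mem_iUnion.2 ⟨i, h⟩)) _
  rw [cellAverage, Set.indicator_of_mem hx]
  simp [this]

lemma measurable_cellAverage [Countable ι] (hQ : ∀ i, MeasurableSet (Q i)) (hf : Measurable f) :
    Measurable (cellAverage Q f) :=
  (Measurable.tsum fun i => measurable_const.indicator (hQ i)).add
    (hf.indicator (MeasurableSet.iUnion hQ).compl)

end cellAverage

end RoughSquare

/-! ### The Calderón–Zygmund argument for weak type (1,1). -/

namespace RoughSquare

variable {n : ℕ}

lemma norm_le_of_abs_le {x : Rn n} {r : ℝ} (hn : 1 ≤ n) (h : ∀ i, |x i| ≤ r) : ‖x‖ ≤ n * r := by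
  have hr : 0 ≤ r := (abs_nonneg _).trans (h ⟨0, hn⟩)
  have h1 : ‖x‖ ^ 2 ≤ (n * r) ^ 2 := by
    rw [EuclideanSpace.norm_sq_eq]
    calc ∑ i, ‖x i‖ ^ 2 ≤ ∑ _i : Fin n, r ^ 2 := by
          gcongr with i
          exact h i
      _ = n * r ^ 2 := by simp
      _ ≤ (n : ℝ) * n * r ^ 2 := by
          have : (1 : ℝ) ≤ n := by exact_mod_cast hn
          gcongr
          nlinarith
      _ = _ := by ring
  exact le_of_sq_le_sq h1 (by positivity)

lemma norm_sub_le_of_mem_cube (hn : 1 ≤ n) {c x : Rn n} {r : ℝ} (h : x ∈ cube c r) :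
    ‖x - c‖ ≤ n * r := norm_le_of_abs_le hn fun i => by simpa using h i

lemma closedBall_subset_cube (c : Rn n) (r : ℝ) : Metric.closedBall c r ⊆ cube c r := by
  intro x hx i
  rw [Metric.mem_closedBall, dist_eq_norm] at hx
  have := PiLp.norm_apply_le (x - c) i
  simp only [PiLp.sub_apply, Real.norm_eq_abs] at this
  exact this.trans hx

lemma enorm_setAverage_mul_le (f : Rn n → ℂ) {A : Set (Rn n)} (h0 : volume A ≠ 0)
    (ht : volume A ≠ ⊤) : ‖⨍ y in A, f y‖ₑ * volume A ≤ ∫⁻ y in A, ‖f y‖ₑ := by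
  have hr : 0 < volume.real A := ENNReal.toReal_pos h0 ht
  rw [setAverage_eq, enorm_smul, Real.enorm_of_nonneg (by positivity),
    ENNReal.ofReal_inv_of_pos hr, Measure.real, ENNReal.ofReal_toReal ht, mul_right_comm,
    ENNReal.inv_mul_cancel h0 ht, one_mul]
  exact enorm_integral_le_lintegral_enorm _

/-- Gives a grid so coarse that the averages of |f| over its top cubes are at most s, which starts
the stopping process. The maximum with 1 ensures ℓ ≤ ℓ^n. -/
lemma exists_side_le (hn : 1 ≤ n) {F : ℝ≥0∞} (hF : F ≠ ⊤) {s : ℝ≥0} (hs : s ≠ 0) :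
    ∃ ℓ : ℝ, 0 < ℓ ∧ F ≤ s * ENNReal.ofReal ℓ ^ n := by
  refine ⟨max 1 (F / s).toReal, by positivity, ?_⟩
  have hs' : (s : ℝ≥0∞) ≠ 0 := by exact_mod_cast hs
  have h1 : (1 : ℝ≥0∞) ≤ ENNReal.ofReal (max 1 (F / s).toReal) := by
    rw [← ENNReal.ofReal_one]; exact ENNReal.ofReal_le_ofReal (le_max_left _ _)
  calc F = s * (F / s) := (ENNReal.mul_div_cancel hs' ENNReal.coe_ne_top).symm
    _ = s * ENNReal.ofReal (F / s).toReal := by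
        rw [ENNReal.ofReal_toReal (ENNReal.div_ne_top hF hs')]
    _ ≤ s * ENNReal.ofReal (max 1 (F / s).toReal) := by gcongr; exact le_max_right _ _
    _ ≤ _ := by gcongr; exact le_self_pow₀ h1 (by omega)

namespace IsKernelFamily

variable {ψ : ℤ → Rn n → ℂ}

/-- The constant in the weak type (1,1) bound. -/
noncomputable def weakConst (n : ℕ) : ℝ≥0∞ :=
  2 * (l2Const n * 2 ^ n + (2 * n) ^ n + farConst n * 2)

lemma weakConst_ne_top (n : ℕ) : weakConst n ≠ ⊤ := by
  have h1 := l2Const_ne_top n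
  have h2 := farConst_ne_top n
  have h3 : ((2 : ℝ≥0∞) * n) ^ n ≠ ⊤ :=
    ENNReal.pow_ne_top (ENNReal.mul_ne_top (by simp) (by simp))
  have h4 : l2Const n * 2 ^ n ≠ ⊤ := ENNReal.mul_ne_top h1 (by simp)
  have h5 : farConst n * 2 ≠ ⊤ := ENNReal.mul_ne_top h2 (by simp)
  exact ENNReal.mul_ne_top (by simp) (by simp [h3, h4, h5])

/-- Calderón–Zygmund decomposition f = g + b at height s. The L² bound and Chebyshev treat g; balls
around the bad cubes have total measure O(‖f‖₁/s); off these balls the square function of b is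
bounded in L¹. The level is 2s so that g and b receive s each. -/
lemma sqFn_weak_of_measurable (h : IsKernelFamily ψ 1) (hn : 1 ≤ n) {f : Rn n → ℂ}
    (hfm : Measurable f) (hf : Integrable f) (s : ℝ≥0) :
    2 * s * volume {x | 2 * (s : ℝ≥0∞) < sqFn ψ f x} ≤ weakConst n * ∫⁻ x, ‖f x‖ₑ := by
  rcases eq_or_ne s 0 with rfl | hs
  · simp
  have hs0 : (s : ℝ≥0∞) ≠ 0 := by exact_mod_cast hs
  have hst : (s : ℝ≥0∞) ≠ ⊤ := ENNReal.coe_ne_top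
  set F := ∫⁻ x, ‖f x‖ₑ with hF
  have hFt : F ≠ ⊤ := hf.2.ne
  obtain ⟨ℓ, hℓ, hℓF⟩ := exists_side_le hn hFt hs
  obtain ⟨P, -, hPd, hPlt, hPle, hPae⟩ := calderon_zygmund (o := fun _ => 0) hℓ hfm.enorm hFt s 0
    (fun m => by
      rw [volume_gcube hℓ]
      refine (setLIntegral_le_lintegral _ _).trans (hℓF.trans (le_of_eq ?_))
      simp [gside])
  set Q : P → Set (Rn n) := fun i => gcube (fun _ => 0) ℓ i.1 with hQdef
  have hQ : ∀ i, MeasurableSet (Q i) := fun i => measurableSet_hbox _ _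
  have hd : Pairwise (Function.onFun Disjoint Q) := fun i j hij =>
    hPd i.2 j.2 (fun e => hij (Subtype.ext e))
  have hQ0 : ∀ i, volume (Q i) ≠ 0 := fun i => volume_gcube_ne_zero hℓ _
  have hQt : ∀ i, volume (Q i) ≠ ⊤ := fun i => volume_gcube_ne_top hℓ _
  set Ω := ⋃ i, Q i with hΩ
  have hΩm : MeasurableSet Ω := MeasurableSet.iUnion hQ
  have hΩF : ∑' i, ∫⁻ y in Q i, ‖f y‖ₑ ≤ F := by
    rw [← lintegral_iUnion hQ hd]; exact setLIntegral_le_lintegral _ _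
  set g := cellAverage Q f with hg
  have hgm : Measurable g := measurable_cellAverage hQ hfm
  -- size of the averaged function
  have havg : ∀ i, ‖⨍ y in Q i, f y‖ₑ ≤ 2 ^ n * s := by
    intro i
    have h1 := (enorm_setAverage_mul_le f (hQ0 i) (hQt i)).trans (hPle i.1 i.2)
    exact (ENNReal.mul_le_mul_iff_left (hQ0 i) (hQt i)).1 h1
  have hgle : ∀ᵐ x, ‖g x‖ₑ ≤ 2 ^ n * s := by
    filter_upwards [hPae] with x hx
    by_cases hxΩ : x ∈ Ω
    · obtain ⟨i, hi⟩ := Set.mem_iUnion.1 hxΩ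
      rw [hg, cellAverage_of_mem hd hi]
      exact havg i
    · rw [hg, cellAverage_of_notMem hxΩ]
      refine (hx ?_).trans ?_
      · intro hcon
        obtain ⟨q, hq, hxq⟩ := Set.mem_iUnion₂.1 hcon
        exact hxΩ (Set.mem_iUnion.2 ⟨⟨q, hq⟩, hxq⟩)
      · exact le_mul_of_one_le_left zero_le (one_le_pow₀ (by norm_num))
  have hg1 : ∫⁻ x, ‖g x‖ₑ ≤ F := by
    rw [hF, ← lintegral_add_compl _ hΩm, ← lintegral_add_compl (fun x => ‖f x‖ₑ) hΩm]
    refine add_le_add ?_ (le_of_eq ?_)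
    · rw [hΩ, lintegral_iUnion hQ hd, lintegral_iUnion hQ hd]
      refine ENNReal.tsum_le_tsum fun i => ?_
      rw [setLIntegral_congr_fun (hQ i) (g := fun _ => ‖⨍ y in Q i, f y‖ₑ)
        (fun x hx => by simp only [hg, cellAverage_of_mem hd hx]), setLIntegral_const]
      exact enorm_setAverage_mul_le f (hQ0 i) (hQt i)
    · exact setLIntegral_congr_fun hΩm.compl
        (fun x hx => by simp only [hg, cellAverage_of_notMem hx])
  have hg2 : ∫⁻ x, ‖g x‖ₑ ^ 2 ≤ 2 ^ n * s * F := by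
    calc _ ≤ ∫⁻ x, 2 ^ n * s * ‖g x‖ₑ := by
          refine lintegral_mono_ae ?_
          filter_upwards [hgle] with x hx
          rw [sq]; gcongr
      _ = 2 ^ n * s * ∫⁻ x, ‖g x‖ₑ := lintegral_const_mul _ hgm.enorm
      _ ≤ _ := by gcongr
  have hgi : Integrable g := ⟨hgm.aestronglyMeasurable, hg1.trans_lt hFt.lt_top⟩
  have hgL2 : MemLp g 2 := by
    refine ⟨hgm.aestronglyMeasurable, ?_⟩
    rw [eLpNorm_eq_lintegral_rpow_enorm_toReal (by simp) (by simp)]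
    refine ENNReal.rpow_lt_top_of_nonneg (by simp) ?_
    simp only [ENNReal.toReal_ofNat, ENNReal.rpow_two]
    exact (hg2.trans_lt (ENNReal.mul_lt_top (ENNReal.mul_lt_top (by simp) hst.lt_top)
      hFt.lt_top)).ne
  -- the atoms
  set b := f - g with hb
  have hbi : Integrable b := hf.sub hgi
  have hb1 : ∫⁻ x, ‖b x‖ₑ ≤ 2 * F := by
    calc _ ≤ ∫⁻ x, (‖f x‖ₑ + ‖g x‖ₑ) := lintegral_mono fun x => enorm_sub_le
      _ = F + ∫⁻ x, ‖g x‖ₑ := lintegral_add_left hfm.enorm _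
      _ ≤ F + F := by gcongr
      _ = _ := (two_mul _).symm
  have hb0 : ∀ x, x ∉ ⋃ i, Q i → b x = 0 := fun x hx => by
    simp only [hb, Pi.sub_apply, hg, cellAverage_of_notMem hx, sub_self]
  have hbQ : ∀ i, ∫ x in Q i, b x = 0 := by
    intro i
    simp only [hb, Pi.sub_apply]
    have hr : volume.real (Q i) ≠ 0 := (ENNReal.toReal_pos (hQ0 i) (hQt i)).ne'
    have e : ∫ x in Q i, g x = ∫ _x in Q i, ⨍ y in Q i, f y :=
      setIntegral_congr_fun (hQ i) fun x hx => by simp only [hg, cellAverage_of_mem hd hx]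
    rw [integral_sub hf.integrableOn hgi.integrableOn, e, setIntegral_const, setAverage_eq,
      smul_smul, mul_inv_cancel₀ hr, one_smul, sub_self]
  set c : P → Rn n := fun i =>
    boxCenter (fun j => (0 : ℝ) + gside ℓ i.1.1 * i.1.2 j) (gside ℓ i.1.1) with hc
  -- A cube of side a lies within n a/2 of its centre, since the Euclidean norm is at most n times
  -- the sup norm; the radius is twice that.
  set R : P → ℝ := fun i => n * gside ℓ i.1.1 with hR
  have hn0 : (0 : ℝ) < n := by exact_mod_cast hn
  have hRpos : ∀ i, 0 < R i := fun i => mul_pos hn0 (gside_pos hℓ _)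
  have hQR : ∀ i, ∀ y ∈ Q i, ‖y - c i‖ ≤ R i / 2 := by
    intro i y hy
    have := norm_sub_le_of_mem_cube hn (hbox_subset_cube _ _ hy)
    simp only [hc, hR]
    linarith
  have hfar := h.lintegral_sqFn_atoms_le hn hQ hd hbi hb0 hbQ c R hRpos hQR
  set U := ⋃ i, Metric.closedBall (c i) (R i) with hU
  have hUm : MeasurableSet U := MeasurableSet.iUnion fun i => measurableSet_closedBall
  have hUvol : s * volume U ≤ (2 * n) ^ n * F := by
    calc s * volume U ≤ s * ∑' i, volume (Metric.closedBall (c i) (R i)) := by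
          gcongr; exact measure_iUnion_le _
      _ ≤ s * ∑' i, (2 * n) ^ n * volume (Q i) := by
          gcongr with i
          refine (measure_mono (closedBall_subset_cube _ _)).trans (le_of_eq ?_)
          have hsd := gside_pos hℓ i.1.1
          rw [volume_cube _ (hRpos i).le, hQdef, volume_gcube hℓ, hR, ← mul_assoc, mul_pow,
            ENNReal.ofReal_mul (by positivity), ENNReal.ofReal_pow (by positivity),
            ENNReal.ofReal_pow hsd.le, ENNReal.ofReal_mul (by norm_num)]
          norm_num
      _ = (2 * n) ^ n * ∑' i, s * volume (Q i) := by
          rw [ENNReal.tsum_mul_left, ENNReal.tsum_mul_left]; ring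
      _ ≤ (2 * n) ^ n * ∑' i, ∫⁻ y in Q i, ‖f y‖ₑ := by
          gcongr with i
          exact (hPlt i.1 i.2).le
      _ ≤ _ := by gcongr
  have hgood : s * volume {x | (s : ℝ≥0∞) ≤ sqFn ψ g x} ≤ l2Const n * 2 ^ n * F := by
    have hmeas := h.measurable_sqFn hgi.locallyIntegrable
    have h1 : (s : ℝ≥0∞) ^ 2 * volume {x | (s : ℝ≥0∞) ≤ sqFn ψ g x} ≤
        s * (l2Const n * 2 ^ n * F) := by
      calc _ ≤ (s : ℝ≥0∞) ^ 2 * volume {x | (s : ℝ≥0∞) ^ 2 ≤ sqFn ψ g x ^ 2} :=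
            mul_le_mul' le_rfl (measure_mono fun x hx => pow_le_pow_left' hx 2)
      _ ≤ ∫⁻ x, sqFn ψ g x ^ 2 := mul_meas_ge_le_lintegral (hmeas.pow_const 2) _
      _ ≤ l2Const n * ∫⁻ x, ‖g x‖ₑ ^ 2 := h.sqFn_L2 hgL2
      _ ≤ l2Const n * (2 ^ n * s * F) := by gcongr
      _ = _ := by ring
    rw [sq, mul_assoc] at h1
    exact (ENNReal.mul_le_mul_iff_right hs0 hst).1 h1
  have hbad : s * volume ({x | (s : ℝ≥0∞) ≤ sqFn ψ b x} ∩ Uᶜ) ≤ farConst n * 2 * F := by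
    rw [← Measure.restrict_apply' hUm.compl]
    refine (mul_meas_ge_le_lintegral (h.measurable_sqFn hbi.locallyIntegrable) _).trans ?_
    refine hfar.trans ?_
    rw [mul_assoc]
    gcongr
  have hsub : {x | 2 * (s : ℝ≥0∞) < sqFn ψ f x} ⊆
      {x | (s : ℝ≥0∞) ≤ sqFn ψ g x} ∪ (U ∪ {x | (s : ℝ≥0∞) ≤ sqFn ψ b x} ∩ Uᶜ) := by
    intro x hx
    by_contra hcon
    simp only [Set.mem_union, Set.mem_inter_iff, Set.mem_ofPred_eq, Set.mem_compl_iff, not_or,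
      not_and, not_not, not_le] at hcon
    have hxb : sqFn ψ b x < s := by
      by_contra h1
      exact hcon.2.1 (hcon.2.2 (not_lt.1 h1))
    have h1 := h.sqFn_add_le hgi.locallyIntegrable hbi.locallyIntegrable x
    have e : g + b = f := by simp [hb]
    rw [e] at h1
    have h2 : 2 * (s : ℝ≥0∞) < sqFn ψ f x := hx
    refine absurd (h2.trans_le h1) (not_lt.2 ?_)
    rw [two_mul]
    exact add_le_add hcon.1.le hxb.le
  calc _ ≤ 2 * (s * volume {x | (s : ℝ≥0∞) ≤ sqFn ψ g x} +
        (s * volume U + s * volume ({x | (s : ℝ≥0∞) ≤ sqFn ψ b x} ∩ Uᶜ))) := by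
        rw [mul_assoc, ← mul_add, ← mul_add]
        gcongr
        exact (measure_mono hsub).trans ((measure_union_le _ _).trans
          (add_le_add le_rfl (measure_union_le _ _)))
    _ ≤ 2 * (l2Const n * 2 ^ n * F + ((2 * n) ^ n * F + farConst n * 2 * F)) := by gcongr
    _ = _ := by rw [weakConst]; ring

theorem sqFn_weak (h : IsKernelFamily ψ 1) (hn : 1 ≤ n) {f : Rn n → ℂ} (hf : Integrable f)
    (t : ℝ≥0) : t * volume {x | (t : ℝ≥0∞) < sqFn ψ f x} ≤ weakConst n * ∫⁻ x, ‖f x‖ₑ := by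
  obtain ⟨g, hgm, hfg⟩ := hf.1
  have hg : Integrable g := hf.congr hfg
  have := h.sqFn_weak_of_measurable hn hgm.measurable hg (t / 2)
  have e : 2 * ((t / 2 : ℝ≥0) : ℝ≥0∞) = t := by
    rw [← ENNReal.coe_ofNat, ← ENNReal.coe_mul, mul_div_cancel₀ _ two_ne_zero]
  rw [e] at this
  rw [sqFn_congr hfg]
  refine this.trans (le_of_eq ?_)
  congr 1
  exact lintegral_congr_ae (hfg.mono fun x hx => by simp only [hx])

end IsKernelFamily

end RoughSquare

namespace RoughSquare

/-! ### The grand maximal truncated operator -/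

variable {n : ℕ}

lemma le_hlMaximal (g : Rn n → ℝ≥0∞) {c x : Rn n} {r : ℝ} (hr : 0 < r) (hx : x ∈ cube c r) :
    (∫⁻ y in cube c r, g y) / volume (cube c r) ≤ hlMaximal g x :=
  le_iSup_of_le c (le_iSup_of_le r (le_iSup_of_le hr (le_iSup_of_le hx le_rfl)))

lemma lintegral_cube_le (g : Rn n → ℝ≥0∞) {c x : Rn n} {r : ℝ} (hr : 0 < r) (hx : x ∈ cube c r) :
    ∫⁻ y in cube c r, g y ≤ hlMaximal g x * volume (cube c r) :=
  (ENNReal.div_le_iff (volume_cube_ne_zero c hr) (volume_cube_ne_top c hr.le)).1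
    (le_hlMaximal g hr hx)

lemma cube_mono (c : Rn n) {r r' : ℝ} (h : r ≤ r') : cube c r ⊆ cube c r' :=
  fun _ hx i => (hx i).trans h

namespace IsKernelFamily

variable {ψ : ℤ → Rn n → ℂ}

lemma sqFn_neg (ψ : ℤ → Rn n → ℂ) (f : Rn n → ℂ) : sqFn ψ (-f) = sqFn ψ f := by
  ext x
  simp only [sqFn, convolution_mul_swap, Pi.neg_apply, mul_neg, integral_neg, enorm_neg]

/-- The constant in the oscillation estimate `sqFn_osc_le`. -/
noncomputable def oscConst (n : ℕ) : ℝ≥0∞ :=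
  geomConst (n + 1) * 2 ^ (n + 1) * (2 * ENNReal.ofReal (n * 6 ^ n))

lemma oscConst_ne_top (n : ℕ) : oscConst n ≠ ⊤ :=
  ENNReal.mul_ne_top (ENNReal.mul_ne_top (geomConst_ne_top (by positivity)) (by simp))
    (ENNReal.mul_ne_top (by simp) ENNReal.ofReal_ne_top)

lemma sub_norm_ge {c x y : Rn n} {r R : ℝ} (hx : x ∈ cube c r) (hy : y ∉ cube c R) :
    R - r ≤ ‖x - y‖ := by
  simp only [cube, Set.mem_ofPred_eq, not_forall, not_le] at hy
  obtain ⟨i, hi⟩ := hy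
  have h1 := PiLp.norm_apply_le (x - y) i
  simp only [PiLp.sub_apply, Real.norm_eq_abs] at h1
  have h2 := hx i
  have h3 : |y i - c i| ≤ |x i - y i| + |x i - c i| := by
    rw [abs_sub_comm (x i) (y i)]; exact abs_sub_le _ _ _
  linarith

/-- The square function of a function supported off `3Q` is almost constant on `Q`. -/
lemma sqFn_osc_le (h : IsKernelFamily ψ 1) (hn : 1 ≤ n) {f : Rn n → ℂ} (hf : LocallyIntegrable f)
    {c x x' z : Rn n} {r : ℝ} (hr : 0 < r) (hx : x ∈ cube c r) (hx' : x' ∈ cube c r)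
    (hz : z ∈ cube c r) :
    sqFn ψ ((cube c (3 * r))ᶜ.indicator f) x ≤ sqFn ψ ((cube c (3 * r))ᶜ.indicator f) x' +
      oscConst n * hlMaximal (fun y => ‖f y‖ₑ) z := by
  classical
  have hms : ∀ R, MeasurableSet (cube c R) := fun R => measurableSet_cube c R
  refine (h.sqFn_le_add ((hf.indicator (hms (3 * r)).compl)) x x').trans ?_
  gcongr
  set M := hlMaximal (fun y => ‖f y‖ₑ) z
  -- Dyadic shells around 3Q. On the i-th shell both points are at distance at least 3r·2^i - r ≥
  -- 2r·2^i, so the summed regularity beats the inverse volume of the surrounding cube by 2^{-i};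
  -- that cube contains z, so the average of |f| over it is at most `M`.
  set A : ℕ → Set (Rn n) := fun i => cube c (3 * r * 2 ^ (i + 1)) \ cube c (3 * r * 2 ^ i)
  have hcov : (cube c (3 * r))ᶜ ⊆ ⋃ i, A i := by
    intro y hy
    have hex : ∃ i : ℕ, y ∈ cube c (3 * r * 2 ^ i) := by
      obtain ⟨i, hi⟩ := pow_unbounded_of_one_lt (‖y - c‖ / (3 * r)) (one_lt_two (α := ℝ))
      refine ⟨i, closedBall_subset_cube _ _ ?_⟩
      rw [Metric.mem_closedBall, dist_eq_norm]
      rw [div_lt_iff₀ (by positivity)] at hi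
      linarith
    have hne : Nat.find hex ≠ 0 := by
      intro h0
      have := Nat.find_spec hex
      rw [h0] at this
      exact hy (by simpa using this)
    obtain ⟨i, hi⟩ := Nat.exists_eq_succ_of_ne_zero hne
    refine Set.mem_iUnion.2 ⟨i, ?_, ?_⟩
    · have := Nat.find_spec hex
      rwa [hi] at this
    · exact Nat.find_min hex (by omega)
  have hpt : ∀ i, ∫⁻ y in A i, (∑' k, ‖ψ k (x - y) - ψ k (x' - y)‖ₑ) * ‖f y‖ₑ ≤
      geomConst (n + 1) * 2 ^ (n + 1) * ENNReal.ofReal (n * 6 ^ n) * M * 2⁻¹ ^ i := by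
    intro i
    have hA : MeasurableSet (A i) := (hms _).diff (hms _)
    have hi1 : (1 : ℝ) ≤ 2 ^ i := one_le_pow₀ one_le_two
    have hm0 : 0 < 2 * r * 2 ^ i := by positivity
    have hb : ∀ w ∈ cube c r, ∀ y ∈ A i, 2 * r * 2 ^ i ≤ ‖w - y‖ := by
      intro w hw y hy
      refine le_trans ?_ (sub_norm_ge hw hy.2)
      nlinarith
    set v : ℝ := n * (2 * r) / (2 * r * 2 ^ i) ^ (n + 1) with hv
    calc ∫⁻ y in A i, (∑' k, ‖ψ k (x - y) - ψ k (x' - y)‖ₑ) * ‖f y‖ₑ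
        ≤ ∫⁻ y in A i, geomConst (n + 1) * 2 ^ (n + 1) * ENNReal.ofReal v * ‖f y‖ₑ := by
          refine setLIntegral_mono' hA fun y hy => ?_
          gcongr
          refine (h.tsum_sub_le hm0 (hb x hx y hy) (hb x' hx' y hy)).trans ?_
          gcongr
          rw [sub_sub_sub_cancel_right, hv]
          gcongr
          refine norm_le_of_abs_le hn fun j => ?_
          have h1 := hx j
          have h2 := hx' j
          rw [abs_le] at h1 h2
          simp only [PiLp.sub_apply]
          rw [abs_le]
          constructor <;> linarith [h1.1, h1.2, h2.1, h2.2]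
      _ = geomConst (n + 1) * 2 ^ (n + 1) * ENNReal.ofReal v * ∫⁻ y in A i, ‖f y‖ₑ :=
          lintegral_const_mul' _ _ (ENNReal.mul_ne_top (ENNReal.mul_ne_top
            (geomConst_ne_top (by positivity)) (by simp)) ENNReal.ofReal_ne_top)
      _ ≤ geomConst (n + 1) * 2 ^ (n + 1) * ENNReal.ofReal v *
            (M * ENNReal.ofReal ((2 * (3 * r * 2 ^ (i + 1))) ^ n)) := by
          gcongr
          rw [← volume_cube c (by positivity)]
          refine (lintegral_mono_set Set.sdiff_subset).trans (lintegral_cube_le _ (by positivity) ?_)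
          refine cube_mono c ?_ hz
          have : (1 : ℝ) ≤ 2 ^ (i + 1) := one_le_pow₀ one_le_two
          nlinarith
      _ = geomConst (n + 1) * 2 ^ (n + 1) * M * (ENNReal.ofReal v *
            ENNReal.ofReal ((2 * (3 * r * 2 ^ (i + 1))) ^ n)) := by ring
      _ = geomConst (n + 1) * 2 ^ (n + 1) * M * (ENNReal.ofReal (n * 6 ^ n) * 2⁻¹ ^ i) := by
          congr 1
          have e2 : (2⁻¹ : ℝ≥0∞) ^ i = ENNReal.ofReal (2⁻¹ ^ i) := by
            rw [ENNReal.ofReal_pow (by norm_num), ENNReal.ofReal_inv_of_pos two_pos]; norm_num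
          rw [e2, ← ENNReal.ofReal_mul (by positivity), ← ENNReal.ofReal_mul (by positivity)]
          congr 1
          rw [hv]
          have : (2 * (3 * r * 2 ^ (i + 1))) ^ n = 6 ^ n * (2 * r * 2 ^ i) ^ n := by
            rw [← mul_pow]; congr 1; ring
          rw [this, inv_pow]
          field_simp
          ring
      _ = _ := by ring
  calc ∫⁻ y, (∑' k, ‖ψ k (x - y) - ψ k (x' - y)‖ₑ) * ‖(cube c (3 * r))ᶜ.indicator f y‖ₑ
      = ∫⁻ y in (cube c (3 * r))ᶜ, (∑' k, ‖ψ k (x - y) - ψ k (x' - y)‖ₑ) * ‖f y‖ₑ := by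
        rw [← lintegral_indicator (hms _).compl]
        refine lintegral_congr fun y => ?_
        by_cases hy : y ∈ (cube c (3 * r))ᶜ
        · rw [Set.indicator_of_mem hy, Set.indicator_of_mem hy]
        · rw [Set.indicator_of_notMem hy, Set.indicator_of_notMem hy, enorm_zero, mul_zero]
    _ ≤ ∑' i, ∫⁻ y in A i, (∑' k, ‖ψ k (x - y) - ψ k (x' - y)‖ₑ) * ‖f y‖ₑ :=
        (lintegral_mono_set hcov).trans (lintegral_iUnion_le _ _)
    _ ≤ ∑' i : ℕ, geomConst (n + 1) * 2 ^ (n + 1) * ENNReal.ofReal (n * 6 ^ n) * M * 2⁻¹ ^ i :=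
        ENNReal.tsum_le_tsum hpt
    _ = _ := by
        rw [ENNReal.tsum_mul_left, ENNReal.tsum_geometric, ENNReal.one_sub_inv_two, inv_inv,
          oscConst]
        ring

/-- The constant in the weak type (1,1) bound for the grand maximal operator. -/
noncomputable def grandConst (n : ℕ) : ℝ≥0∞ :=
  3 * (5 ^ n * (1 + oscConst n + 2 * (weakConst n * 3 ^ n)) + 3 * 5 ^ n * weakConst n)

lemma grandConst_ne_top (n : ℕ) : grandConst n ≠ ⊤ := by
  have h1 := oscConst_ne_top n
  have h2 := weakConst_ne_top n
  have h3 : weakConst n * 3 ^ n ≠ ⊤ := ENNReal.mul_ne_top h2 (by simp)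
  have h4 : 2 * (weakConst n * 3 ^ n) ≠ ⊤ := ENNReal.mul_ne_top (by simp) h3
  have h5 : 3 * 5 ^ n * weakConst n ≠ ⊤ :=
    ENNReal.mul_ne_top (ENNReal.mul_ne_top (by simp) (by simp)) h2
  have h6 : 5 ^ n * (1 + oscConst n + 2 * (weakConst n * 3 ^ n)) ≠ ⊤ :=
    ENNReal.mul_ne_top (by simp) (by simp [h1, h4])
  exact ENNReal.mul_ne_top (by simp) (by simp [h5, h6])

/-- A Cotlar-type argument. If x is in neither set on the right, choose Q containing x and ξ in Q
with S(f χ_{(3Q)^c})(ξ) > 3s. Oscillation costs at most s, so this function exceeds 2s throughout Q,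
and by sublinearity Sf or S(f χ_{3Q}) exceeds s at every point of Q. The first can happen on at most
1/3 of Q, by the bound on the maximal function, and the second on at most 1/2, by the weak type
bound; together they do not fill Q. -/
lemma grandMaximal_subset (h : IsKernelFamily ψ 1) (hn : 1 ≤ n) {f : Rn n → ℂ} (hf : Integrable f)
    {s : ℝ≥0} (hs : s ≠ 0) : {x | 3 * (s : ℝ≥0∞) < grandMaximal (sqFn ψ) f x} ⊆
      {x | (s : ℝ≥0∞) < (1 + oscConst n + 2 * (weakConst n * 3 ^ n)) *
        hlMaximal (fun y => ‖f y‖ₑ) x} ∪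
      {x | 3⁻¹ < hlMaximal ({y | (s : ℝ≥0∞) < sqFn ψ f y}.indicator 1) x} := by
  intro x hx
  by_contra hcon
  simp only [Set.mem_union, Set.mem_ofPred_eq, not_or, not_lt] at hcon
  obtain ⟨hc1, hc2⟩ := hcon
  set M := hlMaximal (fun y => ‖f y‖ₑ) x
  have hs0 : (s : ℝ≥0∞) ≠ 0 := by exact_mod_cast hs
  have hst : (s : ℝ≥0∞) ≠ ⊤ := ENNReal.coe_ne_top
  have hM1 : oscConst n * M ≤ s := by
    refine le_trans ?_ hc1
    gcongr
    rw [add_comm 1, add_assoc]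
    exact le_self_add
  have hM2 : 2 * (weakConst n * 3 ^ n * M) ≤ s := by
    refine le_trans ?_ hc1
    rw [← mul_assoc]
    gcongr
    exact le_add_self
  have hx' : 3 * (s : ℝ≥0∞) < grandMaximal (sqFn ψ) f x := hx
  simp only [grandMaximal, lt_iSup_iff] at hx'
  obtain ⟨c, r, hr, hxQ, hess⟩ := hx'
  set G := (cube c (3 * r))ᶜ.indicator f with hG
  set H := (cube c (3 * r)).indicator f with hH
  have hGi : Integrable G := hf.indicator (measurableSet_cube _ _).compl
  have hHi : Integrable H := hf.indicator (measurableSet_cube _ _)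
  obtain ⟨ξ, hξ, hξs⟩ : ∃ ξ ∈ cube c r, 3 * (s : ℝ≥0∞) < sqFn ψ G ξ := by
    by_contra hno
    push Not at hno
    refine absurd hess (not_lt.2 (essSup_le_of_ae_le _ ?_))
    exact (ae_restrict_iff' (measurableSet_cube _ _)).2 (ae_of_all _ hno)
  have hall : ∀ y ∈ cube c r, (s : ℝ≥0∞) < sqFn ψ f y ∨ (s : ℝ≥0∞) < sqFn ψ H y := by
    intro y hy
    by_contra hno
    simp only [not_or, not_lt] at hno
    have h1 := h.sqFn_osc_le hn hf.locallyIntegrable hr hξ hy hxQ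
    have e : f + (-H) = G := by
      rw [← sub_eq_add_neg, sub_eq_iff_eq_add]
      exact (Set.indicator_compl_add_self _ _).symm
    have h2 := h.sqFn_add_le hf.locallyIntegrable hHi.neg.locallyIntegrable y
    rw [e, sqFn_neg] at h2
    refine absurd (hξs.trans_le h1) (not_lt.2 ?_)
    calc sqFn ψ G y + oscConst n * M ≤ (s + s) + s := by
          gcongr
          exact h2.trans (add_le_add hno.1 hno.2)
      _ = 3 * s := by ring
  set V := volume (cube c r) with hV
  have hV0 : V ≠ 0 := volume_cube_ne_zero c hr
  have hVt : V ≠ ⊤ := volume_cube_ne_top c hr.le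
  have hHs : 2 * volume {y | (s : ℝ≥0∞) < sqFn ψ H y} ≤ V := by
    have h1 := h.sqFn_weak hn hHi s
    have h2 : ∫⁻ y, ‖H y‖ₑ ≤ M * (3 ^ n * V) := by
      have e : ∫⁻ y, ‖H y‖ₑ = ∫⁻ y in cube c (3 * r), ‖f y‖ₑ := by
        rw [← lintegral_indicator (measurableSet_cube _ _)]
        exact lintegral_congr fun y => enorm_indicator_eq_indicator_enorm _ _
      have e2 : volume (cube c (3 * r)) = 3 ^ n * V := by
        rw [volume_cube_mul c c hr.le (by norm_num)]
        norm_num [hV]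
      rw [e, ← e2]
      exact lintegral_cube_le _ (by positivity) (cube_mono c (by linarith) hxQ)
    have h3 : (s : ℝ≥0∞) * (2 * volume {y | (s : ℝ≥0∞) < sqFn ψ H y}) ≤ s * V := by
      calc _ = 2 * (s * volume {y | (s : ℝ≥0∞) < sqFn ψ H y}) := by ring
        _ ≤ 2 * (weakConst n * (M * (3 ^ n * V))) := mul_le_mul' le_rfl (h1.trans (mul_le_mul' le_rfl h2))
        _ = 2 * (weakConst n * 3 ^ n * M) * V := by ring
        _ ≤ _ := by gcongr
    exact (ENNReal.mul_le_mul_iff_right hs0 hst).1 h3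
  have hSm : MeasurableSet {y | (s : ℝ≥0∞) < sqFn ψ f y} :=
    measurableSet_lt measurable_const (h.measurable_sqFn hf.locallyIntegrable)
  have hSf : volume ({y | (s : ℝ≥0∞) < sqFn ψ f y} ∩ cube c r) ≤ 3⁻¹ * V := by
    have h1 := (lintegral_cube_le ({y | (s : ℝ≥0∞) < sqFn ψ f y}.indicator 1) hr hxQ).trans
      (mul_le_mul' hc2 le_rfl)
    rwa [lintegral_indicator_one hSm, Measure.restrict_apply hSm] at h1
  have hQ : V ≤ 3⁻¹ * V + volume {y | (s : ℝ≥0∞) < sqFn ψ H y} := by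
    calc V ≤ volume ({y | (s : ℝ≥0∞) < sqFn ψ f y} ∩ cube c r ∪ {y | (s : ℝ≥0∞) < sqFn ψ H y}) := by
          refine measure_mono fun y hy => ?_
          rcases hall y hy with h1 | h1
          · exact Or.inl ⟨h1, hy⟩
          · exact Or.inr h1
      _ ≤ _ := (measure_union_le _ _).trans (by gcongr)
  have hfin : V + V ≤ 3⁻¹ * V + 3⁻¹ * V + V := by
    calc V + V ≤ (3⁻¹ * V + volume {y | (s : ℝ≥0∞) < sqFn ψ H y}) +
          (3⁻¹ * V + volume {y | (s : ℝ≥0∞) < sqFn ψ H y}) := add_le_add hQ hQ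
      _ = 3⁻¹ * V + 3⁻¹ * V + 2 * volume {y | (s : ℝ≥0∞) < sqFn ψ H y} := by ring
      _ ≤ _ := by gcongr
  have hfin2 : V ≤ 3⁻¹ * V + 3⁻¹ * V := (ENNReal.add_le_add_iff_right hVt).1 hfin
  have hfin3 : 3 * V ≤ 2 * V := by
    calc 3 * V ≤ 3 * (3⁻¹ * V + 3⁻¹ * V) := by gcongr
      _ = (3 * 3⁻¹) * (2 * V) := by ring
      _ = 2 * V := by rw [ENNReal.mul_inv_cancel (by simp) (by simp), one_mul]
  have := (ENNReal.mul_le_mul_iff_left hV0 hVt).1 hfin3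
  norm_num at this

theorem grandMaximal_weak (h : IsKernelFamily ψ 1) (hn : 1 ≤ n) {f : Rn n → ℂ} (hf : Integrable f)
    (t : ℝ≥0) : t * volume {x | (t : ℝ≥0∞) < grandMaximal (sqFn ψ) f x} ≤
      grandConst n * ∫⁻ x, ‖f x‖ₑ := by
  rcases eq_or_ne t 0 with rfl | ht
  · simp
  obtain ⟨s, rfl⟩ : ∃ s, t = 3 * s := ⟨t / 3, by field_simp⟩
  have hs : s ≠ 0 := right_ne_zero_of_mul ht
  push_cast
  set F := ∫⁻ x, ‖f x‖ₑ
  set D : ℝ≥0∞ := 1 + oscConst n + 2 * (weakConst n * 3 ^ n) with hD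
  have hD0 : D ≠ 0 := by rw [hD, add_assoc]; exact (lt_of_lt_of_le one_pos le_self_add).ne'
  have hDt : D ≠ ⊤ := by
    have h1 := oscConst_ne_top n
    have h4 : 2 * (weakConst n * 3 ^ n) ≠ ⊤ :=
      ENNReal.mul_ne_top (by simp) (ENNReal.mul_ne_top (weakConst_ne_top n) (by simp))
    simp [hD, h1, h4]
  have h1 : s * volume {x | (s : ℝ≥0∞) < D * hlMaximal (fun y => ‖f y‖ₑ) x} ≤ 5 ^ n * D * F := by
    have e : {x | (s : ℝ≥0∞) < D * hlMaximal (fun y => ‖f y‖ₑ) x} =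
        {x | (s : ℝ≥0∞) / D < hlMaximal (fun y => ‖f y‖ₑ) x} := by
      ext x
      simp only [Set.mem_ofPred_eq]
      rw [ENNReal.div_lt_iff (Or.inl hD0) (Or.inl hDt), mul_comm]
    rw [e]
    calc _ = D * (s / D * volume {x | (s : ℝ≥0∞) / D < hlMaximal (fun y => ‖f y‖ₑ) x}) := by
          rw [← mul_assoc, ENNReal.mul_div_cancel hD0 hDt]
      _ ≤ D * (5 ^ n * F) := mul_le_mul' le_rfl (hlMaximal_weak hn _ _)
      _ = _ := by ring
  have hSm : MeasurableSet {y | (s : ℝ≥0∞) < sqFn ψ f y} :=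
    measurableSet_lt measurable_const (h.measurable_sqFn hf.locallyIntegrable)
  have h2 : s * volume {x | 3⁻¹ < hlMaximal ({y | (s : ℝ≥0∞) < sqFn ψ f y}.indicator 1) x} ≤
      3 * 5 ^ n * weakConst n * F := by
    have h3 := hlMaximal_weak hn ({y | (s : ℝ≥0∞) < sqFn ψ f y}.indicator 1) 3⁻¹
    rw [lintegral_indicator_one hSm] at h3
    calc _ = 3 * s * (3⁻¹ * volume {x | 3⁻¹ <
            hlMaximal ({y | (s : ℝ≥0∞) < sqFn ψ f y}.indicator 1) x}) := by
          rw [mul_right_comm 3, ← mul_assoc 3, ENNReal.mul_inv_cancel (by simp) (by simp), one_mul,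
            mul_comm]
      _ ≤ 3 * s * (5 ^ n * volume {y | (s : ℝ≥0∞) < sqFn ψ f y}) := by gcongr
      _ = 3 * 5 ^ n * (s * volume {y | (s : ℝ≥0∞) < sqFn ψ f y}) := by ring
      _ ≤ 3 * 5 ^ n * (weakConst n * F) := mul_le_mul' le_rfl (h.sqFn_weak hn hf s)
      _ = _ := by ring
  calc _ ≤ 3 * s * (volume {x | (s : ℝ≥0∞) < D * hlMaximal (fun y => ‖f y‖ₑ) x} +
        volume {x | 3⁻¹ < hlMaximal ({y | (s : ℝ≥0∞) < sqFn ψ f y}.indicator 1) x}) := by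
        gcongr
        exact (measure_mono (h.grandMaximal_subset hn hf hs)).trans (measure_union_le _ _)
    _ = 3 * (s * volume {x | (s : ℝ≥0∞) < D * hlMaximal (fun y => ‖f y‖ₑ) x} +
        s * volume {x | 3⁻¹ < hlMaximal ({y | (s : ℝ≥0∞) < sqFn ψ f y}.indicator 1) x}) := by ring
    _ ≤ 3 * (5 ^ n * D * F + 3 * 5 ^ n * weakConst n * F) := by gcongr
    _ = _ := by rw [grandConst]; ring

end IsKernelFamily

end RoughSquare

namespace RoughSquare

/-! ### Sparse domination -/

variable {n : ℕ}

/-- The centre of a grid cube. -/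
noncomputable def gcenter (o : Fin n → ℝ) (ℓ : ℝ) (q : ℕ × (Fin n → ℤ)) : Rn n :=
  boxCenter (fun i => o i + gside ℓ q.1 * q.2 i) (gside ℓ q.1)

lemma gcube_subset_cube (o : Fin n → ℝ) (ℓ : ℝ) (q : ℕ × (Fin n → ℤ)) :
    gcube o ℓ q ⊆ cube (gcenter o ℓ q) (gside ℓ q.1 / 2) := hbox_subset_cube _ _

lemma tcube_ae_eq_cube (o : Fin n → ℝ) {ℓ : ℝ} (hℓ : 0 < ℓ) (q : ℕ × (Fin n → ℤ)) :
    tcube o ℓ q =ᵐ[volume] cube (gcenter o ℓ q) (3 * (gside ℓ q.1 / 2)) := by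
  have hs := gside_pos hℓ q.1
  have h := hbox_ae_eq_cube (fun i => o i + gside ℓ q.1 * (q.2 i - 1)) (s := 3 * gside ℓ q.1)
    (by positivity)
  have e : boxCenter (fun i => o i + gside ℓ q.1 * (q.2 i - 1)) (3 * gside ℓ q.1) =
      gcenter o ℓ q := by
    simp only [boxCenter, gcenter]
    congr 1
    ext i
    ring
  rw [e, mul_div_assoc] at h
  exact h

lemma tcube_subset_tcube {o : Fin n → ℝ} {ℓ : ℝ} (hℓ : 0 < ℓ) {p q : ℕ × (Fin n → ℤ)}
    (h : gcube o ℓ p ⊆ gcube o ℓ q) (hpq : q.1 ≤ p.1) : tcube o ℓ p ⊆ tcube o ℓ q := by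
  have hp := gside_pos hℓ p.1
  have hq := gside_pos hℓ q.1
  have hle : gside ℓ p.1 ≤ gside ℓ q.1 := by
    unfold gside
    gcongr
    norm_num
  intro x hx i
  have hx1 := hx i
  have hcorner : (WithLp.toLp 2 fun i => o i + gside ℓ p.1 * p.2 i : Rn n) ∈ gcube o ℓ p := by
    intro j
    simp only []
    constructor <;> linarith
  have h1 := (h hcorner i).1
  simp only [] at h1
  have hr : o i + gside ℓ p.1 * p.2 i + gside ℓ p.1 ≤ o i + gside ℓ q.1 * q.2 i + gside ℓ q.1 := by
    by_contra hcon
    push Not at hcon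
    -- The boxes are half-open, so upper corners cannot be tested. If the upper face of `p` stuck
    -- out, the point with i-th coordinate `m` would lie in `p` but not in `q`.
    set m := max (o i + gside ℓ p.1 * p.2 i) (o i + gside ℓ q.1 * q.2 i + gside ℓ q.1) with hm
    have hmem : (WithLp.toLp 2 fun j => if j = i then m else o j + gside ℓ p.1 * p.2 j : Rn n) ∈
        gcube o ℓ p := by
      intro j
      by_cases hj : j = i
      · subst hj
        simp only [if_true]
        exact ⟨le_max_left _ _, max_lt (by linarith) hcon⟩
      · simp only [hj, if_false]
        constructor <;> linarith
    have h2 := (h hmem i).2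
    simp only [if_true] at h2
    exact absurd h2 (not_lt.2 (le_max_right _ _))
  constructor <;> nlinarith [hx1.1, hx1.2]

namespace IsKernelFamily

variable {ψ : ℤ → Rn n → ℂ}

/-- The constant in the sparse domination. -/
noncomputable def domConst (n : ℕ) : ℝ≥0∞ := 2 ^ (n + 2) * (3 ^ n * (1 + weakConst n + grandConst n))

lemma domConst_ne_top (n : ℕ) : domConst n ≠ ⊤ := by
  have h1 := weakConst_ne_top n
  have h2 := grandConst_ne_top n
  exact ENNReal.mul_ne_top (by simp) (ENNReal.mul_ne_top (by simp) (by simp [h1, h2]))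

/-- The average of `|f|` over the threefold dilate of a grid cube. -/
noncomputable def tavg (o : Fin n → ℝ) (ℓ : ℝ) (f : Rn n → ℂ) (q : ℕ × (Fin n → ℤ)) : ℝ≥0∞ :=
  (∫⁻ y in tcube o ℓ q, ‖f y‖ₑ) / volume (tcube o ℓ q)

/-- The weak type bound at height D a with the average a divided out. For a = 0 the set {g > 0} is
null, as a countable union of level sets of measure zero. -/
lemma mul_measure_lt_le_of_weak {g : Rn n → ℝ≥0∞} {B a V D : ℝ≥0∞} (ha : a ≠ ⊤)
    (hDt : D ≠ ⊤) (hg : ∀ t : ℝ≥0, t * volume {x | (t : ℝ≥0∞) < g x} ≤ B * (a * V)) :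
    D * volume {x | D * a < g x} ≤ B * V := by
  rcases eq_or_ne a 0 with rfl | ha0
  · have : volume {x | D * 0 < g x} = 0 := by
      have hsub : {x | D * 0 < g x} ⊆ ⋃ k : ℕ, {x | (((k + 1 : ℝ≥0)⁻¹ : ℝ≥0) : ℝ≥0∞) < g x} := by
        intro x hx
        have hx' : 0 < g x := by simpa using hx
        obtain ⟨k, hk⟩ := ENNReal.exists_inv_nat_lt hx'.ne'
        refine Set.mem_iUnion.2 ⟨k, lt_of_le_of_lt ?_ hk⟩
        rw [ENNReal.coe_inv (by positivity)]
        push_cast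
        exact ENNReal.inv_le_inv.2 le_self_add
      refine measure_mono_null hsub (measure_iUnion_null fun k => ?_)
      have h1 := hg (k + 1 : ℝ≥0)⁻¹
      rw [zero_mul, mul_zero, nonpos_iff_eq_zero, mul_eq_zero] at h1
      refine h1.resolve_left ?_
      rw [ENNReal.coe_eq_zero]
      positivity
    rw [this, mul_zero]
    exact zero_le
  · have hDa : D * a ≠ ⊤ := ENNReal.mul_ne_top hDt ha
    have h1 := hg (D * a).toNNReal
    rw [ENNReal.coe_toNNReal hDa] at h1
    refine (ENNReal.mul_le_mul_iff_right ha0 ha).1 ?_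
    calc _ = D * a * volume {x | D * a < g x} := by ring
      _ ≤ _ := h1
      _ = _ := by ring

/-- One step of the sparse domination. -/
theorem exists_children (h : IsKernelFamily ψ 1) (hn : 1 ≤ n) {f : Rn n → ℂ}
    (hf : LocallyIntegrable f) (o : Fin n → ℝ) {ℓ : ℝ} (hℓ : 0 < ℓ) (q : ℕ × (Fin n → ℤ)) :
    ∃ P : Set (ℕ × (Fin n → ℤ)), (∀ p ∈ P, q.1 < p.1 ∧ gcube o ℓ p ⊆ gcube o ℓ q) ∧
      P.PairwiseDisjoint (gcube o ℓ) ∧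
      2 * volume (⋃ p ∈ P, gcube o ℓ p) ≤ volume (gcube o ℓ q) ∧
      (∀ᵐ x, x ∈ gcube o ℓ q → x ∉ ⋃ p ∈ P, gcube o ℓ p →
        sqFn ψ ((tcube o ℓ q).indicator f) x ≤ domConst n * tavg o ℓ f q) ∧
      ∀ p ∈ P, ∀ᵐ x, x ∈ gcube o ℓ p → sqFn ψ ((tcube o ℓ q).indicator f) x ≤
        domConst n * tavg o ℓ f q + sqFn ψ ((tcube o ℓ p).indicator f) x := by
  set F := (tcube o ℓ q).indicator f with hF
  set a := tavg o ℓ f q with ha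
  set D := domConst n with hD
  set V := volume (gcube o ℓ q) with hV
  have hV0 : V ≠ 0 := volume_gcube_ne_zero hℓ q
  have hVt : V ≠ ⊤ := volume_gcube_ne_top hℓ q
  have htm : ∀ q, MeasurableSet (tcube o ℓ q) := fun q => measurableSet_hbox _ _
  have hgm : ∀ q, MeasurableSet (gcube o ℓ q) := fun q => measurableSet_hbox _ _
  have hTV : volume (tcube o ℓ q) = 3 ^ n * V := volume_tcube hℓ q
  have hT0 : volume (tcube o ℓ q) ≠ 0 := by rw [hTV]; simp [hV0]
  have hTt : volume (tcube o ℓ q) ≠ ⊤ := by rw [hTV]; exact ENNReal.mul_ne_top (by simp) hVt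
  have hfT : ∀ q, IntegrableOn f (tcube o ℓ q) := by
    intro q
    have hb : tcube o ℓ q ⊆ Metric.closedBall (gcenter o ℓ q) (n * (3 * gside ℓ q.1)) := by
      intro x hx
      rw [Metric.mem_closedBall, dist_eq_norm]
      have hs := gside_pos hℓ q.1
      refine norm_le_of_abs_le hn fun i => ?_
      have := hx i
      simp only [gcenter, boxCenter, PiLp.sub_apply]
      rw [abs_le]
      constructor <;> nlinarith [this.1, this.2]
    exact (hf.integrableOn_isCompact (isCompact_closedBall _ _)).mono_set hb
  have hFi : ∀ q, Integrable ((tcube o ℓ q).indicator f) := fun q =>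
    (integrable_indicator_iff (htm q)).2 (hfT q)
  have hFnorm : ∫⁻ x, ‖F x‖ₑ = a * (3 ^ n * V) := by
    have e : ∫⁻ y, ‖F y‖ₑ = ∫⁻ y in tcube o ℓ q, ‖f y‖ₑ := by
      rw [← lintegral_indicator (htm q)]
      exact lintegral_congr fun y => enorm_indicator_eq_indicator_enorm _ _
    rw [e, ha, tavg, ← hTV, ENNReal.div_mul_cancel hT0 hTt]
  have hat : a ≠ ⊤ := ENNReal.div_ne_top (hfT q).2.ne hT0
  -- The exceptional set. The constant `domConst` is chosen so that its measure is at most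
  -- 2^{-(n+2)} times that of the cube.
  set E := {x | D * a < sqFn ψ F x} ∪ {x | D * a < grandMaximal (sqFn ψ) F x} with hE
  have hEvol : 2 ^ (n + 2) * volume E ≤ V := by
    have h1 := mul_measure_lt_le_of_weak (g := sqFn ψ F) (B := weakConst n) (V := 3 ^ n * V) hat
      (domConst_ne_top n) (by rw [← hFnorm]; exact h.sqFn_weak hn (hFi q))
    have h2 := mul_measure_lt_le_of_weak (g := grandMaximal (sqFn ψ) F) (B := grandConst n)
      (V := 3 ^ n * V) hat (domConst_ne_top n)
      (by rw [← hFnorm]; exact h.grandMaximal_weak hn (hFi q))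
    set K : ℝ≥0∞ := 3 ^ n * (1 + weakConst n + grandConst n) with hK
    have hK0 : K ≠ 0 := by simp [hK]
    have hKt : K ≠ ⊤ := ENNReal.mul_ne_top (by simp)
      (by simp [weakConst_ne_top n, grandConst_ne_top n])
    refine (ENNReal.mul_le_mul_iff_right hK0 hKt).1 ?_
    calc K * (2 ^ (n + 2) * volume E) = D * volume E := by rw [hD, domConst]; ring
      _ ≤ D * (volume {x | D * a < sqFn ψ F x} + volume {x | D * a < grandMaximal (sqFn ψ) F x}) :=
          mul_le_mul' le_rfl (measure_union_le _ _)
      _ ≤ weakConst n * (3 ^ n * V) + grandConst n * (3 ^ n * V) := by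
          rw [mul_add]; exact add_le_add h1 h2
      _ ≤ weakConst n * (3 ^ n * V) + grandConst n * (3 ^ n * V) + 3 ^ n * V := le_self_add
      _ = K * V := by rw [hK]; ring
  -- Passing to a measurable hull avoids any measurability question for the grand maximal operator.
  set E' := toMeasurable volume E ∩ gcube o ℓ q with hE'
  have hE'm : MeasurableSet E' := (measurableSet_toMeasurable _ _).inter (hgm q)
  have hE'vol : 2 ^ (n + 2) * volume E' ≤ V := by
    refine le_trans (mul_le_mul' le_rfl ?_) hEvol
    exact (measure_mono Set.inter_subset_left).trans (measure_toMeasurable E).le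
  have hEE' : ∀ x ∈ gcube o ℓ q, x ∉ E' → x ∉ E := fun x hx hx' hxE =>
    hx' ⟨subset_toMeasurable _ _ hxE, hx⟩
  -- Height 2^{-(n+1)}. The cubes of the starting generation are not bad, by the size of `E'`. The
  -- selected cubes have total measure at most 2^{n+1}|E'|, hence at most half of the cube. And `E'`
  -- fills at most 2^n·2^{-(n+1)} = 1/2 of each selected cube, which therefore contains a point
  -- outside `E'`.
  set τ : ℝ≥0 := (2 ^ (n + 1))⁻¹ with hτ
  have hτe : (τ : ℝ≥0∞) = (2 ^ (n + 1))⁻¹ := by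
    rw [hτ, ENNReal.coe_inv (by positivity)]; push_cast; rfl
  have hpow0 : (2 : ℝ≥0∞) ^ (n + 1) ≠ 0 := by simp
  have hpowt : (2 : ℝ≥0∞) ^ (n + 1) ≠ ⊤ := by simp
  have hind : ∀ A, MeasurableSet A → ∫⁻ x in A, E'.indicator 1 x = volume (E' ∩ A) := by
    intro A hA
    rw [lintegral_indicator_one hE'm, Measure.restrict_apply hE'm]
  obtain ⟨P, hPlev, hPd, hPlt, hPle, hPae⟩ := calderon_zygmund (o := o) (h := E'.indicator 1) hℓ
    (measurable_one.indicator hE'm)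
    (by
      rw [lintegral_indicator_one hE'm]
      exact ((measure_mono Set.inter_subset_right).trans_lt hVt.lt_top).ne) τ q.1
    (fun m => by
      rw [hind _ (hgm _), hτe]
      have : volume (gcube o ℓ (q.1, m)) = V := by rw [hV, volume_gcube hℓ, volume_gcube hℓ]
      rw [this]
      refine (measure_mono Set.inter_subset_left).trans ?_
      refine (ENNReal.mul_le_mul_iff_right hpow0 hpowt).1 ?_
      rw [← mul_assoc, ENNReal.mul_inv_cancel hpow0 hpowt, one_mul]
      refine le_trans ?_ hE'vol
      gcongr
      · norm_num
      · norm_num)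
  have hPlt' : ∀ p ∈ P, volume (gcube o ℓ p) < 2 ^ (n + 1) * volume (E' ∩ gcube o ℓ p) := by
    intro p hp
    have h1 := hPlt p hp
    rw [hind _ (hgm p), hτe] at h1
    have h2 := (ENNReal.mul_lt_mul_iff_right hpow0 hpowt).2 h1
    rwa [← mul_assoc, ENNReal.mul_inv_cancel hpow0 hpowt, one_mul] at h2
  have hPsub : ∀ p ∈ P, gcube o ℓ p ⊆ gcube o ℓ q := by
    intro p hp
    have h1 : volume (E' ∩ gcube o ℓ p) ≠ 0 := by
      intro h0
      have := hPlt' p hp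
      rw [h0, mul_zero] at this
      exact absurd this (not_lt.2 zero_le)
    obtain ⟨x, hx1, hx2⟩ := nonempty_of_measure_ne_zero h1
    exact gcube_nested hℓ (hPlev p hp).le hx1.2 hx2
  refine ⟨P, fun p hp => ⟨hPlev p hp, hPsub p hp⟩, hPd, ?_, ?_, ?_⟩
  · rw [measure_biUnion (Set.to_countable P) hPd fun p _ => hgm p]
    calc 2 * ∑' p : P, volume (gcube o ℓ p) ≤
          2 * ∑' p : P, 2 ^ (n + 1) * volume (E' ∩ gcube o ℓ p) := by
          gcongr with p
          exact (hPlt' p.1 p.2).le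
      _ = 2 ^ (n + 2) * ∑' p : P, volume (E' ∩ gcube o ℓ p) := by
          rw [ENNReal.tsum_mul_left]; ring
      _ ≤ 2 ^ (n + 2) * volume E' := by
          gcongr
          have hdis : P.PairwiseDisjoint fun p => E' ∩ gcube o ℓ p := fun p hp p' hp' hne =>
            (hPd hp hp' hne).mono Set.inter_subset_right Set.inter_subset_right
          rw [← measure_biUnion (Set.to_countable P) hdis
            fun p _ => hE'm.inter (hgm p)]
          exact measure_mono (Set.iUnion₂_subset fun p _ => Set.inter_subset_left)
      _ ≤ V := hE'vol
  · filter_upwards [hPae] with x hx hxq hxP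
    have h1 := hx hxP
    have hxE' : x ∉ E' := by
      intro hxE
      rw [Set.indicator_of_mem hxE, hτe, Pi.one_apply] at h1
      have : (1 : ℝ≥0∞) < 2 ^ (n + 1) := one_lt_pow₀ (by norm_num) (by omega)
      exact absurd h1 (not_le.2 (ENNReal.inv_lt_one.2 this))
    have := hEE' x hxq hxE'
    simp only [hE, Set.mem_union, Set.mem_ofPred_eq, not_or, not_lt] at this
    exact this.1
  · intro p hp
    -- At such a point the grand maximal operator is at most D a. Tested on the closed cube of `p`,
    -- this bounds the square function of the part of `F` off the dilate of `p`, almost everywhere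
    -- on `p`.
    obtain ⟨z, hz, hzE⟩ : ∃ z ∈ gcube o ℓ p, z ∉ E' := by
      by_contra hno
      push Not at hno
      have h1 := hPle p hp
      rw [hind _ (hgm p), Set.inter_eq_right.2 hno, hτe] at h1
      have e : (2 : ℝ≥0∞) ^ n * (2 ^ (n + 1))⁻¹ = 2⁻¹ := by
        rw [pow_succ, ENNReal.mul_inv (by simp) (by simp), ← mul_assoc,
          ENNReal.mul_inv_cancel (by simp) (by simp), one_mul]
      rw [e] at h1
      have h2 := volume_gcube_ne_zero hℓ p (o := o)
      have h3 := volume_gcube_ne_top hℓ p (o := o)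
      have h4 : (1 : ℝ≥0∞) ≤ 2⁻¹ := (ENNReal.mul_le_mul_iff_left h2 h3).1 (by rwa [one_mul])
      exact absurd h4 (not_le.2 ENNReal.one_half_lt_one)
    have hzM : grandMaximal (sqFn ψ) F z ≤ D * a := by
      have := hEE' z (hPsub p hp hz) hzE
      simp only [hE, Set.mem_union, Set.mem_ofPred_eq, not_or, not_lt] at this
      exact this.2
    set c := gcenter o ℓ p
    set r := gside ℓ p.1 / 2 with hr
    have hr0 : 0 < r := half_pos (gside_pos hℓ _)
    have hess : essSup (sqFn ψ ((cube c (3 * r))ᶜ.indicator F)) (volume.restrict (cube c r)) ≤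
        D * a := by
      refine le_trans ?_ hzM
      exact le_iSup_of_le c (le_iSup_of_le r (le_iSup_of_le hr0
        (le_iSup_of_le (gcube_subset_cube o ℓ p hz) le_rfl)))
    have hae := ENNReal.ae_le_essSup (μ := volume.restrict (cube c r))
      (sqFn ψ ((cube c (3 * r))ᶜ.indicator F))
    rw [ae_restrict_iff' (measurableSet_cube _ _)] at hae
    filter_upwards [hae] with x hx hxp
    have h1 := (hx (gcube_subset_cube o ℓ p hxp)).trans hess
    have e1 : sqFn ψ ((cube c (3 * r))ᶜ.indicator F) = sqFn ψ ((tcube o ℓ p)ᶜ.indicator F) :=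
      sqFn_congr (indicator_ae_eq_of_ae_eq_set (tcube_ae_eq_cube o hℓ p).symm.compl)
    have e2 : (tcube o ℓ p)ᶜ.indicator F + (tcube o ℓ p).indicator f = F := by
      have : (tcube o ℓ p).indicator f = (tcube o ℓ p).indicator F := by
        rw [hF, Set.indicator_indicator,
          Set.inter_eq_left.2 (tcube_subset_tcube hℓ (hPsub p hp) (hPlev p hp).le)]
      rw [this]
      exact Set.indicator_compl_add_self _ _
    have h2 := h.sqFn_add_le ((hFi q).indicator (htm p).compl).locallyIntegrable
      (hFi p).locallyIntegrable x
    rw [e2] at h2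
    rw [e1] at h1
    exact h2.trans (add_le_add h1 le_rfl)

end IsKernelFamily

end RoughSquare

/-! ### Iteration along the tree of selected cubes. -/

namespace RoughSquare

variable {n : ℕ}

/-- The generations of a tree with children `P`. -/
def generation {I : Type*} (P : I → Set I) (q₀ : I) : ℕ → Set I
  | 0 => {q₀}
  | k + 1 => ⋃ q ∈ generation P q₀ k, P q

section generation

variable {I X : Type*} {P : I → Set I} {q₀ : I} {D : I → Set X}

lemma mem_generation_succ {k : ℕ} {p : I} :
    p ∈ generation P q₀ (k + 1) ↔ ∃ q ∈ generation P q₀ k, p ∈ P q := by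
  simp [generation]

lemma generation_pairwiseDisjoint (hsub : ∀ q, ∀ p ∈ P q, D p ⊆ D q)
    (hd : ∀ q, (P q).PairwiseDisjoint D) (k : ℕ) : (generation P q₀ k).PairwiseDisjoint D := by
  induction k with
  | zero => simp [generation]
  | succ k ih =>
    intro p hp p' hp' hne
    obtain ⟨q, hq, hpq⟩ := mem_generation_succ.1 hp
    obtain ⟨q', hq', hpq'⟩ := mem_generation_succ.1 hp'
    by_cases hqq : q = q'
    · subst hqq
      exact hd q hpq hpq' hne
    · exact (ih hq hq' hqq).mono (hsub q p hpq) (hsub q' p' hpq')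

lemma exists_ancestor (hsub : ∀ q, ∀ p ∈ P q, D p ⊆ D q) {k d : ℕ} {r : I}
    (hr : r ∈ generation P q₀ (k + d + 1)) :
    ∃ q ∈ generation P q₀ k, ∃ p ∈ P q, D r ⊆ D p := by
  induction d generalizing r with
  | zero =>
    obtain ⟨q, hq, hrq⟩ := mem_generation_succ.1 hr
    exact ⟨q, hq, r, hrq, subset_rfl⟩
  | succ d ih =>
    obtain ⟨q, hq, hrq⟩ := mem_generation_succ.1 hr
    obtain ⟨q', hq', p, hp, hqp⟩ := ih hq
    exact ⟨q', hq', p, hp, (hsub q r hrq).trans hqp⟩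

/-- A member of a later generation lies inside a child of a member of each earlier one, so it misses
what remains of that generation after the children are removed. Within one generation the sets
themselves are disjoint. These remainders witness sparseness. -/
lemma generation_diff_pairwiseDisjoint (hsub : ∀ q, ∀ p ∈ P q, D p ⊆ D q)
    (hd : ∀ q, (P q).PairwiseDisjoint D) :
    (⋃ k, generation P q₀ k).PairwiseDisjoint fun q => D q \ ⋃ p ∈ P q, D p := by
  have key : ∀ k d q r x, q ∈ generation P q₀ k → r ∈ generation P q₀ (k + d + 1) →
      x ∈ D q \ (⋃ p ∈ P q, D p) → x ∈ D r → False := by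
    intro k d q r x hq hr hxq hxr
    obtain ⟨q', hq', p, hp, hrp⟩ := exists_ancestor hsub hr
    have hqq : q = q' := by
      by_contra hne
      exact Set.disjoint_left.1 (generation_pairwiseDisjoint hsub hd k hq hq' hne) hxq.1
        (hsub q' p hp (hrp hxr))
    subst hqq
    exact hxq.2 (Set.mem_biUnion hp (hrp hxr))
  intro q hq r hr hne
  obtain ⟨k, hk⟩ := Set.mem_iUnion.1 hq
  obtain ⟨j, hj⟩ := Set.mem_iUnion.1 hr
  rw [Function.onFun, Set.disjoint_left]
  intro x hxq hxr
  rcases lt_trichotomy k j with hlt | rfl | hlt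
  · obtain ⟨d, rfl⟩ := Nat.exists_eq_add_of_lt hlt
    exact key k d q r x hk hj hxq hxr.1
  · exact Set.disjoint_left.1 (generation_pairwiseDisjoint hsub hd k hk hj hne) hxq.1 hxr.1
  · obtain ⟨d, rfl⟩ := Nat.exists_eq_add_of_lt hlt
    exact key j d r q x hj hk hxr hxq.1

lemma measure_generation_le [MeasurableSpace X] {μ : Measure X} [Countable I]
    (hm : ∀ q, MeasurableSet (D q)) (hsub : ∀ q, ∀ p ∈ P q, D p ⊆ D q)
    (hd : ∀ q, (P q).PairwiseDisjoint D) (hμ : ∀ q, 2 * μ (⋃ p ∈ P q, D p) ≤ μ (D q)) (k : ℕ) :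
    2 ^ k * μ (⋃ q ∈ generation P q₀ k, D q) ≤ μ (D q₀) := by
  induction k with
  | zero => simp [generation]
  | succ k ih =>
    refine le_trans ?_ ih
    have e : ⋃ q ∈ generation P q₀ (k + 1), D q =
        ⋃ q ∈ generation P q₀ k, ⋃ p ∈ P q, D p := by
      ext x
      simp only [Set.mem_iUnion, exists_prop, mem_generation_succ]
      constructor
      · rintro ⟨p, ⟨q, hq, hp⟩, hx⟩
        exact ⟨q, hq, p, hp, hx⟩
      · rintro ⟨q, hq, p, hp, hx⟩
        exact ⟨p, ⟨q, hq, hp⟩, hx⟩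
    rw [e, pow_succ, mul_assoc]
    refine mul_le_mul' le_rfl ?_
    rw [measure_biUnion (Set.to_countable _) (generation_pairwiseDisjoint hsub hd k) fun q _ => hm q]
    refine (mul_le_mul' le_rfl (measure_biUnion_le μ (Set.to_countable _) _)).trans ?_
    rw [← ENNReal.tsum_mul_left]
    exact ENNReal.tsum_le_tsum fun q => hμ q.1

/-- Each generation has at most half the measure of the previous bound, so the points in all
generations form a null set and almost every branch terminates. -/
lemma ae_exists_notMem_generation [MeasurableSpace X] {μ : Measure X} [Countable I]
    (hm : ∀ q, MeasurableSet (D q)) (hsub : ∀ q, ∀ p ∈ P q, D p ⊆ D q)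
    (hd : ∀ q, (P q).PairwiseDisjoint D) (hμ : ∀ q, 2 * μ (⋃ p ∈ P q, D p) ≤ μ (D q))
    (hfin : μ (D q₀) ≠ ⊤) : ∀ᵐ x ∂μ, ∃ k, x ∉ ⋃ q ∈ generation P q₀ k, D q := by
  have h0 : μ {x | ∀ k, x ∈ ⋃ q ∈ generation P q₀ k, D q} = 0 := by
    have hle : ∀ k : ℕ, μ {x | ∀ k, x ∈ ⋃ q ∈ generation P q₀ k, D q} ≤ μ (D q₀) * 2⁻¹ ^ k := by
      intro k
      have h1 := measure_generation_le (q₀ := q₀) hm hsub hd hμ k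
      have h2 : μ {x | ∀ k, x ∈ ⋃ q ∈ generation P q₀ k, D q} ≤
          μ (⋃ q ∈ generation P q₀ k, D q) := measure_mono fun x hx => hx k
      refine h2.trans ?_
      rw [← ENNReal.inv_pow, ← div_eq_mul_inv, ENNReal.le_div_iff_mul_le (Or.inl (by simp))
        (Or.inl (by simp)), mul_comm]
      exact h1
    have hlim : Tendsto (fun k : ℕ => μ (D q₀) * 2⁻¹ ^ k) atTop (𝓝 (μ (D q₀) * 0)) :=
      ENNReal.Tendsto.const_mul
        (ENNReal.tendsto_pow_atTop_nhds_zero_of_lt_one (by simp)) (Or.inr hfin)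
    rw [mul_zero] at hlim
    exact le_antisymm (ge_of_tendsto' hlim hle) zero_le
  rw [ae_iff]
  simpa using h0

end generation

lemma tsum_indicator_add_le {I : Type*} {A B : Set I} {q : I} (hAB : A ⊆ B) (hqB : q ∈ B)
    (hqA : q ∉ A) (u : I → ℝ≥0∞) : ∑' i, A.indicator u i + u q ≤ ∑' i, B.indicator u i := by
  classical
  rw [← tsum_pi_single q (u q), ← ENNReal.tsum_add]
  refine ENNReal.tsum_le_tsum fun i => ?_
  by_cases hi : i = q
  · subst hi
    rw [Pi.single_eq_same, Set.indicator_of_notMem hqA, Set.indicator_of_mem hqB, zero_add]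
  · rw [Pi.single_eq_of_ne hi, add_zero]
    exact Set.indicator_le_indicator_of_subset hAB (fun _ => zero_le) i

namespace IsKernelFamily

variable {ψ : ℤ → Rn n → ℂ}

/-- Sparse domination of the square function. -/
theorem sparse_domination (h : IsKernelFamily ψ 1) (hn : 1 ≤ n) {f : Rn n → ℂ}
    (hf : LocallyIntegrable f) (o : Fin n → ℝ) {ℓ : ℝ} (hℓ : 0 < ℓ) (q₀ : ℕ × (Fin n → ℤ)) :
    ∃ (G : Set (ℕ × (Fin n → ℤ))) (E : ℕ × (Fin n → ℤ) → Set (Rn n)),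
      (∀ q, MeasurableSet (E q)) ∧ (∀ q, E q ⊆ gcube o ℓ q) ∧
      (∀ q, volume (gcube o ℓ q) ≤ 2 * volume (E q)) ∧ G.PairwiseDisjoint E ∧
      ∀ᵐ x, x ∈ gcube o ℓ q₀ → sqFn ψ ((tcube o ℓ q₀).indicator f) x ≤ domConst n *
        ∑' q, G.indicator (fun q => (gcube o ℓ q).indicator (fun _ => tavg o ℓ f q) x) q := by
  choose P hPsub hPd hPvol hPae hPae' using fun q => h.exists_children hn hf o hℓ q
  have hgm : ∀ q, MeasurableSet (gcube o ℓ q) := fun q => measurableSet_hbox _ _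
  have hsub : ∀ q, ∀ p ∈ P q, gcube o ℓ p ⊆ gcube o ℓ q := fun q p hp => (hPsub q p hp).2
  have hUm : ∀ q, MeasurableSet (⋃ p ∈ P q, gcube o ℓ p) := fun q =>
    MeasurableSet.biUnion (Set.to_countable _) fun p _ => hgm p
  set G := ⋃ k, generation P q₀ k with hG
  refine ⟨G, fun q => gcube o ℓ q \ ⋃ p ∈ P q, gcube o ℓ p, fun q => (hgm q).diff (hUm q),
    fun q => Set.sdiff_subset, fun q => ?_, generation_diff_pairwiseDisjoint hsub hPd, ?_⟩
  · set V := volume (gcube o ℓ q)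
    set U := ⋃ p ∈ P q, gcube o ℓ p
    have hVt : V ≠ ⊤ := volume_gcube_ne_top hℓ q
    have h1 : V ≤ volume (gcube o ℓ q \ U) + volume U := by
      refine (measure_mono ?_).trans (measure_union_le _ _)
      intro x hx
      by_cases hxU : x ∈ U
      · exact Or.inr hxU
      · exact Or.inl ⟨hx, hxU⟩
    have h2 : V + V ≤ 2 * volume (gcube o ℓ q \ U) + V := by
      calc V + V = 2 * V := (two_mul V).symm
        _ ≤ 2 * (volume (gcube o ℓ q \ U) + volume U) := by gcongr
        _ = 2 * volume (gcube o ℓ q \ U) + 2 * volume U := mul_add _ _ _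
        _ ≤ _ := add_le_add le_rfl (hPvol q)
    exact (ENNReal.add_le_add_iff_right hVt).1 h2
  · have h1 := ae_exists_notMem_generation (q₀ := q₀) (μ := volume) hgm hsub hPd hPvol
      (volume_gcube_ne_top hℓ q₀)
    have h2 := ae_all_iff.2 fun q => hPae q
    have h3 := ae_all_iff.2 fun q => (ae_ball_iff (Set.to_countable (P q))).2 (hPae' q)
    filter_upwards [h1, h2, h3] with x hx1 hx2 hx3 hxq₀
    set u : ℕ × (Fin n → ℤ) → ℝ≥0∞ := fun q =>
      (gcube o ℓ q).indicator (fun _ => tavg o ℓ f q) x with hu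
    have huq : ∀ q, x ∈ gcube o ℓ q → u q = tavg o ℓ f q := fun q hq => Set.indicator_of_mem hq _
    -- Telescoping down the branch of x. The sum collected so far runs over members strictly coarser
    -- than `q`; a child has a strictly larger generation index, so `q` is a new index when its
    -- average is added.
    have chain : ∀ k, ∀ q ∈ generation P q₀ k, x ∈ gcube o ℓ q →
        sqFn ψ ((tcube o ℓ q₀).indicator f) x ≤
          domConst n * (∑' p, {p | p ∈ G ∧ p.1 < q.1}.indicator u p) +
            sqFn ψ ((tcube o ℓ q).indicator f) x := by
      intro k
      induction k with
      | zero =>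
        intro q hq _
        obtain rfl : q = q₀ := hq
        exact le_add_self
      | succ k ih =>
        intro p hp hxp
        obtain ⟨q, hq, hpq⟩ := mem_generation_succ.1 hp
        have hxq := hsub q p hpq hxp
        refine (ih q hq hxq).trans ?_
        refine (add_le_add le_rfl (hx3 q p hpq hxp)).trans ?_
        rw [← add_assoc, ← mul_add, ← huq q hxq]
        refine add_le_add (mul_le_mul' le_rfl ?_) le_rfl
        refine tsum_indicator_add_le ?_ ?_ ?_ u
        · exact fun r hr => ⟨hr.1, hr.2.trans (hPsub q p hpq).1⟩
        · exact ⟨Set.mem_iUnion.2 ⟨k, hq⟩, (hPsub q p hpq).1⟩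
        · exact fun hcon => lt_irrefl _ hcon.2
    classical
    have hpos : Nat.find hx1 ≠ 0 := by
      intro h0
      have := Nat.find_spec hx1
      rw [h0] at this
      exact this (by simpa [generation] using hxq₀)
    obtain ⟨k, hk⟩ := Nat.exists_eq_succ_of_ne_zero hpos
    have hin : x ∈ ⋃ q ∈ generation P q₀ k, gcube o ℓ q := by
      by_contra hcon
      exact Nat.find_min hx1 (by omega : k < Nat.find hx1) hcon
    have hout := Nat.find_spec hx1
    rw [hk] at hout
    obtain ⟨q, hq, hxq⟩ := Set.mem_iUnion₂.1 hin
    have hxP : x ∉ ⋃ p ∈ P q, gcube o ℓ p := by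
      intro hcon
      obtain ⟨p, hp, hxp⟩ := Set.mem_iUnion₂.1 hcon
      exact hout (Set.mem_biUnion (mem_generation_succ.2 ⟨q, hq, hp⟩) hxp)
    refine (chain k q hq hxq).trans ?_
    refine (add_le_add le_rfl (hx2 q hxq hxP)).trans ?_
    rw [← mul_add, ← huq q hxq]
    refine mul_le_mul' le_rfl (tsum_indicator_add_le ?_ ?_ ?_ u)
    · exact fun r hr => hr.1
    · exact Set.mem_iUnion.2 ⟨k, hq⟩
    · exact fun hcon => lt_irrefl _ hcon.2

end IsKernelFamily

end RoughSquare

namespace RoughSquare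

/-! ### Weighted bounds for sparse operators -/

variable {n : ℕ}

lemma hlMaximal_congr {g g' : Rn n → ℝ≥0∞} (h : g =ᵐ[volume] g') : hlMaximal g = hlMaximal g' := by
  ext x
  have : ∀ A : Set (Rn n), ∫⁻ y in A, g y = ∫⁻ y in A, g' y := fun A =>
    lintegral_congr_ae (ae_restrict_of_ae h)
  simp only [hlMaximal, this]

/-- Positive weights which are integrable over cubes. -/
structure IsWeight (v : Rn n → ℝ≥0∞) : Prop where
  meas : Measurable v
  pos : ∀ x, v x ≠ 0
  fin : ∀ c r, ∫⁻ x in cube c r, v x ≠ ⊤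

section carleson

variable {o : Fin n → ℝ} {ℓ : ℝ} {E : ℕ × (Fin n → ℤ) → Set (Rn n)} {T : Finset (ℕ × (Fin n → ℤ))}

lemma measurableSet_tcube (o : Fin n → ℝ) (ℓ : ℝ) (q : ℕ × (Fin n → ℤ)) :
    MeasurableSet (tcube o ℓ q) := measurableSet_hbox _ _

lemma volume_tcube_ne_zero (hℓ : 0 < ℓ) (q : ℕ × (Fin n → ℤ)) : volume (tcube o ℓ q) ≠ 0 := by
  rw [volume_tcube hℓ]
  exact mul_ne_zero (by simp) (volume_gcube_ne_zero hℓ q)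

lemma volume_tcube_ne_top (hℓ : 0 < ℓ) (q : ℕ × (Fin n → ℤ)) : volume (tcube o ℓ q) ≠ ⊤ := by
  rw [volume_tcube hℓ]
  exact ENNReal.mul_ne_top (by simp) (volume_gcube_ne_top hℓ q)

lemma IsWeight.tcube_ne_top {v : Rn n → ℝ≥0∞} (hv : IsWeight v) (hℓ : 0 < ℓ)
    (q : ℕ × (Fin n → ℤ)) : ∫⁻ x in tcube o ℓ q, v x ≠ ⊤ := by
  rw [setLIntegral_congr (tcube_ae_eq_cube o hℓ q)]
  exact hv.fin _ _

lemma IsWeight.setLIntegral_ne_zero {v : Rn n → ℝ≥0∞} (hv : IsWeight v) {A : Set (Rn n)}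
    (hA : volume A ≠ 0) : ∫⁻ x in A, v x ≠ 0 := by
  intro h0
  rw [lintegral_eq_zero_iff hv.meas] at h0
  have : volume.restrict A Set.univ = 0 := by
    rw [Filter.EventuallyEq, ae_iff] at h0
    convert h0 using 2
    ext x
    simpa using hv.pos x
  rw [Measure.restrict_apply_univ] at this
  exact hA this

lemma sum_volume_tcube_le (hℓ : 0 < ℓ) (hEm : ∀ q, MeasurableSet (E q))
    (hEsub : ∀ q, E q ⊆ gcube o ℓ q)
    (hE : ∀ q, volume (gcube o ℓ q) ≤ 2 * volume (E q))
    (hd : (T : Set (ℕ × (Fin n → ℤ))).PairwiseDisjoint E) {R : Set (Rn n)}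
    (hR : ∀ q ∈ T, tcube o ℓ q ⊆ R) :
    ∑ q ∈ T, volume (tcube o ℓ q) ≤ 2 * 3 ^ n * volume R := by
  calc ∑ q ∈ T, volume (tcube o ℓ q) ≤ ∑ q ∈ T, 2 * 3 ^ n * volume (E q) := by
        refine Finset.sum_le_sum fun q _ => ?_
        rw [volume_tcube hℓ, mul_comm 2, mul_assoc]
        exact mul_le_mul' le_rfl (hE q)
    _ = 2 * 3 ^ n * volume (⋃ q ∈ T, E q) := by
        rw [← Finset.mul_sum, measure_biUnion_finset hd fun q _ => hEm q]
    _ ≤ _ := by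
        refine mul_le_mul' le_rfl (measure_mono (Set.iUnion₂_subset fun q hq => ?_))
        exact (hEsub q).trans ((gcube_subset_tcube hℓ q).trans (hR q hq))

/-- This is where the A_∞ constant enters. The average of v over the dilate of q is at most M(v χ_R)
at every point of `E q`, the dilate has measure at most 2·3^n |E q|, and the `E q` are disjoint.
Summation leaves the integral of M(v χ_R) over R that defines [v]_{A_∞}. -/
lemma IsWeight.sum_tcube_le {v : Rn n → ℝ≥0∞} (hv : IsWeight v) (hℓ : 0 < ℓ)
    (hEm : ∀ q, MeasurableSet (E q)) (hEsub : ∀ q, E q ⊆ gcube o ℓ q)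
    (hE : ∀ q, volume (gcube o ℓ q) ≤ 2 * volume (E q))
    (hd : (T : Set (ℕ × (Fin n → ℤ))).PairwiseDisjoint E) {R : ℕ × (Fin n → ℤ)}
    (hR : ∀ q ∈ T, tcube o ℓ q ⊆ tcube o ℓ R) :
    ∑ q ∈ T, ∫⁻ x in tcube o ℓ q, v x ≤
      2 * 3 ^ n * aInftyConst v * ∫⁻ x in tcube o ℓ R, v x := by
  set u := (tcube o ℓ R).indicator v with hu
  have hs := gside_pos hℓ R.1
  have key : ∀ q ∈ T, ∫⁻ x in tcube o ℓ q, v x ≤ 2 * 3 ^ n * ∫⁻ x in E q, hlMaximal u x := by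
    intro q hq
    have hsq := gside_pos hℓ q.1
    set m := (∫⁻ x in tcube o ℓ q, v x) / volume (tcube o ℓ q) with hm
    have h1 : ∀ x ∈ E q, m ≤ hlMaximal u x := by
      intro x hx
      have hxc : x ∈ cube (gcenter o ℓ q) (3 * (gside ℓ q.1 / 2)) :=
        cube_mono _ (by linarith) (gcube_subset_cube o ℓ q (hEsub q hx))
      refine le_trans (le_of_eq ?_) (le_hlMaximal u (by positivity) hxc)
      rw [hm, ← setLIntegral_congr (tcube_ae_eq_cube o hℓ q),
        ← measure_congr (tcube_ae_eq_cube o hℓ q)]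
      congr 1
      refine setLIntegral_congr_fun (measurableSet_tcube o ℓ q) fun x hx => ?_
      rw [hu, Set.indicator_of_mem (hR q hq hx)]
    calc ∫⁻ x in tcube o ℓ q, v x = m * volume (tcube o ℓ q) :=
          (ENNReal.div_mul_cancel (volume_tcube_ne_zero hℓ q) (volume_tcube_ne_top hℓ q)).symm
      _ = m * (3 ^ n * volume (gcube o ℓ q)) := by rw [volume_tcube hℓ]
      _ ≤ m * (3 ^ n * (2 * volume (E q))) :=
          mul_le_mul' le_rfl (mul_le_mul' le_rfl (hE q))
      _ = 2 * 3 ^ n * ∫⁻ _x in E q, m := by rw [setLIntegral_const]; ring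
      _ ≤ _ := mul_le_mul' le_rfl (setLIntegral_mono' (hEm q) h1)
  have hRae := tcube_ae_eq_cube o hℓ R
  set Q := cube (gcenter o ℓ R) (3 * (gside ℓ R.1 / 2)) with hQ
  have hMu : hlMaximal u = hlMaximal (Q.indicator v) :=
    hlMaximal_congr (indicator_ae_eq_of_ae_eq_set hRae)
  have h0 : ∫⁻ x in Q, v x ≠ 0 := hv.setLIntegral_ne_zero (volume_cube_ne_zero _ (by positivity))
  have ht : ∫⁻ x in Q, v x ≠ ⊤ := hv.fin _ _
  calc ∑ q ∈ T, ∫⁻ x in tcube o ℓ q, v x ≤ ∑ q ∈ T, 2 * 3 ^ n * ∫⁻ x in E q, hlMaximal u x :=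
        Finset.sum_le_sum key
    _ = 2 * 3 ^ n * ∫⁻ x in ⋃ q ∈ T, E q, hlMaximal u x := by
        rw [← Finset.mul_sum, lintegral_biUnion_finset hd fun q _ => hEm q]
    _ ≤ 2 * 3 ^ n * ∫⁻ x in tcube o ℓ R, hlMaximal u x := by
        refine mul_le_mul' le_rfl (lintegral_mono_set (Set.iUnion₂_subset fun q hq => ?_))
        exact (hEsub q).trans ((gcube_subset_tcube hℓ q).trans (hR q hq))
    _ = 2 * 3 ^ n * ∫⁻ x in Q, hlMaximal (Q.indicator v) x := by
        rw [setLIntegral_congr hRae, hMu]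
    _ ≤ 2 * 3 ^ n * (aInftyConst v * ∫⁻ x in Q, v x) := by
        refine mul_le_mul' le_rfl ((ENNReal.div_le_iff h0 ht).1 ?_)
        exact le_iSup_of_le (gcenter o ℓ R) (le_iSup_of_le (3 * (gside ℓ R.1 / 2))
          (le_iSup_of_le (by positivity) le_rfl))
    _ = _ := by rw [setLIntegral_congr hRae, mul_assoc (2 * 3 ^ n)]

end carleson

/-- The bound of a sparse operator over cubes of a single colour. -/
lemma sparse_color_bound (hn : 1 ≤ n) {o : Fin n → ℝ} {ℓ : ℝ} (hℓ : 0 < ℓ)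
    {E : ℕ × (Fin n → ℤ) → Set (Rn n)} {T : Finset (ℕ × (Fin n → ℤ))}
    (hEm : ∀ q, MeasurableSet (E q)) (hEsub : ∀ q, E q ⊆ gcube o ℓ q)
    (hE : ∀ q, volume (gcube o ℓ q) ≤ 2 * volume (E q))
    (hd : (T : Set (ℕ × (Fin n → ℤ))).PairwiseDisjoint E)
    (hT : ∀ q ∈ T, ∀ q' ∈ T, gcolor q = gcolor q')
    {p q : ℝ} (hpq : p.HolderConjugate q) {W σ : Rn n → ℝ≥0∞} (hW : IsWeight W) (hσ : IsWeight σ)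
    {A : ℝ≥0∞} (hA : ∀ c r, 0 < r → ((∫⁻ x in cube c r, W x) / volume (cube c r)) ^ (1 / p) *
      ((∫⁻ x in cube c r, σ x) / volume (cube c r)) ^ (1 / q) ≤ A)
    (hσt : ∀ x, σ x ≠ ⊤) (hrel : ∀ x, σ x ^ (1 - p) = W x)
    {g : Rn n → ℝ≥0∞} (hg : Measurable g) (hgp : ∫⁻ x, g x ^ p * W x ≠ ⊤) :
    (∫⁻ x, (∑ q ∈ T, (tcube o ℓ q).indicator
        (fun _ => (∫⁻ y in tcube o ℓ q, g y) / volume (tcube o ℓ q)) x) ^ p * W x) ^ (1 / p) ≤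
      SparseData.sparseConst p q (2 * 3 ^ n) * A * (2 * 3 ^ n * max (aInftyConst W ^ (1 / q))
        (aInftyConst σ ^ (1 / p))) * (∫⁻ x, g x ^ p * W x) ^ (1 / p) := by
  classical
  have hp0 := hpq.pos
  have hinj := tcube_injective (o := o) hℓ hn
  have hwd : ∀ {v : Rn n → ℝ≥0∞} (i : ℕ × (Fin n → ℤ)),
      (volume.withDensity v) (tcube o ℓ i) = ∫⁻ x in tcube o ℓ i, v x :=
    fun i => withDensity_apply _ (measurableSet_tcube o ℓ i)
  have hσ0 : ∀ x, σ x ≠ 0 := hσ.pos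
  -- the subfamilies below a given cube
  have hsub : ∀ S' ⊆ T.image (tcube o ℓ), ∀ R ∈ T.image (tcube o ℓ), (∀ Q ∈ S', Q ⊆ R) →
      ∃ T' ⊆ T, ∃ r ∈ T, tcube o ℓ r = R ∧ (∀ i ∈ T', tcube o ℓ i ⊆ tcube o ℓ r) ∧
        ∀ m : Set (Rn n) → ℝ≥0∞, ∑ Q ∈ S', m Q = ∑ i ∈ T', m (tcube o ℓ i) := by
    intro S' hS' R hR hSR
    obtain ⟨T', hT', rfl⟩ := Finset.subset_image_iff.1 hS'
    obtain ⟨r, hr, rfl⟩ := Finset.mem_image.1 hR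
    exact ⟨T', hT', r, hr, rfl, fun i hi => hSR _ (Finset.mem_image_of_mem _ hi),
      fun m => Finset.sum_image fun a _ b _ h => hinj h⟩
  have hd' : ∀ T' ⊆ T, (T' : Set (ℕ × (Fin n → ℤ))).PairwiseDisjoint E := fun T' hT' =>
    hd.subset (Finset.coe_subset.2 hT')
  have hdata : SparseData volume (volume.withDensity σ) (volume.withDensity W)
      (T.image (tcube o ℓ)) (2 * 3 ^ n) := by
    constructor
    · intro Q hQ R hR
      obtain ⟨i, hi, rfl⟩ := Finset.mem_image.1 hQ
      obtain ⟨j, hj, rfl⟩ := Finset.mem_image.1 hR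
      by_cases hij : Disjoint (tcube o ℓ i) (tcube o ℓ j)
      · exact Or.inr (Or.inr hij)
      · obtain ⟨x, hx, hx'⟩ := Set.not_disjoint_iff.1 hij
        rcases le_total i.1 j.1 with hle | hle
        · exact Or.inr (Or.inl (tcube_nested hℓ hle (hT i hi j hj) hx hx'))
        · exact Or.inl (tcube_nested hℓ hle (hT j hj i hi) hx' hx)
    · intro Q hQ
      obtain ⟨i, hi, rfl⟩ := Finset.mem_image.1 hQ
      exact measurableSet_tcube o ℓ i
    · intro Q hQ
      obtain ⟨i, hi, rfl⟩ := Finset.mem_image.1 hQ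
      exact volume_tcube_ne_zero hℓ i
    · intro Q hQ
      obtain ⟨i, hi, rfl⟩ := Finset.mem_image.1 hQ
      exact volume_tcube_ne_top hℓ i
    · intro Q hQ
      obtain ⟨i, hi, rfl⟩ := Finset.mem_image.1 hQ
      rw [hwd]
      exact hσ.setLIntegral_ne_zero (volume_tcube_ne_zero hℓ i)
    · intro Q hQ
      obtain ⟨i, hi, rfl⟩ := Finset.mem_image.1 hQ
      rw [hwd]
      exact hσ.tcube_ne_top hℓ i
    · intro Q hQ
      obtain ⟨i, hi, rfl⟩ := Finset.mem_image.1 hQ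
      rw [hwd]
      exact hW.setLIntegral_ne_zero (volume_tcube_ne_zero hℓ i)
    · intro Q hQ
      obtain ⟨i, hi, rfl⟩ := Finset.mem_image.1 hQ
      rw [hwd]
      exact hW.tcube_ne_top hℓ i
    · exact one_le_mul_of_one_le_of_one_le (by norm_num) (one_le_pow₀ (by norm_num))
    · exact ENNReal.mul_ne_top (by simp) (by simp)
    · intro S' hS' R hR hSR
      obtain ⟨T', hT', r, hr, rfl, hle, hsum⟩ := hsub S' hS' R hR hSR
      rw [hsum]
      exact sum_volume_tcube_le hℓ hEm hEsub hE (hd' T' hT') hle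
  have hcarl : ∀ {v : Rn n → ℝ≥0∞}, IsWeight v → ∀ S' ⊆ T.image (tcube o ℓ),
      ∀ R ∈ T.image (tcube o ℓ), (∀ Q ∈ S', Q ⊆ R) →
      ∑ Q ∈ S', (volume.withDensity v) Q ≤ 2 * 3 ^ n * aInftyConst v * (volume.withDensity v) R := by
    intro v hv S' hS' R hR hSR
    obtain ⟨T', hT', r, hr, rfl, hle, hsum⟩ := hsub S' hS' R hR hSR
    rw [hsum]
    simp only [hwd]
    exact hv.sum_tcube_le hℓ hEm hEsub hE (hd' T' hT') hle
  -- transfer of the function to the dual weight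
  set F : Rn n → ℝ≥0∞ := fun x => g x / σ x with hF
  have hFm : Measurable F := hg.div hσ.meas
  have hFσ : ∀ x, F x * σ x = g x := fun x => ENNReal.div_mul_cancel (hσ0 x) (hσt x)
  -- Since σ^{1-p} = W, the L^p(W) norm of g is the L^p(σ) norm of g/σ.
  have hFp : ∀ x, σ x * F x ^ p = g x ^ p * W x := by
    intro x
    simp only [hF]
    rw [div_eq_mul_inv, ENNReal.mul_rpow_of_nonneg _ _ hp0.le, ENNReal.inv_rpow, ← hrel x,
      ENNReal.rpow_sub _ _ (hσ0 x) (hσt x), ENNReal.rpow_one, div_eq_mul_inv]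
    ring
  have hint : ∫⁻ x, F x ^ p ∂(volume.withDensity σ) = ∫⁻ x, g x ^ p * W x := by
    rw [lintegral_withDensity_eq_lintegral_mul _ hσ.meas (hFm.pow_const p)]
    exact lintegral_congr hFp
  have hFQ : ∀ i, ∫⁻ y in tcube o ℓ i, F y ∂(volume.withDensity σ) = ∫⁻ y in tcube o ℓ i, g y := by
    intro i
    rw [setLIntegral_withDensity_eq_setLIntegral_mul _ hσ.meas hFm (measurableSet_tcube o ℓ i)]
    refine lintegral_congr fun x => ?_
    rw [Pi.mul_apply, mul_comm, hFσ]
  have main := hdata.strong_bound hpq (A := A) (B := 2 * 3 ^ n * aInftyConst σ)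
    (B' := 2 * 3 ^ n * aInftyConst W) ?_ (hcarl hσ) (hcarl hW) hFm (by rwa [hint])
  · have hsum : ∀ x, (∑ Q ∈ T.image (tcube o ℓ), Q.indicator
        (fun _ => (∫⁻ y in Q, F y ∂(volume.withDensity σ)) / volume Q) x) =
        ∑ i ∈ T, (tcube o ℓ i).indicator
          (fun _ => (∫⁻ y in tcube o ℓ i, g y) / volume (tcube o ℓ i)) x := by
      intro x
      rw [Finset.sum_image fun a _ b _ h => hinj h]
      simp only [hFQ]
    simp only [hsum] at main
    rw [hint, lintegral_withDensity_eq_lintegral_mul _ hW.meas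
      ((Finset.measurable_fun_sum _ fun i _ =>
        measurable_const.indicator (measurableSet_tcube o ℓ i)).pow_const p)] at main
    simp only [Pi.mul_apply] at main
    simp only [mul_comm _ (W _)] at main ⊢
    refine main.trans (mul_le_mul' (mul_le_mul' le_rfl ?_) le_rfl)
    have hK : (1 : ℝ≥0∞) ≤ 2 * 3 ^ n :=
      one_le_mul_of_one_le_of_one_le (by norm_num) (one_le_pow₀ (by norm_num))
    have hpow : ∀ {s : ℝ} (a : ℝ≥0∞), 1 < s → (2 * 3 ^ n * a) ^ (1 / s) ≤
        2 * 3 ^ n * a ^ (1 / s) := by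
      intro s a hs
      rw [ENNReal.mul_rpow_of_nonneg _ _ (by positivity)]
      refine mul_le_mul' ?_ le_rfl
      calc _ ≤ ((2 : ℝ≥0∞) * 3 ^ n) ^ (1 : ℝ) :=
            ENNReal.rpow_le_rpow_of_exponent_le hK ((div_le_one (by linarith)).2 hs.le)
        _ = _ := ENNReal.rpow_one _
    refine max_le ((hpow _ hpq.lt).trans ?_) ((hpow _ hpq.symm.lt).trans ?_)
    · exact mul_le_mul' le_rfl (le_max_right _ _)
    · exact mul_le_mul' le_rfl (le_max_left _ _)
  · intro Q hQ
    obtain ⟨i, hi, rfl⟩ := Finset.mem_image.1 hQ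
    have hs := gside_pos hℓ i.1
    rw [hwd, hwd, setLIntegral_congr (tcube_ae_eq_cube o hℓ i),
      setLIntegral_congr (f := σ) (tcube_ae_eq_cube o hℓ i),
      measure_congr (tcube_ae_eq_cube o hℓ i)]
    exact hA _ _ (by positivity)

end RoughSquare

/-! ### From sparse operators to the weighted bound for the square function. -/

namespace RoughSquare

variable {n : ℕ}

/-- Hölder against σ. It makes functions in L^p(W) locally integrable, so that sparse domination
applies to them. -/
lemma setLIntegral_ne_top_of_weight {p q : ℝ} (hpq : p.HolderConjugate q) {W σ : Rn n → ℝ≥0∞}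
    (hσ : IsWeight σ) (hσt : ∀ x, σ x ≠ ⊤) (hrel : ∀ x, σ x ^ (1 - p) = W x)
    {g : Rn n → ℝ≥0∞} (hg : Measurable g) (hgp : ∫⁻ x, g x ^ p * W x ≠ ⊤) (c : Rn n) (r : ℝ) :
    ∫⁻ x in cube c r, g x ≠ ⊤ := by
  have hm := measurableSet_cube c r
  have hFm : Measurable fun x => g x / σ x := hg.div hσ.meas
  have h1 : ∫⁻ x, (g x / σ x) ^ p ∂(volume.withDensity σ) = ∫⁻ x, g x ^ p * W x := by
    rw [lintegral_withDensity_eq_lintegral_mul _ hσ.meas (hFm.pow_const p)]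
    refine lintegral_congr fun x => ?_
    rw [Pi.mul_apply, div_eq_mul_inv, ENNReal.mul_rpow_of_nonneg _ _ hpq.pos.le, ENNReal.inv_rpow,
      ← hrel x, ENNReal.rpow_sub _ _ (hσ.pos x) (hσt x), ENNReal.rpow_one, div_eq_mul_inv]
    ring
  have h2 := setLIntegral_ne_top_of_rpow hpq hFm (by rwa [h1]) (Q := cube c r)
    (by rw [withDensity_apply _ hm]; exact hσ.fin c r)
  rw [setLIntegral_withDensity_eq_setLIntegral_mul _ hσ.meas hFm hm] at h2
  have e : ∫⁻ x in cube c r, (σ * fun x => g x / σ x) x = ∫⁻ x in cube c r, g x :=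
    lintegral_congr fun x => by
      rw [Pi.mul_apply, mul_comm, ENNReal.div_mul_cancel (hσ.pos x) (hσt x)]
  rwa [e] at h2

section sparse

variable {o : Fin n → ℝ} {ℓ : ℝ} {E : ℕ × (Fin n → ℤ) → Set (Rn n)} {G : Set (ℕ × (Fin n → ℤ))}
  {p q : ℝ} {W σ : Rn n → ℝ≥0∞} {A : ℝ≥0∞}

/-- The `L^p(w)` bound of a sparse operator. -/
theorem sparse_bound (hn : 1 ≤ n) (hℓ : 0 < ℓ)
    (hEm : ∀ q, MeasurableSet (E q)) (hEsub : ∀ q, E q ⊆ gcube o ℓ q)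
    (hE : ∀ q, volume (gcube o ℓ q) ≤ 2 * volume (E q)) (hd : G.PairwiseDisjoint E)
    (hpq : p.HolderConjugate q) (hW : IsWeight W) (hσ : IsWeight σ)
    (hA : ∀ c r, 0 < r → ((∫⁻ x in cube c r, W x) / volume (cube c r)) ^ (1 / p) *
      ((∫⁻ x in cube c r, σ x) / volume (cube c r)) ^ (1 / q) ≤ A)
    (hσt : ∀ x, σ x ≠ ⊤) (hrel : ∀ x, σ x ^ (1 - p) = W x)
    {g : Rn n → ℝ≥0∞} (hg : Measurable g) (hgp : ∫⁻ x, g x ^ p * W x ≠ ⊤) :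
    (∫⁻ x, (∑' q, G.indicator (fun q => (tcube o ℓ q).indicator
        (fun _ => (∫⁻ y in tcube o ℓ q, g y) / volume (tcube o ℓ q)) x) q) ^ p
          ∂(volume.withDensity W)) ^ (1 / p) ≤
      3 ^ n * (SparseData.sparseConst p q (2 * 3 ^ n) * A * (2 * 3 ^ n *
        max (aInftyConst W ^ (1 / q)) (aInftyConst σ ^ (1 / p))) *
          (∫⁻ x, g x ^ p * W x) ^ (1 / p)) := by
  classical
  have hp0 := hpq.pos
  set K := SparseData.sparseConst p q (2 * 3 ^ n) * A * (2 * 3 ^ n *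
        max (aInftyConst W ^ (1 / q)) (aInftyConst σ ^ (1 / p))) *
          (∫⁻ x, g x ^ p * W x) ^ (1 / p) with hK
  set u : ℕ × (Fin n → ℤ) → Rn n → ℝ≥0∞ := fun q x => (tcube o ℓ q).indicator
        (fun _ => (∫⁻ y in tcube o ℓ q, g y) / volume (tcube o ℓ q)) x with hu
  have hum : ∀ q, Measurable (u q) := fun q =>
    measurable_const.indicator (measurableSet_tcube o ℓ q)
  have hfin : ∀ T : Finset (ℕ × (Fin n → ℤ)),
      (∫⁻ x, (∑ i ∈ T, G.indicator (fun i => u i x) i) ^ p ∂(volume.withDensity W)) ^ (1 / p) ≤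
        3 ^ n * K := by
    intro T
    set T₁ := T.filter (· ∈ G) with hT₁
    -- One sum per colour; there are 3^n colours, which is the outer factor in the bound.
    have e : ∀ x, ∑ i ∈ T, G.indicator (fun i => u i x) i =
        ∑ c : Fin n → ZMod 3, ∑ i ∈ T₁.filter (fun i => gcolor i = c), u i x := by
      intro x
      rw [Finset.sum_fiberwise, hT₁, Finset.sum_filter]
      exact Finset.sum_congr rfl fun i _ => by rw [Set.indicator_apply]
    simp only [e]
    refine (lintegral_Lp_finset_sum_le hpq.lt.le Finset.univ
      (fun c x => ∑ i ∈ T₁.filter (fun i => gcolor i = c), u i x)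
      (fun c => Finset.measurable_fun_sum _ fun i _ => hum i)).trans ?_
    have hc : ∀ c ∈ (Finset.univ : Finset (Fin n → ZMod 3)),
        (∫⁻ x, (∑ i ∈ T₁.filter (fun i => gcolor i = c), u i x) ^ p
          ∂(volume.withDensity W)) ^ (1 / p) ≤ K := by
      intro c _
      rw [lintegral_withDensity_eq_lintegral_mul _ hW.meas
        ((Finset.measurable_fun_sum _ fun i _ => hum i).pow_const p)]
      have := sparse_color_bound (T := T₁.filter (fun i => gcolor i = c)) hn hℓ hEm hEsub hE
        (hd.subset fun i hi => by
          have := Finset.mem_coe.1 hi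
          simp only [hT₁, Finset.mem_filter] at this
          exact this.1.2)
        (fun i hi j hj => (Finset.mem_filter.1 hi).2.trans (Finset.mem_filter.1 hj).2.symm)
        hpq hW hσ hA hσt hrel hg hgp
      simp only [Pi.mul_apply]
      simp only [mul_comm _ (W _)] at this ⊢
      refine this.trans (le_of_eq ?_)
      rw [hK]
      simp only [mul_comm _ (W _)]
    refine (Finset.sum_le_card_nsmul _ _ _ hc).trans (le_of_eq ?_)
    simp
  have hsup : ∀ x, (∑' i, G.indicator (fun i => u i x) i) ^ p =
      ⨆ T : Finset (ℕ × (Fin n → ℤ)), (∑ i ∈ T, G.indicator (fun i => u i x) i) ^ p := by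
    intro x
    rw [ENNReal.tsum_eq_iSup_sum]
    exact (ENNReal.orderIsoRpow p hp0).map_iSup _
  have hle : ∫⁻ x, (∑' i, G.indicator (fun i => u i x) i) ^ p ∂(volume.withDensity W) ≤
      (3 ^ n * K) ^ p := by
    simp only [hsup]
    rw [lintegral_iSup_directed]
    · refine iSup_le fun T => ?_
      have := ENNReal.rpow_le_rpow (hfin T) hp0.le
      rwa [← ENNReal.rpow_mul, one_div, inv_mul_cancel₀ hp0.ne', ENNReal.rpow_one] at this
    · intro T
      refine (Measurable.pow_const (Finset.measurable_fun_sum _ fun i _ => ?_) p).aemeasurable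
      by_cases hi : i ∈ G
      · simpa only [Set.indicator_of_mem hi] using hum i
      · simp only [Set.indicator_of_notMem hi]; exact measurable_const
    · refine Monotone.directed_le fun T T' hTT x => ?_
      exact ENNReal.rpow_le_rpow (Finset.sum_le_sum_of_subset hTT) hp0.le
  calc _ ≤ ((3 ^ n * K) ^ p) ^ (1 / p) := ENNReal.rpow_le_rpow hle (by positivity)
    _ = _ := by rw [← ENNReal.rpow_mul, one_div, mul_inv_cancel₀ hp0.ne', ENNReal.rpow_one]

end sparse

namespace IsKernelFamily

variable {ψ : ℤ → Rn n → ℂ}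

/-- The constant in the weighted bound. -/
noncomputable def weightConst (n : ℕ) (p q : ℝ) : ℝ≥0∞ :=
  domConst n * (3 ^ n * (SparseData.sparseConst p q (2 * 3 ^ n) * (2 * 3 ^ n)))

lemma weightConst_ne_top (n : ℕ) {p q : ℝ} (hpq : p.HolderConjugate q) : weightConst n p q ≠ ⊤ := by
  have h : (2 : ℝ≥0∞) * 3 ^ n ≠ ⊤ := ENNReal.mul_ne_top (by simp) (by simp)
  exact ENNReal.mul_ne_top (domConst_ne_top n) (ENNReal.mul_ne_top (by simp)
    (ENNReal.mul_ne_top (SparseData.sparseConst_ne_top hpq h) h))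

section weighted

variable {p q : ℝ} {W σ : Rn n → ℝ≥0∞} {A : ℝ≥0∞}

lemma sqFn_weighted_local (h : IsKernelFamily ψ 1) (hn : 1 ≤ n)
    (hpq : p.HolderConjugate q) (hW : IsWeight W) (hσ : IsWeight σ)
    (hA : ∀ c r, 0 < r → ((∫⁻ x in cube c r, W x) / volume (cube c r)) ^ (1 / p) *
      ((∫⁻ x in cube c r, σ x) / volume (cube c r)) ^ (1 / q) ≤ A)
    (hσt : ∀ x, σ x ≠ ⊤) (hrel : ∀ x, σ x ^ (1 - p) = W x)
    {f : Rn n → ℂ} (hfm : Measurable f) (hf : LocallyIntegrable f)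
    (hfp : ∫⁻ x, ‖f x‖ₑ ^ p * W x ≠ ⊤) (o : Fin n → ℝ) {ℓ : ℝ} (hℓ : 0 < ℓ)
    (q₀ : ℕ × (Fin n → ℤ)) :
    ∫⁻ x in gcube o ℓ q₀, sqFn ψ ((tcube o ℓ q₀).indicator f) x ^ p ∂(volume.withDensity W) ≤
      (weightConst n p q * (A * max (aInftyConst W ^ (1 / q)) (aInftyConst σ ^ (1 / p))) *
        (∫⁻ x, ‖f x‖ₑ ^ p * W x) ^ (1 / p)) ^ p := by
  have hp0 := hpq.pos
  obtain ⟨G, E, hEm, hEsub, hE, hd, hae⟩ := h.sparse_domination hn hf o hℓ q₀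
  have hs := sparse_bound hn hℓ hEm hEsub hE hd hpq hW hσ hA hσt hrel hfm.enorm hfp
  have hs' := ENNReal.rpow_le_rpow hs hp0.le
  rw [← ENNReal.rpow_mul, one_div, inv_mul_cancel₀ hp0.ne', ENNReal.rpow_one] at hs'
  have hae' : ∀ᵐ x ∂(volume.withDensity W), x ∈ gcube o ℓ q₀ →
      sqFn ψ ((tcube o ℓ q₀).indicator f) x ^ p ≤ domConst n ^ p *
        (∑' q, G.indicator (fun q => (tcube o ℓ q).indicator
        (fun _ => (∫⁻ y in tcube o ℓ q, ‖f y‖ₑ) / volume (tcube o ℓ q)) x) q) ^ p := by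
    refine (withDensity_absolutelyContinuous volume W).ae_le ?_
    filter_upwards [hae] with x hx hxq
    rw [← ENNReal.mul_rpow_of_nonneg _ _ hp0.le]
    refine ENNReal.rpow_le_rpow ((hx hxq).trans (mul_le_mul' le_rfl ?_)) hp0.le
    refine ENNReal.tsum_le_tsum fun i => Set.indicator_le_indicator ?_
    exact Set.indicator_le_indicator_of_subset (gcube_subset_tcube hℓ i) (fun _ => zero_le) x
  refine (setLIntegral_mono_ae' (measurableSet_hbox _ _) hae').trans ?_
  refine (setLIntegral_le_lintegral _ _).trans ?_
  rw [lintegral_const_mul' _ _ (ENNReal.rpow_ne_top_of_nonneg hp0.le (domConst_ne_top n))]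
  refine (mul_le_mul' le_rfl hs').trans (le_of_eq ?_)
  rw [← ENNReal.mul_rpow_of_nonneg _ _ hp0.le, weightConst]
  congr 1
  simp only [one_div]
  ring

/-- Each ψ_k has compact support, so for fixed k and x the truncation is invisible once `B M` is
large; Fatou in k does the rest. -/
lemma sqFn_le_liminf (h : IsKernelFamily ψ 1) (f : Rn n → ℂ) (B : ℕ → Set (Rn n))
    (hB : ∀ R : ℝ, ∀ᶠ M in atTop, Metric.closedBall (0 : Rn n) R ⊆ B M) (x : Rn n) :
    sqFn ψ f x ≤ liminf (fun M => sqFn ψ ((B M).indicator f) x) atTop := by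
  have h1 : ∀ k, Tendsto (fun M => ‖(ψ k ⋆[ContinuousLinearMap.mul ℂ ℂ, volume]
      ((B M).indicator f)) x‖ₑ ^ 2) atTop
      (𝓝 (‖(ψ k ⋆[ContinuousLinearMap.mul ℂ ℂ, volume] f) x‖ₑ ^ 2)) := by
    intro k
    refine tendsto_const_nhds.congr' ?_
    filter_upwards [hB (‖x‖ + 2 * (2 : ℝ) ^ k)] with M hM
    congr 2
    rw [convolution_mul_swap, convolution_mul_swap]
    refine integral_congr_ae (ae_of_all _ fun y => ?_)
    simp only []
    by_cases hy : y ∈ B M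
    · rw [Set.indicator_of_mem hy]
    · have : ψ k (x - y) = 0 := by
        by_contra hne
        refine hy (hM ?_)
        have h2 := h.supp k _ hne
        rw [Metric.mem_closedBall, dist_zero_right]
        have h3 := norm_sub_norm_le y x
        rw [norm_sub_rev] at h3
        linarith
      rw [this, zero_mul, zero_mul]
  have h2 := tsum_fatou _ _ h1
  have h3 : (liminf (fun M => ∑' k, ‖(ψ k ⋆[ContinuousLinearMap.mul ℂ ℂ, volume]
      ((B M).indicator f)) x‖ₑ ^ 2) atTop) ^ (1 / 2 : ℝ) =
      liminf (fun M => sqFn ψ ((B M).indicator f) x) atTop :=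
    (ENNReal.orderIsoRpow (1 / 2) (by norm_num)).liminf_apply
  rw [← h3]
  exact ENNReal.rpow_le_rpow h2 (by norm_num)

/-- The weighted bound for measurable functions and positive weights. -/
theorem sqFn_weighted (h : IsKernelFamily ψ 1) (hn : 1 ≤ n)
    (hpq : p.HolderConjugate q) (hW : IsWeight W) (hσ : IsWeight σ)
    (hA : ∀ c r, 0 < r → ((∫⁻ x in cube c r, W x) / volume (cube c r)) ^ (1 / p) *
      ((∫⁻ x in cube c r, σ x) / volume (cube c r)) ^ (1 / q) ≤ A)
    (hσt : ∀ x, σ x ≠ ⊤) (hrel : ∀ x, σ x ^ (1 - p) = W x)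
    {f : Rn n → ℂ} (hfm : Measurable f) (hfp : ∫⁻ x, ‖f x‖ₑ ^ p * W x ≠ ⊤) :
    (∫⁻ x, sqFn ψ f x ^ p ∂(volume.withDensity W)) ^ (1 / p) ≤
      weightConst n p q * (A * max (aInftyConst W ^ (1 / q)) (aInftyConst σ ^ (1 / p))) *
        (∫⁻ x, ‖f x‖ₑ ^ p * W x) ^ (1 / p) := by
  have hp0 := hpq.pos
  set Bd := weightConst n p q * (A * max (aInftyConst W ^ (1 / q)) (aInftyConst σ ^ (1 / p))) *
        (∫⁻ x, ‖f x‖ₑ ^ p * W x) ^ (1 / p)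
  have hf : LocallyIntegrable f := by
    intro x
    refine ⟨Metric.closedBall x 1, Metric.closedBall_mem_nhds x one_pos, hfm.aestronglyMeasurable,
      ?_⟩
    refine (lintegral_mono_set (closedBall_subset_cube x 1)).trans_lt (lt_top_iff_ne_top.2 ?_)
    exact setLIntegral_ne_top_of_weight hpq hσ hσt hrel hfm.enorm hfp x 1
  -- The cube with index (0, 0) of the M-th grid is [-2^M, 2^M)^n, and these cubes exhaust the
  -- space.
  set o : ℕ → Fin n → ℝ := fun M _ => -2 ^ M
  set ℓ : ℕ → ℝ := fun M => 2 ^ (M + 1)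
  have hℓ : ∀ M, 0 < ℓ M := fun M => by positivity
  have hsub : ∀ R : ℝ, ∀ᶠ M in atTop, Metric.closedBall (0 : Rn n) R ⊆ gcube (o M) (ℓ M) (0, 0) := by
    intro R
    obtain ⟨M₀, hM₀⟩ := pow_unbounded_of_one_lt R (one_lt_two (α := ℝ))
    filter_upwards [eventually_ge_atTop M₀] with M hM
    intro x hx i
    have h1 := closedBall_subset_cube 0 R hx i
    have h2 : (2 : ℝ) ^ M₀ ≤ 2 ^ M := pow_le_pow_right₀ one_le_two hM
    simp only [PiLp.zero_apply, sub_zero] at h1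
    rw [abs_le] at h1
    simp only [gside, o, ℓ, pow_zero, div_one, Pi.zero_apply, Int.cast_zero, mul_zero, add_zero,
      pow_succ]
    constructor <;> linarith [h1.1, h1.2]
  set S : ℕ → Rn n → ℝ≥0∞ := fun M x =>
    (gcube (o M) (ℓ M) (0, 0)).indicator (fun x =>
      sqFn ψ ((tcube (o M) (ℓ M) (0, 0)).indicator f) x ^ p) x with hS
  have hgm : ∀ M, MeasurableSet (gcube (o M) (ℓ M) ((0 : ℕ), (0 : Fin n → ℤ))) :=
    fun M => measurableSet_hbox _ _
  have hSm : ∀ M, Measurable (S M) := fun M =>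
    ((h.measurable_sqFn (hf.indicator (measurableSet_tcube _ _ _))).pow_const p).indicator (hgm M)
  have hpt : ∀ x, sqFn ψ f x ^ p ≤ liminf (fun M => S M x) atTop := by
    intro x
    have h1 := h.sqFn_le_liminf f (fun M => tcube (o M) (ℓ M) (0, 0)) (fun R => by
      filter_upwards [hsub R] with M hM
      exact hM.trans (gcube_subset_tcube (hℓ M) _)) x
    have h2 : (liminf (fun M => sqFn ψ ((tcube (o M) (ℓ M) (0, 0)).indicator f) x) atTop) ^ p =
        liminf (fun M => sqFn ψ ((tcube (o M) (ℓ M) (0, 0)).indicator f) x ^ p) atTop :=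
      (ENNReal.orderIsoRpow p hp0).liminf_apply
    refine (ENNReal.rpow_le_rpow h1 hp0.le).trans (h2.trans ?_).le
    refine liminf_congr ?_
    filter_upwards [hsub ‖x‖] with M hM
    rw [hS]
    simp only []
    rw [Set.indicator_of_mem (hM (by simp))]
  have hle : ∫⁻ x, sqFn ψ f x ^ p ∂(volume.withDensity W) ≤ Bd ^ p := by
    calc _ ≤ ∫⁻ x, liminf (fun M => S M x) atTop ∂(volume.withDensity W) := lintegral_mono hpt
      _ ≤ liminf (fun M => ∫⁻ x, S M x ∂(volume.withDensity W)) atTop := lintegral_liminf_le hSm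
      _ ≤ liminf (fun _ : ℕ => Bd ^ p) atTop := by
          refine liminf_le_liminf (Eventually.of_forall fun M => ?_)
          simp only [hS]
          rw [lintegral_indicator (hgm M)]
          exact h.sqFn_weighted_local hn hpq hW hσ hA hσt hrel hfm hf hfp (o M) (hℓ M) (0, 0)
      _ = _ := liminf_const _
  calc _ ≤ (Bd ^ p) ^ (1 / p) := ENNReal.rpow_le_rpow hle (by positivity)
    _ = _ := by rw [← ENNReal.rpow_mul, one_div, mul_inv_cancel₀ hp0.ne', ENNReal.rpow_one]

end weighted

end IsKernelFamily

end RoughSquare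

namespace RoughSquare

/-! ### Muckenhoupt weights -/

variable {n : ℕ}

lemma aInftyConst_congr {v v' : Rn n → ℝ≥0∞} (h : v =ᵐ[volume] v') :
    aInftyConst v = aInftyConst v' := by
  have h1 : ∀ A : Set (Rn n), hlMaximal (A.indicator v) = hlMaximal (A.indicator v') :=
    fun A => hlMaximal_congr (by
      filter_upwards [h] with x hx
      simp only [Set.indicator, hx])
  have h2 : ∀ A : Set (Rn n), ∫⁻ y in A, v y = ∫⁻ y in A, v' y := fun A =>
    lintegral_congr_ae (ae_restrict_of_ae h)
  simp only [aInftyConst, h1, h2]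

lemma ae_of_forall_cube {P : Rn n → Prop}
    (h : ∀ m : ℕ, ∀ᵐ x ∂(volume.restrict (cube (0 : Rn n) m)), P x) : ∀ᵐ x, P x := by
  have hU : ⋃ m : ℕ, cube (0 : Rn n) m = Set.univ := by
    refine Set.eq_univ_of_forall fun x => ?_
    obtain ⟨m, hm⟩ := exists_nat_ge ‖x‖
    exact Set.mem_iUnion.2 ⟨m, closedBall_subset_cube _ _ (by simpa using hm)⟩
  rw [← Measure.restrict_univ (μ := volume), ← hU]
  exact (ae_restrict_iUnion_iff _ _).2 h

section weight

variable {p : ℝ} {w : Rn n → ℝ}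

lemma IsApWeight.aemeasurable (hw : IsApWeight p w) : AEMeasurable (toWeight w) :=
  hw.locInt.aestronglyMeasurable.aemeasurable.ennreal_ofReal

lemma IsApWeight.lintegral_cube_ne_top (hn : 1 ≤ n) (hw : IsApWeight p w) (c : Rn n) (r : ℝ) :
    ∫⁻ x in cube c r, toWeight w x ≠ ⊤ := by
  have hsub : cube c r ⊆ Metric.closedBall c (n * r) := fun x hx => by
    rw [Metric.mem_closedBall, dist_eq_norm]
    exact norm_sub_le_of_mem_cube hn hx
  have := ((hw.locInt.integrableOn_isCompact (isCompact_closedBall c (n * r))).mono_set hsub).2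
  refine ((lintegral_congr fun x => ?_).trans_lt this).ne
  rw [toWeight, Real.enorm_of_nonneg (hw.nonneg x)]

/-- An infinite dual integral next to a nonzero integral of w would make the A_p product of this
single cube infinite. -/
lemma IsApWeight.dual_ne_top (hp : 1 < p) (hw : IsApWeight p w) {c : Rn n} {r : ℝ} (hr : 0 < r)
    (h0 : ∫⁻ x in cube c r, toWeight w x ≠ 0) :
    ∫⁻ x in cube c r, dualWeight p (toWeight w) x ≠ ⊤ := by
  intro htop
  have h1 : ((∫⁻ x in cube c r, toWeight w x) / volume (cube c r)) *
      ((∫⁻ x in cube c r, dualWeight p (toWeight w) x) / volume (cube c r)) ^ (p - 1) ≤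
        apConst p (toWeight w) := le_iSup_of_le c (le_iSup_of_le r (le_iSup_of_le hr le_rfl))
  rw [htop, ENNReal.top_div_of_ne_top (volume_cube_ne_top c hr.le),
    ENNReal.top_rpow_of_pos (by linarith), ENNReal.mul_top
      (ENNReal.div_ne_zero.2 ⟨h0, volume_cube_ne_top c hr.le⟩)] at h1
  exact absurd hw.finite (not_lt.2 h1)

/-- A Muckenhoupt weight vanishes almost everywhere or almost nowhere. -/
lemma IsApWeight.ae_zero_or_pos (hp : 1 < p) (hw : IsApWeight p w) :
    toWeight w =ᵐ[volume] 0 ∨ ∀ᵐ x, toWeight w x ≠ 0 := by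
  by_cases h : ∃ m : ℕ, ∫⁻ x in cube (0 : Rn n) m, toWeight w x ≠ 0
  · right
    obtain ⟨m, hm⟩ := h
    refine ae_of_forall_cube fun j => ?_
    set N := m + j + 1 with hN
    have hsub : ∀ i : ℕ, i ≤ N → cube (0 : Rn n) i ⊆ cube 0 N := fun i hi =>
      cube_mono 0 (by exact_mod_cast hi)
    have h1 : ∫⁻ x in cube (0 : Rn n) N, toWeight w x ≠ 0 := fun h0 => hm
      (le_antisymm ((lintegral_mono_set (hsub m (by omega))).trans h0.le) zero_le)
    -- The dual weight is infinite wherever w vanishes, so its finite integral over a large cube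
    -- excludes zeros of w on a set of positive measure.
    have h2 := hw.dual_ne_top hp (by positivity) h1
    have h3 := ae_lt_top' (hw.aemeasurable.pow_const (1 - p.conjExponent)).restrict h2
    have h4 := ae_restrict_of_ae_restrict_of_subset (hsub j (by omega)) h3
    filter_upwards [h4] with x hx h0
    have hq := (Real.HolderConjugate.conjExponent hp).symm.lt
    rw [h0, ENNReal.zero_rpow_of_neg (by linarith)] at hx
    exact lt_irrefl _ hx
  · left
    push Not at h
    exact ae_of_forall_cube fun m => (lintegral_eq_zero_iff' hw.aemeasurable.restrict).1 (h m)

end weight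

namespace IsKernelFamily

variable {ψ : ℤ → Rn n → ℂ}

/-- The weighted bound for a normalised kernel family. -/
theorem eLpNorm_sqFn_weighted (h : IsKernelFamily ψ 1) (hn : 1 ≤ n) {p : ℝ} (hp : 1 < p)
    {w : Rn n → ℝ} (hw : IsApWeight p w) {f : Rn n → ℂ}
    (hf : MemLp f (ENNReal.ofReal p) (weightMeasure w)) :
    eLpNorm (sqFn ψ f) (ENNReal.ofReal p) (weightMeasure w) ≤
      weightConst n p p.conjExponent * braceConst p (toWeight w) *
        eLpNorm f (ENNReal.ofReal p) (weightMeasure w) := by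
  -- A weight vanishing almost everywhere is admitted; its measure is zero and so is the left side.
  rcases hw.ae_zero_or_pos hp with h0 | hpos
  · have : weightMeasure w = 0 := by
      rw [weightMeasure, withDensity_congr_ae h0]; exact withDensity_zero
    rw [this, eLpNorm_measure_zero]
    exact zero_le
  have hp0 : 0 < p := by linarith
  have hpq := Real.HolderConjugate.conjExponent hp
  set q := p.conjExponent with hq
  -- a measurable, positive and finite version of the weight
  set W₁ := hw.aemeasurable.mk (toWeight w) with hW₁
  have hW₁m : Measurable W₁ := hw.aemeasurable.measurable_mk
  set N : Set (Rn n) := {x | W₁ x = 0 ∨ W₁ x = ⊤} with hN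
  have hNm : MeasurableSet N :=
    (hW₁m (measurableSet_singleton 0)).union (hW₁m (measurableSet_singleton ⊤))
  classical
  set W : Rn n → ℝ≥0∞ := fun x => if x ∈ N then 1 else W₁ x with hWdef
  have hWm : Measurable W := Measurable.ite hNm measurable_const hW₁m
  have hWae : toWeight w =ᵐ[volume] W := by
    filter_upwards [hw.aemeasurable.ae_eq_mk, hpos] with x hx hx0
    have : x ∉ N := by
      rintro (h1 | h1)
      · exact hx0 (hx.trans h1)
      · exact ENNReal.ofReal_ne_top (hx.trans h1)
    simp only [hWdef, this, if_false]
    exact hx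
  have hW0 : ∀ x, W x ≠ 0 := by
    intro x
    simp only [hWdef]
    split_ifs with hx
    · exact one_ne_zero
    · exact fun h1 => hx (Or.inl h1)
  have hWt : ∀ x, W x ≠ ⊤ := by
    intro x
    simp only [hWdef]
    split_ifs with hx
    · exact ENNReal.one_ne_top
    · exact fun h1 => hx (Or.inr h1)
  set σ : Rn n → ℝ≥0∞ := fun x => W x ^ (1 - q) with hσdef
  have hσae : dualWeight p (toWeight w) =ᵐ[volume] σ := by
    filter_upwards [hWae] with x hx
    rw [dualWeight, hx]
  have hWc : ∀ A : Set (Rn n), ∫⁻ x in A, toWeight w x = ∫⁻ x in A, W x := fun A =>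
    lintegral_congr_ae (ae_restrict_of_ae hWae)
  have hσc : ∀ A : Set (Rn n), ∫⁻ x in A, dualWeight p (toWeight w) x = ∫⁻ x in A, σ x := fun A =>
    lintegral_congr_ae (ae_restrict_of_ae hσae)
  have hWw : IsWeight W := ⟨hWm, hW0, fun c r => by
    rw [← hWc]; exact hw.lintegral_cube_ne_top hn c r⟩
  have hσw : IsWeight σ := by
    refine ⟨hWm.pow_const _, fun x => (ENNReal.rpow_pos (pos_iff_ne_zero.2 (hW0 x)) (hWt x)).ne',
      fun c r => ?_⟩
    have hr : 0 < max r 1 := by positivity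
    have h1 := hw.dual_ne_top hp (c := c) hr (by
      rw [hWc]; exact hWw.setLIntegral_ne_zero (volume_cube_ne_zero c hr))
    rw [hσc] at h1
    exact ne_top_of_le_ne_top h1 (lintegral_mono_set (cube_mono c (le_max_left _ _)))
  have hσt : ∀ x, σ x ≠ ⊤ := fun x => ENNReal.rpow_ne_top_of_ne_zero (hW0 x) (hWt x)
  have hrel : ∀ x, σ x ^ (1 - p) = W x := by
    intro x
    simp only [hσdef]
    rw [← ENNReal.rpow_mul]
    have : (1 - q) * (1 - p) = 1 := by linarith [hpq.mul_eq_add]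
    rw [this, ENNReal.rpow_one]
  have hA : ∀ c r, 0 < r → ((∫⁻ x in cube c r, W x) / volume (cube c r)) ^ (1 / p) *
      ((∫⁻ x in cube c r, σ x) / volume (cube c r)) ^ (1 / q) ≤
        apConst p (toWeight w) ^ (1 / p) := by
    intro c r hr
    have h1 : ((∫⁻ x in cube c r, toWeight w x) / volume (cube c r)) *
      ((∫⁻ x in cube c r, dualWeight p (toWeight w) x) / volume (cube c r)) ^ (p - 1) ≤
        apConst p (toWeight w) := le_iSup_of_le c (le_iSup_of_le r (le_iSup_of_le hr le_rfl))
    rw [hWc, hσc] at h1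
    refine le_trans (le_of_eq ?_) (ENNReal.rpow_le_rpow h1 (by positivity : 0 ≤ 1 / p))
    rw [ENNReal.mul_rpow_of_nonneg _ _ (by positivity), ← ENNReal.rpow_mul]
    congr 2
    have hq0 := hpq.symm.pos
    have := hpq.mul_eq_add
    field_simp
    linarith
  have hμ : weightMeasure w = volume.withDensity W := withDensity_congr_ae hWae
  -- As `W` is positive, changing f on a set of weighted measure zero changes it on a Lebesgue null
  -- set only, so the square function is unaffected.
  have hac : (volume : Measure (Rn n)) ≪ volume.withDensity W :=
    withDensity_absolutelyContinuous' hWm.aemeasurable (ae_of_all _ hW0)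
  have hpt : (ENNReal.ofReal p).toReal = p := ENNReal.toReal_ofReal hp0.le
  have hpo : ENNReal.ofReal p ≠ 0 := by simpa using hp0
  rw [hμ] at hf ⊢
  obtain ⟨g, hgm, hfg⟩ := hf.1
  have hfg' : f =ᵐ[volume] g := hac.ae_le hfg
  have hgp : ∫⁻ x, ‖g x‖ₑ ^ p ∂(volume.withDensity W) = ∫⁻ x, ‖g x‖ₑ ^ p * W x := by
    rw [lintegral_withDensity_eq_lintegral_mul _ hWm (hgm.measurable.enorm.pow_const p)]
    exact lintegral_congr fun x => mul_comm _ _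
  have hnorm : eLpNorm f (ENNReal.ofReal p) (volume.withDensity W) =
      (∫⁻ x, ‖g x‖ₑ ^ p * W x) ^ (1 / p) := by
    rw [eLpNorm_congr_ae hfg, eLpNorm_eq_lintegral_rpow_enorm_toReal hpo ENNReal.ofReal_ne_top, hpt,
      hgp]
  have hfin : ∫⁻ x, ‖g x‖ₑ ^ p * W x ≠ ⊤ := by
    intro htop
    have := hf.2
    rw [hnorm, htop, ENNReal.top_rpow_of_pos (by positivity)] at this
    exact lt_irrefl _ this
  have main := h.sqFn_weighted hn hpq hWw hσw hA hσt hrel hgm.measurable hfin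
  rw [hnorm, sqFn_congr hfg', eLpNorm_eq_lintegral_rpow_enorm_toReal hpo ENNReal.ofReal_ne_top, hpt]
  simp only [enorm_eq_self]
  rw [braceConst, aInftyConst_congr hWae, aInftyConst_congr hσae]
  exact main

end IsKernelFamily

end RoughSquare

namespace RoughSquare

/-! ### Scaling of kernel families -/

variable {n : ℕ}

lemma sqFn_const_mul (ψ : ℤ → Rn n → ℂ) {a : ℝ} (ha : 0 ≤ a) (f : Rn n → ℂ) (x : Rn n) :
    sqFn (fun k x => (a : ℂ) * ψ k x) f x = ENNReal.ofReal a * sqFn ψ f x := by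
  have h : ∀ k, ((fun x => (a : ℂ) * ψ k x) ⋆[ContinuousLinearMap.mul ℂ ℂ, volume] f) x =
      (a : ℂ) * (ψ k ⋆[ContinuousLinearMap.mul ℂ ℂ, volume] f) x := by
    intro k
    rw [convolution_mul_swap, convolution_mul_swap, ← integral_const_mul]
    exact integral_congr_ae (ae_of_all _ fun y => mul_assoc _ _ _)
  have ha' : ‖(a : ℂ)‖ₑ = ENNReal.ofReal a := by
    rw [← ofReal_norm, Complex.norm_real, Real.norm_of_nonneg ha]
  simp only [sqFn, h, enorm_mul, mul_pow, ENNReal.tsum_mul_left, ha']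
  rw [ENNReal.mul_rpow_of_nonneg _ _ (by norm_num), ← ENNReal.rpow_natCast, ← ENNReal.rpow_mul]
  norm_num

/-- Homogeneity reduces all estimates to constant one. For A = 0 the size bound forces the kernels
to vanish, and the zero family serves. -/
lemma IsKernelFamily.exists_normalized {ψ : ℤ → Rn n → ℂ} {A : ℝ} (h : IsKernelFamily ψ A) :
    ∃ ψ', IsKernelFamily ψ' 1 ∧ ψ = fun k x => (A : ℂ) * ψ' k x := by
  rcases h.nonneg.eq_or_lt with rfl | hA
  · refine ⟨0, ⟨?_, ?_, ?_, ?_⟩, ?_⟩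
    · intro k x hx; exact absurd rfl hx
    · intro k x; simp only [Pi.zero_apply, norm_zero]; positivity
    · intro k x y; simp only [Pi.zero_apply, sub_self, norm_zero]; positivity
    · intro k; simp
    · ext k x
      have := h.bound k x
      rw [zero_mul] at this
      simpa using this
  · refine ⟨_, by simpa [hA.ne'] using h.smul A⁻¹ (by positivity), ?_⟩
    ext k x
    rw [← mul_assoc, mul_inv_cancel₀ (by exact_mod_cast hA.ne'), one_mul]

lemma grandMaximal_const_mul {U U' : (Rn n → ℂ) → Rn n → ℝ≥0∞} {a : ℝ≥0∞}
    (h : ∀ f x, U f x = a * U' f x) (f : Rn n → ℂ) (x : Rn n) :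
    grandMaximal U f x = a * grandMaximal U' f x := by
  have h1 : ∀ g, U g = fun x => a * U' g x := fun g => funext (h g)
  simp only [grandMaximal, ENNReal.mul_iSup, h1, ENNReal.essSup_const_mul]

lemma weakL1_const_mul_le {g : Rn n → ℝ≥0∞} {B a : ℝ≥0∞} (ha : a ≠ ⊤)
    (hg : ∀ t : ℝ≥0, t * volume {x | (t : ℝ≥0∞) < g x} ≤ B) :
    weakL1 (fun x => a * g x) ≤ a * B := by
  refine iSup_le fun t => ?_
  rcases eq_or_ne a 0 with rfl | ha0
  · simp
  have ht : (t : ℝ≥0∞) / a ≠ ⊤ := ENNReal.div_ne_top ENNReal.coe_ne_top ha0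
  have h1 := hg (t / a : ℝ≥0∞).toNNReal
  rw [ENNReal.coe_toNNReal ht] at h1
  have e : {x | (t : ℝ≥0∞) < a * g x} = {x | (t : ℝ≥0∞) / a < g x} := by
    ext x
    simp only [Set.mem_ofPred_eq]
    rw [ENNReal.div_lt_iff (Or.inl ha0) (Or.inl ha), mul_comm]
  rw [e]
  calc _ = a * (t / a * volume {x | (t : ℝ≥0∞) / a < g x}) := by
        rw [← mul_assoc, ENNReal.mul_div_cancel ha0 ha]
    _ ≤ _ := mul_le_mul' le_rfl h1

lemma eLpNorm_const_mul_ennreal {X : Type*} [MeasurableSpace X] {μ : Measure X} {g : X → ℝ≥0∞}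
    {a : ℝ≥0∞} (ha : a ≠ ⊤) {r : ℝ≥0∞} (hr0 : r ≠ 0) (hrt : r ≠ ⊤) :
    eLpNorm (fun x => a * g x) r μ = a * eLpNorm g r μ := by
  have hr : 0 < r.toReal := ENNReal.toReal_pos hr0 hrt
  rw [eLpNorm_eq_lintegral_rpow_enorm_toReal hr0 hrt, eLpNorm_eq_lintegral_rpow_enorm_toReal hr0 hrt]
  simp only [enorm_eq_self, ENNReal.mul_rpow_of_nonneg _ _ hr.le]
  rw [lintegral_const_mul' _ _ (ENNReal.rpow_ne_top_of_nonneg hr.le ha),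
    ENNReal.mul_rpow_of_nonneg _ _ (by positivity), ← ENNReal.rpow_mul, mul_one_div_cancel hr.ne',
    ENNReal.rpow_one]

lemma ofReal_mul_const_le {c C b : ℝ} (h : 0 ≤ c * C) {X : ℝ≥0∞} (hX : X ≠ ⊤) (hXb : X.toReal ≤ b) :
    ENNReal.ofReal (c * C) * X ≤ ENNReal.ofReal (c * b * C) := by
  calc _ = ENNReal.ofReal (c * C) * ENNReal.ofReal X.toReal := by rw [ENNReal.ofReal_toReal hX]
    _ = ENNReal.ofReal (c * C * X.toReal) := (ENNReal.ofReal_mul h).symm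
    _ ≤ ENNReal.ofReal (c * C * b) := ENNReal.ofReal_le_ofReal (mul_le_mul_of_nonneg_left hXb h)
    _ = _ := by rw [mul_right_comm]

namespace IsKernelFamily

variable {ψ : ℤ → Rn n → ℂ}

lemma eLpNorm_sqFn_le (h : IsKernelFamily ψ 1) {f : Rn n → ℂ} (hf : MemLp f 2) :
    eLpNorm (sqFn ψ f) 2 volume ≤ l2Const n ^ (1 / 2 : ℝ) * eLpNorm f 2 volume := by
  rw [eLpNorm_eq_lintegral_rpow_enorm_toReal (by simp) (by simp),
    eLpNorm_eq_lintegral_rpow_enorm_toReal (by simp) (by simp)]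
  simp only [enorm_eq_self, ENNReal.toReal_ofNat, ENNReal.rpow_two]
  rw [← ENNReal.mul_rpow_of_nonneg _ _ (by norm_num)]
  exact ENNReal.rpow_le_rpow (h.sqFn_L2 hf) (by norm_num)

/-- The constant in the Lipschitz condition. -/
noncomputable def lipConst (n : ℕ) : ℝ≥0∞ := geomConst (n + 1) * 2 ^ (n + 1) * 2 ^ (n + 1)

lemma lipConst_ne_top (n : ℕ) : lipConst n ≠ ⊤ :=
  ENNReal.mul_ne_top (ENNReal.mul_ne_top (geomConst_ne_top (by positivity)) (by simp)) (by simp)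

lemma tsum_sub_rpow_le (h : IsKernelFamily ψ 1) {γ : ℝ} (hγ1 : γ ≤ 1)
    {x y : Rn n} (hy : 0 < 2 * ‖y‖) (hyx : 2 * ‖y‖ ≤ ‖x‖) :
    ∑' k, ‖ψ k (x - y) - ψ k x‖ₑ ≤
      lipConst n * ENNReal.ofReal (‖y‖ ^ γ / ‖x‖ ^ ((n : ℝ) + γ)) := by
  have hx0 : 0 < ‖x‖ := hy.trans_le hyx
  have hy0 : 0 < ‖y‖ := by linarith
  have h1 : ‖x‖ / 2 ≤ ‖x - y‖ := by
    have := norm_sub_norm_le x y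
    linarith
  refine (h.tsum_sub_le (half_pos hx0) h1 (by linarith)).trans ?_
  rw [lipConst, mul_assoc (geomConst _ * _)]
  refine mul_le_mul' le_rfl ?_
  have e : (2 : ℝ≥0∞) ^ (n + 1) = ENNReal.ofReal (2 ^ (n + 1)) := by
    rw [ENNReal.ofReal_pow (by norm_num)]; norm_num
  rw [e, ← ENNReal.ofReal_mul (by positivity)]
  refine ENNReal.ofReal_le_ofReal ?_
  rw [sub_sub_cancel_left, norm_neg, div_pow, div_div_eq_mul_div, mul_comm, mul_div_assoc]
  refine mul_le_mul_of_nonneg_left ?_ (by positivity)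
  -- The ratio is at most 1/2, so γ = 1 is the strongest case and implies the others.
  have h2 : ‖y‖ / ‖x‖ ≤ (‖y‖ / ‖x‖) ^ γ := by
    have := Real.rpow_le_rpow_of_exponent_ge (x := ‖y‖ / ‖x‖) (by positivity)
      ((div_le_one hx0).2 (by linarith)) hγ1
    rwa [Real.rpow_one] at this
  rw [Real.rpow_add hx0, Real.rpow_natCast, pow_succ, mul_comm (‖x‖ ^ n), mul_comm (‖x‖ ^ n),
    ← div_div, ← div_div, ← Real.div_rpow hy0.le hx0.le]
  gcongr

end IsKernelFamily

end RoughSquare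

/-! ### The theorem, with the constants put together. -/

theorem proposition1p8 (n : ℕ) (hn : 1 ≤ n) (φ : Rn n → ℝ) (hφ : IsProfile φ) :
    (∃ c : ℝ, 0 < c ∧ ∀ (K : Rn n → ℂ) (C : ℝ), IsRoughKernel K C →
      -- the principal values defining `φ_k * K_k` converge
      (∀ (k : ℤ) (x : Rn n),
        Tendsto (fun ε => epsConv φ K k ε x) (𝓝[>] (0 : ℝ)) (𝓝 (smoothKernel φ K k x))) ∧
      -- size condition
      (∀ (k : ℤ) (x : Rn n), x ≠ 0 →
        ‖smoothKernel φ K k x‖ ≤ c * (C / (2 : ℝ) ^ (k * (n : ℤ)))) ∧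
      -- Lipschitz condition
      (∀ γ : ℝ, 0 < γ → γ ≤ 1 → ∀ x y : Rn n, 0 < 2 * ‖y‖ → 2 * ‖y‖ ≤ ‖x‖ →
        ∑' k : ℤ, ‖smoothKernel φ K k (x - y) - smoothKernel φ K k x‖ₑ
          ≤ ENNReal.ofReal (c * C * (‖y‖ ^ γ / ‖x‖ ^ ((n : ℝ) + γ)))) ∧
      -- boundedness on `L²`
      (∀ f : Rn n → ℂ, MemLp f 2 volume →
        eLpNorm (squareFn φ K f) 2 volume ≤ ENNReal.ofReal (c * C) * eLpNorm f 2 volume) ∧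
      -- weak type (1,1) of the square function
      (∀ f : Rn n → ℂ, MemLp f 1 volume →
        weakL1 (squareFn φ K f) ≤ ENNReal.ofReal (c * C) * eLpNorm f 1 volume) ∧
      -- weak type (1,1) of its grand maximal truncated operator
      (∀ f : Rn n → ℂ, MemLp f 1 volume →
        weakL1 (grandMaximal (squareFn φ K) f)
          ≤ ENNReal.ofReal (c * C) * eLpNorm f 1 volume)) ∧
    -- sharp weighted norm inequalities
    (∀ p : ℝ, 1 < p → ∃ c : ℝ, 0 < c ∧ ∀ (K : Rn n → ℂ) (C : ℝ), IsRoughKernel K C →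
      ∀ w : Rn n → ℝ, IsApWeight p w →
        ∀ f : Rn n → ℂ, MemLp f (ENNReal.ofReal p) (weightMeasure w) →
          eLpNorm (squareFn φ K f) (ENNReal.ofReal p) (weightMeasure w)
            ≤ ENNReal.ofReal (c * C) * braceConst p (toWeight w)
              * eLpNorm f (ENNReal.ofReal p) (weightMeasure w)) := by
  obtain ⟨c₀, hc₀, hfam⟩ := exists_isKernelFamily hn hφ
  refine ⟨?_, ?_⟩
  · set X₁ := IsKernelFamily.l2Const n ^ (1 / 2 : ℝ)
    set X₂ := IsKernelFamily.weakConst n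
    set X₃ := IsKernelFamily.grandConst n
    set X₄ := IsKernelFamily.lipConst n
    have hX₁ : X₁ ≠ ⊤ :=
      ENNReal.rpow_ne_top_of_nonneg (by norm_num) (IsKernelFamily.l2Const_ne_top n)
    have hX₂ : X₂ ≠ ⊤ := IsKernelFamily.weakConst_ne_top n
    have hX₃ : X₃ ≠ ⊤ := IsKernelFamily.grandConst_ne_top n
    have hX₄ : X₄ ≠ ⊤ := IsKernelFamily.lipConst_ne_top n
    -- One constant has to serve all estimates; the summand 1 is the one used by the size condition.
    set b := 1 + X₁.toReal + X₂.toReal + X₃.toReal + X₄.toReal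
    have p₁ : 0 ≤ X₁.toReal := ENNReal.toReal_nonneg
    have p₂ : 0 ≤ X₂.toReal := ENNReal.toReal_nonneg
    have p₃ : 0 ≤ X₃.toReal := ENNReal.toReal_nonneg
    have p₄ : 0 ≤ X₄.toReal := ENNReal.toReal_nonneg
    have hb1 : 1 ≤ b := by simp only [b]; linarith
    refine ⟨c₀ * b, by positivity, fun K C hK => ?_⟩
    have hC := hK.nonneg hn
    have hψ := hfam K C hK
    obtain ⟨ψ, hψ1, hψe⟩ := hψ.exists_normalized
    have hA0 : 0 ≤ c₀ * C := by positivity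
    have hsq : ∀ f x, squareFn φ K f x = ENNReal.ofReal (c₀ * C) * sqFn ψ f x := by
      intro f x
      rw [← sqFn_const_mul ψ hA0 f x, ← hψe]
      rfl
    have hsq' : ∀ f, squareFn φ K f = fun x => ENNReal.ofReal (c₀ * C) * sqFn ψ f x :=
      fun f => funext (hsq f)
    have hbd : ∀ {X : ℝ≥0∞}, X ≠ ⊤ → X.toReal ≤ b →
        ENNReal.ofReal (c₀ * C) * X ≤ ENNReal.ofReal (c₀ * b * C) :=
      fun hX hXb => ofReal_mul_const_le hA0 hX hXb
    have hL1 : ∀ f : Rn n → ℂ, ∫⁻ x, ‖f x‖ₑ = eLpNorm f 1 volume := fun f =>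
      eLpNorm_one_eq_lintegral_enorm.symm
    refine ⟨?_, ?_, ?_, ?_, ?_, ?_⟩
    · intro k x
      rw [smoothKernel_eq hn hφ hK]
      exact tendsto_epsConv hn hφ hK k x
    · intro k x _
      refine (hψ.bound k x).trans ?_
      rw [zpow_mul, zpow_natCast, zpow_neg, inv_pow, ← div_eq_mul_inv, mul_div_assoc]
      rw [mul_assoc]
      refine mul_le_mul_of_nonneg_left ?_ hc₀.le
      exact le_mul_of_one_le_left (by positivity) hb1
    · intro γ _ hγ1 x y hy hyx
      have h1 := hψ1.tsum_sub_rpow_le hγ1 hy hyx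
      have h2 : ∀ k, ‖smoothKernel φ K k (x - y) - smoothKernel φ K k x‖ₑ =
          ENNReal.ofReal (c₀ * C) * ‖ψ k (x - y) - ψ k x‖ₑ := by
        intro k
        rw [hψe]
        simp only []
        rw [← mul_sub, enorm_mul, ← ofReal_norm, Complex.norm_real, Real.norm_of_nonneg hA0]
      simp only [h2]
      rw [ENNReal.tsum_mul_left, ENNReal.ofReal_mul (p := c₀ * b * C) (by positivity)]
      refine (mul_le_mul' le_rfl h1).trans ?_
      rw [← mul_assoc]
      exact mul_le_mul' (hbd hX₄ (by simp only [b]; linarith)) le_rfl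
    · intro f hf
      rw [hsq', eLpNorm_const_mul_ennreal ENNReal.ofReal_ne_top (by simp) (by simp)]
      refine (mul_le_mul' le_rfl (hψ1.eLpNorm_sqFn_le hf)).trans ?_
      rw [← mul_assoc]
      exact mul_le_mul' (hbd hX₁ (by simp only [b]; linarith)) le_rfl
    · intro f hf
      rw [hsq']
      refine (weakL1_const_mul_le ENNReal.ofReal_ne_top
        (hψ1.sqFn_weak hn (memLp_one_iff_integrable.1 hf))).trans ?_
      rw [← mul_assoc, hL1]
      exact mul_le_mul' (hbd hX₂ (by simp only [b]; linarith)) le_rfl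
    · intro f hf
      have e : grandMaximal (squareFn φ K) f =
          fun x => ENNReal.ofReal (c₀ * C) * grandMaximal (sqFn ψ) f x :=
        funext fun x => grandMaximal_const_mul hsq f x
      rw [e]
      refine (weakL1_const_mul_le ENNReal.ofReal_ne_top
        (hψ1.grandMaximal_weak hn (memLp_one_iff_integrable.1 hf))).trans ?_
      rw [← mul_assoc, hL1]
      exact mul_le_mul' (hbd hX₃ (by simp only [b]; linarith)) le_rfl
  · intro p hp
    have hpq := Real.HolderConjugate.conjExponent hp
    set X := IsKernelFamily.weightConst n p p.conjExponent
    have hX : X ≠ ⊤ := IsKernelFamily.weightConst_ne_top n hpq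
    have hX0 : 0 ≤ X.toReal := ENNReal.toReal_nonneg
    refine ⟨c₀ * (1 + X.toReal), by positivity, fun K C hK w hw f hf => ?_⟩
    have hC := hK.nonneg hn
    obtain ⟨ψ, hψ1, hψe⟩ := (hfam K C hK).exists_normalized
    have hA0 : 0 ≤ c₀ * C := by positivity
    have hsq : squareFn φ K f = fun x => ENNReal.ofReal (c₀ * C) * sqFn ψ f x := by
      ext x
      rw [← sqFn_const_mul ψ hA0 f x, ← hψe]
      rfl
    rw [hsq, eLpNorm_const_mul_ennreal ENNReal.ofReal_ne_top (by simp; linarith) (by simp)]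
    refine (mul_le_mul' le_rfl (hψ1.eLpNorm_sqFn_weighted hn hp hw hf)).trans ?_
    rw [← mul_assoc, ← mul_assoc]
    exact mul_le_mul' (mul_le_mul' (ofReal_mul_const_le hA0 hX (by linarith)) le_rfl) le_rfl
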